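/- Let $k$ be a field in which every element has a square root. Let $(H,R,\kappa)$ be a finite-dimensional ribbon Hopf algebra over $k$: $H$ is a finite-dimensional Hopf algebra with comultiplication $\Delta x=x_{(1)}\otimes x_{(2)}$, counit $\varepsilon$ and invertible antipode $\gamma$; $R=\sum_i R_i'\otimes R_i''\in H\otimes H$ is invertible with $(\Delta\otimes 1)R=R^{13}R^{23}$, $(1\otimes\Delta)R=R^{13}R^{12}$ and $\Delta^{\mathrm{op}}(a)=R\,\Delta(a)R^{-1}$; and $\kappa\in H$ is grouplike with $\kappa a\kappa^{-1}=\gamma^2(a)$ for all $a\in H$ and $\kappa^2=u_1u_4$, where $u_1=\sum_i\gamma(R_i'')R_i'$ and $u_4=\sum_i\gamma^2(R_i')R_i''$. Let $\nu=\sum_i R_i''\kappa R_i'$, and let $\mathfrak u\subset H$ be the smallest subspace with $R^{12}R^{21}=\sum_{i,j}R_i'R_j''\otimes R_i''R_j'\in\mathfrak u\otimes H$. Let $\int:H\to k$ be a left integral on $H$, that is, a nonzero linear functional with $x_{(1)}\int(x_{(2)})=\int(x)\,1$ for all $x\in H$. A category $\mathcal C$ is called 3-modular if it is a noetherian abelian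 $k$-linear ribbon category (braiding $c$, ribbon twist $\theta$, duals $X^\vee$ with evaluations $\mathrm{ev}:X\otimes X^\vee\to I$) with finite-dimensional spaces of morphisms and $\operatorname{End} I=k$, such that the following hold. * The coend $F=\int^L L\otimes L^\vee$, with structure maps $i_L:L\otimes L^\vee\to F$, is an object of $\mathcal C$. It carries the multiplication $m_F$ given by $i_{L\otimes M}\circ(L\otimes c_{L^\vee,M\otimes M^\vee})$ on $L\otimes L^\vee\otimes M\otimes M^\vee$ (with $(L\otimes M)^\vee\cong M^\vee\otimes L^\vee$), the counit $\varepsilon_F$ given by $\mathrm{ev}$, the pairing $\omega:F\otimes F\to I$ given by $(\mathrm{ev}\otimes\mathrm{ev})(L\otimes c^2\otimes M^\vee)$, the monodromies $\Omega_r:F\otimes X\to F\otimes X$ given by $L\otimes c^2$, and the automorphism $\underline{\theta\otimes1}$ given by $\theta_L\otimes L^\vee$. Let $\pi:F\to\mathbf f=F/\operatorname{Ann}\omega$ be the quotient by the annihilator of $\omega$, with the operations induced on it. * (M2) $\underline{\theta\otimes1}$ preserves $\operatorname{Ann}\omega$, and so induces $T:\mathbf f\to\mathbf f$. * (M3) There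 is a two-sided integral $\sigma:I\to F$ such that $\pi\sigma=\mu$, where $\mu:I\to\mathbf f$ is the normalized integral of $\mathbf f$: a two-sided integral for which there is $\lambda\in k^\times$ such that for all $X$ the composition $X\to\mathbf f\otimes X\xrightarrow{\Omega_r}\mathbf f\otimes X\xrightarrow{\varepsilon_{\mathbf f}\otimes X}X$ equals $\lambda\theta_X^{-1}$ if the first arrow is $T\mu\otimes X$, and $\lambda^{-1}\theta_X$ if the first arrow is $T^{-1}\mu\otimes X$. Theorem. The category $H$-mod of finite-dimensional $H$-modules, with braiding $x\otimes y\mapsto\sum_i R_i''y\otimes R_i'x$, with $X^\vee$ the dual space with action $(h\xi)(x)=\xi(\gamma^{-1}(h)x)$, and with twist the multiplication by $\nu$, is 3-modular if and only if the following three conditions hold: 1. $\nu\in\mathfrak u$; 2. $\int(xy)=\int(y\,\gamma^2(x))$ for all $x,y\in H$; 3. $\sum_{i,j}\int(R_i'R_j'')\,R_i''R_j'\ne0$. Moreover, condition 2 holds if and only if $H$ is unimodular, that is, every left integral $\Lambda\in H$ (an element with $x\Lambda=\varepsilon(x)\Lambda$ for all $x\in H$) is also a right integral ($\Lambda x=\varepsilon(x)\Lambda$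 for all $x\in H$). -/

import Mathlib

open CategoryTheory MonoidalCategory TensorProduct

universe w v u

noncomputable section

namespace RibbonHopf

/-! ### Three-modular categories -/

section Modular

variable {C : Type v} [Category.{w} C] [MonoidalCategory C] [BraidedCategory C] [RigidCategory C]

/- The dual `X^∨` with evaluation `X ⊗ X^∨ ⟶ 𝟙` and coevaluation `𝟙 ⟶ X^∨ ⊗ X` is `ᘁX`. -/

/-- A ribbon twist: a natural automorphism `θ` of the identity functor with
`c² = (θ_X⁻¹ ⊗ θ_Y⁻¹) ∘ θ_{X ⊗ Y}` and `θ_{X^∨} = (θ_X)^t`. -/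
structure IsRibbonTwist (θ : 𝟭 C ⟶ 𝟭 C) : Prop where
  isIso : ∀ X : C, IsIso (θ.app X)
  tensor : ∀ X Y : C,
    θ.app (X ⊗ Y) = (β_ X Y).hom ≫ (β_ Y X).hom ≫ (θ.app X ⊗ₘ θ.app Y)
  dual : ∀ X : C, θ.app (ᘁX : C) = (ᘁ(θ.app X) : (ᘁX : C) ⟶ ᘁX)

/-- The evaluation `L ⊗ L^∨ ⟶ 𝟙`. -/
def ev (L : C) : L ⊗ (ᘁL : C) ⟶ 𝟙_ C := ε_ (ᘁL : C) L

/-- The double braiding `c² : X ⊗ Y ⟶ X ⊗ Y`. -/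
def doubleBraiding (X Y : C) : X ⊗ Y ⟶ X ⊗ Y := (β_ X Y).hom ≫ (β_ Y X).hom

/-- `L ⊗ L^∨ ⊗ M ⊗ M^∨ ⟶ L ⊗ M ⊗ M^∨ ⊗ L^∨ ≅ (L ⊗ M) ⊗ (L ⊗ M)^∨`: the strand `L^∨` is
braided past `M ⊗ M^∨` by `L ⊗ c`. -/
def mulTangle (L M : C) :
    (L ⊗ (ᘁL : C)) ⊗ (M ⊗ (ᘁM : C)) ⟶ (L ⊗ M) ⊗ (ᘁ(L ⊗ M) : C) :=
  (α_ L (ᘁL) (M ⊗ ᘁM)).hom ≫ L ◁ (β_ (ᘁL) (M ⊗ ᘁM)).hom ≫ L ◁ (α_ M (ᘁM) (ᘁL)).hom ≫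
    (α_ L M ((ᘁM : C) ⊗ (ᘁL : C))).inv ≫ (L ⊗ M) ◁ (leftDualTensorIso L M).inv

/-- `L ⊗ c² : L ⊗ L^∨ ⊗ X ⟶ L ⊗ L^∨ ⊗ X`. -/
def monodromyTangle (L X : C) : (L ⊗ (ᘁL : C)) ⊗ X ⟶ (L ⊗ (ᘁL : C)) ⊗ X :=
  (α_ L (ᘁL) X).hom ≫ L ◁ doubleBraiding (ᘁL) X ≫ (α_ L (ᘁL) X).inv

/-- `(ev ⊗ ev) ∘ (L ⊗ c² ⊗ M^∨) : L ⊗ L^∨ ⊗ M ⊗ M^∨ ⟶ 𝟙`. -/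
def pairingTangle (L M : C) : (L ⊗ (ᘁL : C)) ⊗ (M ⊗ (ᘁM : C)) ⟶ 𝟙_ C :=
  (α_ (L ⊗ (ᘁL : C)) M (ᘁM)).inv ≫ monodromyTangle L M ▷ (ᘁM) ≫
    (α_ (L ⊗ (ᘁL : C)) M (ᘁM)).hom ≫ (ev L ⊗ₘ ev M) ≫ (λ_ (𝟙_ C)).hom

variable (C) in
/-- A coend `F = ∫ L ⊗ L^∨` lying in `C`, with its multiplication, counit, pairing `ω` and
monodromies `Ω_r : F ⊗ X ⟶ F ⊗ X`. As `F` is a coend and the tensor product is exact in each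
variable, each of these morphisms is determined by the equation given for it. -/
structure CoendAlgebra where
  F : C
  ι : ∀ L : C, L ⊗ (ᘁL : C) ⟶ F
  dinatural : ∀ {L M : C} (g : L ⟶ M),
    g ▷ (ᘁM : C) ≫ ι M = L ◁ (ᘁg : (ᘁM : C) ⟶ ᘁL) ≫ ι L
  universal : ∀ (Y : C) (j : ∀ L : C, L ⊗ (ᘁL : C) ⟶ Y),
    (∀ {L M : C} (g : L ⟶ M), g ▷ (ᘁM : C) ≫ j M = L ◁ (ᘁg : (ᘁM : C) ⟶ ᘁL) ≫ j L) →
      ∃! φ : F ⟶ Y, ∀ L : C, ι L ≫ φ = j L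
  mul : F ⊗ F ⟶ F
  mul_spec : ∀ L M : C, (ι L ⊗ₘ ι M) ≫ mul = mulTangle L M ≫ ι (L ⊗ M)
  counit : F ⟶ 𝟙_ C
  counit_spec : ∀ L : C, ι L ≫ counit = ev L
  ω : F ⊗ F ⟶ 𝟙_ C
  ω_spec : ∀ L M : C, (ι L ⊗ₘ ι M) ≫ ω = pairingTangle L M
  Ω : ∀ X : C, F ⊗ X ⟶ F ⊗ X
  Ω_spec : ∀ L X : C, ι L ▷ X ≫ Ω X = monodromyTangle L X ≫ ι L ▷ X

/-- The morphism `\underline{θ ⊗ 1} : F ⟶ F`. -/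
def CoendAlgebra.IsTwist (D : CoendAlgebra C) (θ : 𝟭 C ⟶ 𝟭 C) (T : D.F ⟶ D.F) : Prop :=
  ∀ L : C, D.ι L ≫ T = θ.app L ▷ (ᘁL : C) ≫ D.ι L

/-- `s : 𝟙 ⟶ B` is a two-sided integral with respect to a multiplication and a counit of `B`. -/
def IsTwoSidedIntegral {B : C} (m : B ⊗ B ⟶ B) (e : B ⟶ 𝟙_ C) (s : 𝟙_ C ⟶ B) : Prop :=
  B ◁ s ≫ m = (ρ_ B).hom ≫ e ≫ s ∧ s ▷ B ≫ m = (λ_ B).hom ≫ e ≫ s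

/-- The quotient `π : F ⟶ f = F / Ann ω`, with the operations induced on it. In an abelian
category, `epi` and `ann` say that `π` is an epimorphism whose kernel is the largest subobject
`A` of `F` with `ω ∘ (A ⊗ F) = 0`. -/
structure CoendAlgebra.QuotientAlgebra [Preadditive C] (D : CoendAlgebra C) where
  f : C
  π : D.F ⟶ f
  epi : Epi π
  ann : ∀ {Y : C} (g : Y ⟶ D.F), g ≫ π = 0 ↔ g ▷ D.F ≫ D.ω = 0
  mul : f ⊗ f ⟶ f
  mul_spec : (π ⊗ₘ π) ≫ mul = D.mul ≫ π
  counit : f ⟶ 𝟙_ C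
  counit_spec : π ≫ counit = D.counit
  Ω : ∀ X : C, f ⊗ X ⟶ f ⊗ X
  Ω_spec : ∀ X : C, π ▷ X ≫ Ω X = D.Ω X ≫ π ▷ X

/-- For `t : 𝟙 ⟶ f`, the endomorphism `𝟙 ⊗ X ⟶ f ⊗ X ⟶ f ⊗ X ⟶ 𝟙 ⊗ X ≅ X` given by `t ⊗ X`,
the monodromy `Ω_r` and the counit. -/
def CoendAlgebra.QuotientAlgebra.loop [Preadditive C] {D : CoendAlgebra C}
    (Q : D.QuotientAlgebra) (t : 𝟙_ C ⟶ Q.f) (X : C) : 𝟙_ C ⊗ X ⟶ X :=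
  t ▷ X ≫ Q.Ω X ≫ Q.counit ▷ X ≫ (λ_ X).hom

/-- `μ : 𝟙 ⟶ f` is the normalized integral of `f`, with constant `lam`; `T : f ⟶ f` is the
automorphism induced by `\underline{θ ⊗ 1}`. The two equations say that the loop coloured by
`T μ` acts on each `X` by `lam θ_X⁻¹`, and that the loop coloured by `T⁻¹ μ` acts on each `X`
by `lam⁻¹ θ_X`. -/
structure CoendAlgebra.QuotientAlgebra.IsNormalizedIntegral {k : Type u} [Field k]
    [Preadditive C] [Linear k C] {D : CoendAlgebra C} (Q : D.QuotientAlgebra) (θ : 𝟭 C ⟶ 𝟭 C)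
    (T : Q.f ⟶ Q.f) (μ : 𝟙_ C ⟶ Q.f) (lam : kˣ) : Prop where
  integral : IsTwoSidedIntegral Q.mul Q.counit μ
  loop_T : ∀ X : C, Q.loop (μ ≫ T) X ≫ θ.app X = (lam : k) • (λ_ X).hom
  loop_T_inv : ∃ μ' : 𝟙_ C ⟶ Q.f, μ' ≫ T = μ ∧
    ∀ X : C, Q.loop μ' X = ((lam⁻¹ : kˣ) : k) • ((λ_ X).hom ≫ θ.app X)

/-- A three-modular category: a noetherian abelian `k`-linear ribbon category with
finite-dimensional spaces of morphisms and `End 𝟙 = k`, such that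
* (M1) the coend `F`, hence `f = F / Ann ω`, is an object of `C`;
* (M2) `\underline{θ ⊗ 1}` preserves `Ann ω`, that is, it induces an endomorphism of `f`;
* (M3) `F` has a two-sided integral `σ` with `π σ = μ`, the normalized integral of `f`. -/
structure IsThreeModular (k : Type u) [Field k] (C : Type v) [Category.{w} C] [Abelian C]
    [Linear k C] [MonoidalCategory C] [MonoidalPreadditive C] [MonoidalLinear k C]
    [BraidedCategory C] [RigidCategory C] (θ : 𝟭 C ⟶ 𝟭 C) : Prop where
  noetherian : ∀ X : C, IsNoetherianObject X
  finite_hom : ∀ X Y : C, FiniteDimensional k (X ⟶ Y)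
  end_unit : Function.Bijective (fun a : k => a • 𝟙 (𝟙_ C))
  ribbon : IsRibbonTwist θ
  modular : ∃ (D : CoendAlgebra C) (Q : D.QuotientAlgebra) (TF : D.F ⟶ D.F) (T : Q.f ⟶ Q.f),
    D.IsTwist θ TF ∧ TF ≫ Q.π = Q.π ≫ T ∧
    ∃ (μ : 𝟙_ C ⟶ Q.f) (lam : kˣ) (σ : 𝟙_ C ⟶ D.F),
      Q.IsNormalizedIntegral θ T μ lam ∧ IsTwoSidedIntegral D.mul D.counit σ ∧ σ ≫ Q.π = μ

end Modular

/-! ### Ribbon Hopf algebras -/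

section Elements

variable (k H : Type u) [Field k] [Ring H] [HopfAlgebra k H]

/-- `x ⊗ y ↦ x ⊗ y ⊗ 1`. -/
def leg12 : H ⊗[k] H →ₐ[k] (H ⊗[k] H) ⊗[k] H :=
  Algebra.TensorProduct.includeLeft

/-- `x ⊗ y ↦ x ⊗ 1 ⊗ y`. -/
def leg13 : H ⊗[k] H →ₐ[k] (H ⊗[k] H) ⊗[k] H :=
  Algebra.TensorProduct.map Algebra.TensorProduct.includeLeft (AlgHom.id k H)

/-- `x ⊗ y ↦ 1 ⊗ x ⊗ y`. -/
def leg23 : H ⊗[k] H →ₐ[k] (H ⊗[k] H) ⊗[k] H :=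
  Algebra.TensorProduct.map Algebra.TensorProduct.includeRight (AlgHom.id k H)

/-- `Δ ⊗ 1`. -/
def comulLeft : H ⊗[k] H →ₐ[k] (H ⊗[k] H) ⊗[k] H :=
  Algebra.TensorProduct.map (Bialgebra.comulAlgHom k H) (AlgHom.id k H)

/-- `1 ⊗ Δ`, rebracketed to the left. -/
def comulRight : H ⊗[k] H →ₐ[k] (H ⊗[k] H) ⊗[k] H :=
  (Algebra.TensorProduct.assoc k k k H H H).symm.toAlgHom.comp
    (Algebra.TensorProduct.map (AlgHom.id k H) (Bialgebra.comulAlgHom k H))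

/-- The flip `x ⊗ y ↦ y ⊗ x`. -/
def flip : H ⊗[k] H →ₐ[k] H ⊗[k] H :=
  (Algebra.TensorProduct.comm k H H).toAlgHom

/-- The antipode `γ`. -/
abbrev γ : H →ₗ[k] H := HopfAlgebra.antipode k

end Elements

/-- A ribbon Hopf algebra `(H, R, κ)`: a Hopf algebra with invertible antipode, an `R`-matrix
`R = ∑ R' ⊗ R''`, and a grouplike `κ` with `κ² = u₁ u₄`, where `u₁ = ∑ γ(R'') R'` and
`u₄ = ∑ γ²(R') R''`, and `κ a κ⁻¹ = γ²(a)`. -/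
structure RibbonHopfAlgebra (k H : Type u) [Field k] [Ring H] [HopfAlgebra k H] where
  antipode_bijective : Function.Bijective (γ k H)
  R : (H ⊗[k] H)ˣ
  comulLeft_R : comulLeft k H R = leg13 k H R * leg23 k H R
  comulRight_R : comulRight k H R = leg13 k H R * leg12 k H R
  flip_comul : ∀ a : H, flip k H (Coalgebra.comul (R := k) a) =
    (R : H ⊗[k] H) * Coalgebra.comul (R := k) a * ((R⁻¹ : (H ⊗[k] H)ˣ) : H ⊗[k] H)
  κ : Hˣ
  isGroupLike_κ : IsGroupLikeElem k (κ : H)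
  κ_sq : (κ : H) * κ =
    LinearMap.mul' k H (TensorProduct.map (γ k H) LinearMap.id (flip k H R)) *
    LinearMap.mul' k H (TensorProduct.map (γ k H ∘ₗ γ k H) LinearMap.id (R : H ⊗[k] H))
  κ_conj : ∀ a : H, (κ : H) * a * ((κ⁻¹ : Hˣ) : H) = γ k H (γ k H a)

namespace RibbonHopfAlgebra

variable {k H : Type u} [Field k] [Ring H] [HopfAlgebra k H] (A : RibbonHopfAlgebra k H)

/-- The inverse antipode. -/
def antipodeInv : H →ₗ[k] H :=
  (LinearEquiv.ofBijective (γ k H) A.antipode_bijective).symm.toLinearMap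

lemma γ_antipodeInv (a : H) : γ k H (A.antipodeInv a) = a :=
  (LinearEquiv.ofBijective (γ k H) A.antipode_bijective).apply_symm_apply a

lemma antipodeInv_γ (a : H) : A.antipodeInv (γ k H a) = a :=
  (LinearEquiv.ofBijective (γ k H) A.antipode_bijective).symm_apply_apply a

lemma γ_mul (a b : H) : γ k H (a * b) = γ k H b * γ k H a :=
  HopfAlgebra.antipode_mul_antidistrib a b

lemma antipodeInv_mul (a b : H) :
    A.antipodeInv (a * b) = A.antipodeInv b * A.antipodeInv a := by
  apply A.antipode_bijective.1
  rw [γ_mul]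
  simp only [γ_antipodeInv]

lemma antipodeInv_one : A.antipodeInv 1 = 1 := by
  apply A.antipode_bijective.1
  rw [γ_antipodeInv]; simp

/-- `ν = ∑ R'' κ R'`. -/
def ν : H :=
  LinearMap.mul' k H (TensorProduct.map LinearMap.id (LinearMap.mulLeft k (A.κ : H))
    (flip k H A.R))

lemma flip_comul_mul (a : H) :
    flip k H (Coalgebra.comul (R := k) a) * (A.R : H ⊗[k] H) =
      (A.R : H ⊗[k] H) * Coalgebra.comul (R := k) a := by
  rw [A.flip_comul]; simp [mul_assoc]


end RibbonHopfAlgebra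

section Actions

variable {k H : Type u} [Field k] [Ring H] [HopfAlgebra k H]
variable {V W U V' W' : Type u} [AddCommGroup V] [Module k V] [AddCommGroup W] [Module k W]
  [AddCommGroup U] [Module k U] [AddCommGroup V'] [Module k V'] [AddCommGroup W'] [Module k W']
  (ρ : H →ₐ[k] Module.End k V) (σ : H →ₐ[k] Module.End k W) (τ : H →ₐ[k] Module.End k U)
  (ρ' : H →ₐ[k] Module.End k V') (σ' : H →ₐ[k] Module.End k W')

/-- The action of `H ⊗ H` on `V ⊗ W`. -/
def act₂ : H ⊗[k] H →ₐ[k] Module.End k (V ⊗[k] W) :=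
  (Module.endTensorEndAlgHom (R := k) (S := k) (A := k) (M := V) (N := W)).comp
    (Algebra.TensorProduct.map ρ σ)

lemma act₂_tmul (a b : H) (x : V) (y : W) :
    act₂ ρ σ (a ⊗ₜ b) (x ⊗ₜ y) = ρ a x ⊗ₜ σ b y := rfl

lemma map_act₂ {f : V →ₗ[k] V'} {g : W →ₗ[k] W'} (hf : ∀ h x, f (ρ h x) = ρ' h (f x))
    (hg : ∀ h x, g (σ h x) = σ' h (g x)) (t : H ⊗[k] H) (z : V ⊗[k] W) :
    TensorProduct.map f g (act₂ ρ σ t z) = act₂ ρ' σ' t (TensorProduct.map f g z) := by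
  induction t with
  | zero => simp only [map_zero, LinearMap.zero_apply]
  | add a b ha hb => simp only [map_add, LinearMap.add_apply, ha, hb]
  | tmul a b =>
    induction z with
    | zero => simp only [map_zero]
    | add a b ha hb => simp only [map_add, ha, hb]
    | tmul x y => simp only [act₂_tmul, TensorProduct.map_tmul, hf, hg]

/-- The action of `H` on `V ⊗ W` through the comultiplication. -/
def actTensor : H →ₐ[k] Module.End k (V ⊗[k] W) :=
  (act₂ ρ σ).comp (Bialgebra.comulAlgHom k H)

/-- The action of `H` on `k` through the counit. -/
def actUnit : H →ₐ[k] Module.End k k :=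
  (Algebra.lmul k k).comp (Bialgebra.counitAlgHom k H)

lemma actTensor_apply (h : H) : actTensor ρ σ h = act₂ ρ σ (Coalgebra.comul (R := k) h) := rfl

lemma actUnit_apply (h : H) (x : k) : actUnit h x = Coalgebra.counit (R := k) h * x := rfl

/-- The action of `H ⊗ H ⊗ H` on `V ⊗ W ⊗ U`. -/
def act₃ : (H ⊗[k] H) ⊗[k] H →ₐ[k] Module.End k ((V ⊗[k] W) ⊗[k] U) :=
  (Module.endTensorEndAlgHom (R := k) (S := k) (A := k)).comp
    (Algebra.TensorProduct.map (act₂ ρ σ) τ)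

lemma act₃_tmul (a b c : H) (x : V) (y : W) (z : U) :
    act₃ ρ σ τ ((a ⊗ₜ b) ⊗ₜ c) ((x ⊗ₜ y) ⊗ₜ z) = (ρ a x ⊗ₜ σ b y) ⊗ₜ τ c z := rfl

lemma act₂_actTensor_left (t : H ⊗[k] H) (z : (V ⊗[k] W) ⊗[k] U) :
    act₂ (actTensor ρ σ) τ t z = act₃ ρ σ τ (comulLeft k H t) z := by
  induction t with
  | zero => simp only [map_zero, LinearMap.zero_apply]
  | add a b ha hb => simp only [map_add, LinearMap.add_apply, ha, hb]
  | tmul a b => rfl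

lemma act₂_actTensor_right (t : H ⊗[k] H) (z : (V ⊗[k] W) ⊗[k] U) :
    act₂ ρ (actTensor σ τ) t (TensorProduct.assoc k V W U z) =
      TensorProduct.assoc k V W U (act₃ ρ σ τ (comulRight k H t) z) := by
  induction t with
  | zero => simp only [map_zero, LinearMap.zero_apply]
  | add a b ha hb => simp only [map_add, LinearMap.add_apply, ha, hb]
  | tmul a b =>
    have key : ∀ s : H ⊗[k] H, ∀ z : (V ⊗[k] W) ⊗[k] U,
        TensorProduct.map (ρ a) (act₂ σ τ s) (TensorProduct.assoc k V W U z) =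
        TensorProduct.assoc k V W U
          (act₃ ρ σ τ ((TensorProduct.assoc k H H H).symm (a ⊗ₜ s)) z) := by
      intro s z
      induction s with
      | zero => simp only [map_zero, LinearMap.zero_apply, TensorProduct.tmul_zero,
          TensorProduct.map_zero_right]
      | add b c hb hc =>
        simp only [map_add, TensorProduct.tmul_add, LinearMap.add_apply, ← hb, ← hc,
          TensorProduct.map_add_right]
      | tmul b c =>
        induction z with
        | zero => simp only [map_zero]
        | add a b ha hb => simp only [map_add, ha, hb]
        | tmul s z =>
          induction s with
          | zero => simp only [map_zero, TensorProduct.zero_tmul]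
          | add a b ha hb => simp only [map_add, TensorProduct.add_tmul, ha, hb]
          | tmul x y => rfl
    exact key _ z

lemma coassoc (h : H) : comulLeft k H (Coalgebra.comul (R := k) h) =
    comulRight k H (Coalgebra.comul (R := k) h) := by
  apply (TensorProduct.assoc k H H H).injective
  change TensorProduct.assoc k H H H (LinearMap.rTensor H Coalgebra.comul _) =
    TensorProduct.assoc k H H H ((TensorProduct.assoc k H H H).symm
      (LinearMap.lTensor H Coalgebra.comul _))
  rw [LinearEquiv.apply_symm_apply, Coalgebra.coassoc_apply]

lemma assoc_actTensor (h : H) (z : (V ⊗[k] W) ⊗[k] U) :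
    TensorProduct.assoc k V W U (actTensor (actTensor ρ σ) τ h z) =
      actTensor ρ (actTensor σ τ) h (TensorProduct.assoc k V W U z) := by
  rw [actTensor_apply, actTensor_apply, act₂_actTensor_left, act₂_actTensor_right, coassoc]

lemma lid_actTensor (h : H) (z : k ⊗[k] V) :
    TensorProduct.lid k V (actTensor actUnit ρ h z) = ρ h (TensorProduct.lid k V z) := by
  have key : ∀ t : H ⊗[k] H, TensorProduct.lid k V (act₂ actUnit ρ t z) =
      ρ (TensorProduct.lid k H (LinearMap.rTensor H (Coalgebra.counit (R := k)) t))
        (TensorProduct.lid k V z) := by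
    intro t
    induction t with
    | zero => simp only [map_zero, LinearMap.zero_apply]
    | add a b ha hb => simp only [map_add, LinearMap.add_apply, ha, hb]
    | tmul a b =>
      induction z with
      | zero => simp only [map_zero]
      | add a b ha hb => simp only [map_add, ha, hb]
      | tmul x y =>
        rw [act₂_tmul, actUnit_apply]
        simp [mul_smul, smul_comm (Coalgebra.counit (R := k) _)]
  rw [actTensor_apply, key]
  simp

lemma rid_actTensor (h : H) (z : V ⊗[k] k) :
    TensorProduct.rid k V (actTensor ρ actUnit h z) = ρ h (TensorProduct.rid k V z) := by
  have key : ∀ t : H ⊗[k] H, TensorProduct.rid k V (act₂ ρ actUnit t z) =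
      ρ (TensorProduct.rid k H (LinearMap.lTensor H (Coalgebra.counit (R := k)) t))
        (TensorProduct.rid k V z) := by
    intro t
    induction t with
    | zero => simp only [map_zero, LinearMap.zero_apply]
    | add a b ha hb => simp only [map_add, LinearMap.add_apply, ha, hb]
    | tmul a b =>
      induction z with
      | zero => simp only [map_zero]
      | add a b ha hb => simp only [map_add, ha, hb]
      | tmul x y =>
        rw [act₂_tmul, actUnit_apply]
        simp [mul_smul, smul_comm (Coalgebra.counit (R := k) _)]
  rw [actTensor_apply, key]
  simp

lemma comm_act₂ (t : H ⊗[k] H) (z : V ⊗[k] W) :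
    TensorProduct.comm k V W (act₂ ρ σ t z) =
      act₂ σ ρ (flip k H t) (TensorProduct.comm k V W z) := by
  induction t with
  | zero => simp only [map_zero, LinearMap.zero_apply]
  | add a b ha hb => simp only [map_add, LinearMap.add_apply, ha, hb]
  | tmul a b =>
    induction z with
    | zero => simp only [map_zero]
    | add a b ha hb => simp only [map_add, ha, hb]
    | tmul x y => rfl

lemma comm_act₂' (t : H ⊗[k] H) (z : V ⊗[k] W) :
    TensorProduct.comm k V W (act₂ ρ σ (flip k H t) z) =
      act₂ σ ρ t (TensorProduct.comm k V W z) := by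
  rw [comm_act₂]
  congr 3
  exact (TensorProduct.comm k H H).symm_apply_apply t

end Actions

section Braid
variable {k H : Type u} [Field k] [Ring H] [HopfAlgebra k H] (A : RibbonHopfAlgebra k H)
variable {V W U V' W' : Type u} [AddCommGroup V] [Module k V] [AddCommGroup W] [Module k W]
  [AddCommGroup U] [Module k U]
  (ρ : H →ₐ[k] Module.End k V) (σ : H →ₐ[k] Module.End k W) (τ : H →ₐ[k] Module.End k U)

/-- The action of `R` as a linear automorphism of `V ⊗ W`. -/
def actR : V ⊗[k] W ≃ₗ[k] V ⊗[k] W :=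
  LinearEquiv.ofLinearMap (act₂ ρ σ (A.R : H ⊗[k] H))
    (act₂ ρ σ ((A.R⁻¹ : (H ⊗[k] H)ˣ) : H ⊗[k] H))
    (by rw [← Module.End.mul_eq_comp, ← map_mul, Units.mul_inv, map_one]; rfl)
    (by rw [← Module.End.mul_eq_comp, ← map_mul, Units.inv_mul, map_one]; rfl)

/-- The braiding `x ⊗ y ↦ R'' y ⊗ R' x`. -/
def braid : V ⊗[k] W ≃ₗ[k] W ⊗[k] V :=
  (actR A ρ σ).trans (TensorProduct.comm k V W)

lemma braid_apply (z : V ⊗[k] W) :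
    braid A ρ σ z = TensorProduct.comm k V W (act₂ ρ σ (A.R : H ⊗[k] H) z) := rfl

lemma braid_actTensor (h : H) (z : V ⊗[k] W) :
    braid A ρ σ (actTensor ρ σ h z) = actTensor σ ρ h (braid A ρ σ z) := by
  rw [braid_apply, braid_apply, actTensor_apply, actTensor_apply, ← comm_act₂',
    ← Module.End.mul_apply, ← Module.End.mul_apply, ← map_mul, ← map_mul, A.flip_comul_mul]

lemma leg12_aux (t : H ⊗[k] H) (z : (V ⊗[k] W) ⊗[k] U) :
    TensorProduct.map ((TensorProduct.comm k V W).toLinearMap ∘ₗ act₂ ρ σ t) LinearMap.id z =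
      TensorProduct.map (TensorProduct.comm k V W).toLinearMap LinearMap.id
        (act₃ ρ σ τ (leg12 k H t) z) := by
  induction t with
  | zero => simp only [map_zero, LinearMap.zero_apply, LinearMap.comp_zero,
      TensorProduct.map_zero_left]
  | add a b ha hb => simp only [map_add, LinearMap.add_apply, LinearMap.comp_add,
      TensorProduct.map_add_left, ha, hb]
  | tmul a b =>
    induction z with
    | zero => simp only [map_zero]
    | add a b ha hb => simp only [map_add, ha, hb]
    | tmul s z =>
      induction s with
      | zero => simp only [map_zero, TensorProduct.zero_tmul]
      | add a b ha hb => simp only [map_add, TensorProduct.add_tmul, ha, hb]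
      | tmul x y =>
        change (σ b y ⊗ₜ[k] ρ a x) ⊗ₜ[k] z = (σ b y ⊗ₜ[k] ρ a x) ⊗ₜ[k] τ 1 z
        rw [map_one]; rfl

lemma leg13_aux (t : H ⊗[k] H) (z : (V ⊗[k] W) ⊗[k] U) :
    TensorProduct.map LinearMap.id ((TensorProduct.comm k V U).toLinearMap ∘ₗ act₂ ρ τ t)
      (TensorProduct.assoc k W V U
        (TensorProduct.map (TensorProduct.comm k V W).toLinearMap LinearMap.id z)) =
      TensorProduct.assoc k W U V (TensorProduct.comm k V (W ⊗[k] U)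
        (TensorProduct.assoc k V W U (act₃ ρ σ τ (leg13 k H t) z))) := by
  induction t with
  | zero => simp only [map_zero, LinearMap.zero_apply, LinearMap.comp_zero,
      TensorProduct.map_zero_right]
  | add a b ha hb => simp only [map_add, LinearMap.add_apply, LinearMap.comp_add,
      TensorProduct.map_add_right, ha, hb]
  | tmul a b =>
    induction z with
    | zero => simp only [map_zero]
    | add a b ha hb => simp only [map_add, ha, hb]
    | tmul s z =>
      induction s with
      | zero => simp only [map_zero, TensorProduct.zero_tmul]
      | add a b ha hb => simp only [map_add, TensorProduct.add_tmul, ha, hb]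
      | tmul x y =>
        change y ⊗ₜ[k] (τ b z ⊗ₜ[k] ρ a x) = σ 1 y ⊗ₜ[k] (τ b z ⊗ₜ[k] ρ a x)
        rw [map_one]; rfl

lemma leg13_aux' (t : H ⊗[k] H) (z : (V ⊗[k] W) ⊗[k] U) :
    TensorProduct.map ((TensorProduct.comm k V U).toLinearMap ∘ₗ act₂ ρ τ t) LinearMap.id
      ((TensorProduct.assoc k V U W).symm (TensorProduct.map LinearMap.id
        (TensorProduct.comm k W U).toLinearMap (TensorProduct.assoc k V W U z))) =
      (TensorProduct.assoc k U V W).symm (TensorProduct.comm k (V ⊗[k] W) U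
        (act₃ ρ σ τ (leg13 k H t) z)) := by
  induction t with
  | zero => simp only [map_zero, LinearMap.zero_apply, LinearMap.comp_zero,
      TensorProduct.map_zero_left]
  | add a b ha hb => simp only [map_add, LinearMap.add_apply, LinearMap.comp_add,
      TensorProduct.map_add_left, ha, hb]
  | tmul a b =>
    induction z with
    | zero => simp only [map_zero]
    | add a b ha hb => simp only [map_add, ha, hb]
    | tmul s z =>
      induction s with
      | zero => simp only [map_zero, TensorProduct.zero_tmul]
      | add a b ha hb => simp only [map_add, TensorProduct.add_tmul, ha, hb]
      | tmul x y =>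
        change (τ b z ⊗ₜ[k] ρ a x) ⊗ₜ[k] y = (τ b z ⊗ₜ[k] ρ a x) ⊗ₜ[k] σ 1 y
        rw [map_one]; rfl

lemma leg23_aux (t : H ⊗[k] H) (z : (V ⊗[k] W) ⊗[k] U) :
    TensorProduct.map LinearMap.id ((TensorProduct.comm k W U).toLinearMap ∘ₗ act₂ σ τ t)
      (TensorProduct.assoc k V W U z) =
      TensorProduct.map LinearMap.id (TensorProduct.comm k W U).toLinearMap
        (TensorProduct.assoc k V W U (act₃ ρ σ τ (leg23 k H t) z)) := by
  induction t with
  | zero => simp only [map_zero, LinearMap.zero_apply, LinearMap.comp_zero,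
      TensorProduct.map_zero_right]
  | add a b ha hb => simp only [map_add, LinearMap.add_apply, LinearMap.comp_add,
      TensorProduct.map_add_right, ha, hb]
  | tmul a b =>
    induction z with
    | zero => simp only [map_zero]
    | add a b ha hb => simp only [map_add, ha, hb]
    | tmul s z =>
      induction s with
      | zero => simp only [map_zero, TensorProduct.zero_tmul]
      | add a b ha hb => simp only [map_add, TensorProduct.add_tmul, ha, hb]
      | tmul x y =>
        change x ⊗ₜ[k] (τ b z ⊗ₜ[k] σ a y) = ρ 1 x ⊗ₜ[k] (τ b z ⊗ₜ[k] σ a y)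
        rw [map_one]; rfl

lemma braid_hexagon (z : (V ⊗[k] W) ⊗[k] U) :
    TensorProduct.assoc k W U V (braid A ρ (actTensor σ τ) (TensorProduct.assoc k V W U z)) =
      TensorProduct.map LinearMap.id (braid A ρ τ).toLinearMap (TensorProduct.assoc k W V U
        (TensorProduct.map (braid A ρ σ).toLinearMap LinearMap.id z)) := by
  have h1 := leg12_aux ρ σ τ (A.R : H ⊗[k] H) z
  have h2 := leg13_aux ρ σ τ (A.R : H ⊗[k] H) (act₃ ρ σ τ (leg12 k H (A.R : H ⊗[k] H)) z)
  rw [← h1, ← Module.End.mul_apply, ← map_mul, ← A.comulRight_R] at h2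
  rw [braid_apply, act₂_actTensor_right]
  exact h2.symm

lemma braid_hexagon' (z : (V ⊗[k] W) ⊗[k] U) :
    (TensorProduct.assoc k U V W).symm (braid A (actTensor ρ σ) τ z) =
      TensorProduct.map (braid A ρ τ).toLinearMap LinearMap.id
        ((TensorProduct.assoc k V U W).symm
          (TensorProduct.map LinearMap.id (braid A σ τ).toLinearMap
            (TensorProduct.assoc k V W U z))) := by
  have h1 := leg23_aux ρ σ τ (A.R : H ⊗[k] H) z
  have h2 := leg13_aux' ρ σ τ (A.R : H ⊗[k] H) (act₃ ρ σ τ (leg23 k H (A.R : H ⊗[k] H)) z)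
  rw [← h1, ← Module.End.mul_apply, ← map_mul, ← A.comulLeft_R] at h2
  rw [braid_apply, act₂_actTensor_left]
  exact h2.symm

end Braid

/-- Objects of `H`-mod: a finite-dimensional `k`-vector space with an action of `H`. -/
structure HMod {k H : Type u} [Field k] [Ring H] [HopfAlgebra k H]
    (A : RibbonHopfAlgebra k H) where
  V : Type u
  [addCommGroup : AddCommGroup V]
  [module : Module k V]
  [finite : Module.Finite k V]
  act : H →ₐ[k] Module.End k V

attribute [instance] HMod.addCommGroup HMod.module HMod.finite

namespace HMod

variable {k H : Type u} [Field k] [Ring H] [HopfAlgebra k H] {A : RibbonHopfAlgebra k H}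

/-- `H`-linear maps. -/
@[ext]
structure Hom (X Y : HMod A) where
  lin : X.V →ₗ[k] Y.V
  comm : ∀ (h : H) (x : X.V), lin (X.act h x) = Y.act h (lin x)

instance : Category (HMod A) where
  Hom X Y := Hom X Y
  id X := ⟨LinearMap.id, fun _ _ => rfl⟩
  comp f g := ⟨g.lin ∘ₗ f.lin, fun h x => by simp [f.comm, g.comm]⟩

@[ext]
lemma hom_ext {X Y : HMod A} {f g : X ⟶ Y} (h : f.lin = g.lin) : f = g := Hom.ext h

@[simp] lemma id_lin (X : HMod A) : Hom.lin (𝟙 X) = LinearMap.id := rfl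

@[simp] lemma comp_lin {X Y Z : HMod A} (f : X ⟶ Y) (g : Y ⟶ Z) :
    (f ≫ g).lin = g.lin ∘ₗ f.lin := rfl

/-- An `H`-linear isomorphism. -/
def isoMk {X Y : HMod A} (e : X.V ≃ₗ[k] Y.V)
    (he : ∀ (h : H) (x : X.V), e (X.act h x) = Y.act h (e x)) : X ≅ Y where
  hom := ⟨e.toLinearMap, he⟩
  inv := ⟨e.symm.toLinearMap, fun a y => by
    apply e.injective
    simp [he]⟩
  hom_inv_id := by ext x; simp
  inv_hom_id := by ext x; simp

/-- The tensor product of two morphisms. -/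
def tensorMap {X X' Y Y' : HMod A} (f : X ⟶ X') (g : Y ⟶ Y') :
    Hom (A := A) ⟨X.V ⊗[k] Y.V, actTensor X.act Y.act⟩
      ⟨X'.V ⊗[k] Y'.V, actTensor X'.act Y'.act⟩ :=
  ⟨TensorProduct.map f.lin g.lin, fun _ z =>
    map_act₂ X.act Y.act X'.act Y'.act f.comm g.comm _ z⟩

instance : MonoidalCategory (HMod A) where
  tensorObj X Y := ⟨X.V ⊗[k] Y.V, actTensor X.act Y.act⟩
  whiskerLeft X _ _ f := tensorMap (𝟙 X) f
  whiskerRight f Y := tensorMap f (𝟙 Y)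
  tensorHom := tensorMap
  tensorUnit := ⟨k, actUnit⟩
  associator X Y Z := isoMk (TensorProduct.assoc k X.V Y.V Z.V)
    (assoc_actTensor X.act Y.act Z.act)
  leftUnitor X := isoMk (TensorProduct.lid k X.V) (lid_actTensor X.act)
  rightUnitor X := isoMk (TensorProduct.rid k X.V) (rid_actTensor X.act)
  tensorHom_def f g := by
    apply hom_ext; apply TensorProduct.ext'; intro x y; rfl
  id_tensorHom_id X Y := by
    apply hom_ext; apply TensorProduct.ext'; intro x y; rfl
  tensorHom_comp_tensorHom _ _ _ _ := by
    apply hom_ext; apply TensorProduct.ext'; intro x y; rfl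
  whiskerLeft_id _ _ := by
    apply hom_ext; apply TensorProduct.ext'; intro x y; rfl
  id_whiskerRight _ _ := by
    apply hom_ext; apply TensorProduct.ext'; intro x y; rfl
  associator_naturality f g h := by
    apply hom_ext; apply TensorProduct.ext_threefold; intro x y z; rfl
  leftUnitor_naturality f := by
    apply hom_ext; apply TensorProduct.ext'; intro x y
    exact (f.lin.map_smul x y).symm
  rightUnitor_naturality f := by
    apply hom_ext; apply TensorProduct.ext'; intro x y
    exact (f.lin.map_smul y x).symm
  pentagon W X Y Z := by
    apply hom_ext; apply TensorProduct.ext_fourfold; intro w x y z; rfl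
  triangle X Y := by
    apply hom_ext; apply TensorProduct.ext_threefold; intro x y z
    exact (TensorProduct.smul_tmul y x z).symm

instance : BraidedCategory (HMod A) where
  braiding X Y := isoMk (braid A X.act Y.act) (braid_actTensor A X.act Y.act)
  braiding_naturality_right X Y Z f := by
    apply hom_ext; apply LinearMap.ext; intro z
    change braid A X.act Z.act (TensorProduct.map (𝟙 X : X ⟶ X).lin f.lin z) =
      TensorProduct.map f.lin (𝟙 X : X ⟶ X).lin (braid A X.act Y.act z)
    rw [braid_apply, braid_apply, ← map_act₂ X.act Y.act X.act Z.act (𝟙 X : X ⟶ X).comm f.comm]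
    exact (TensorProduct.map_comm _ _ _).symm
  braiding_naturality_left {X Y} f Z := by
    apply hom_ext; apply LinearMap.ext; intro z
    change braid A Y.act Z.act (TensorProduct.map f.lin (𝟙 Z : Z ⟶ Z).lin z) =
      TensorProduct.map (𝟙 Z : Z ⟶ Z).lin f.lin (braid A X.act Z.act z)
    rw [braid_apply, braid_apply, ← map_act₂ X.act Z.act Y.act Z.act f.comm (𝟙 Z : Z ⟶ Z).comm]
    exact (TensorProduct.map_comm _ _ _).symm
  hexagon_forward X Y Z := by
    apply hom_ext; apply LinearMap.ext; intro z
    exact braid_hexagon A X.act Y.act Z.act z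
  hexagon_reverse X Y Z := by
    apply hom_ext; apply LinearMap.ext; intro z
    obtain ⟨z, rfl⟩ := (TensorProduct.assoc k X.V Y.V Z.V).surjective z
    have := braid_hexagon' A X.act Y.act Z.act z
    refine Eq.trans ?_ this
    change (TensorProduct.assoc k Z.V X.V Y.V).symm (braid A (actTensor X.act Y.act) Z.act
      ((TensorProduct.assoc k X.V Y.V Z.V).symm (TensorProduct.assoc k X.V Y.V Z.V z))) = _
    rw [LinearEquiv.symm_apply_apply]

end HMod

section Duals

variable {k H : Type u} [Field k] [Ring H] [HopfAlgebra k H] (A : RibbonHopfAlgebra k H)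
variable {V : Type u} [AddCommGroup V] [Module k V] (ρ : H →ₐ[k] Module.End k V)

/-- `(h ξ)(x) = ξ(γ⁻¹(h) x)`. -/
def actLeftDual : H →ₐ[k] Module.End k (Module.Dual k V) :=
  AlgHom.ofLinearMap (Module.Dual.transpose ∘ₗ ρ.toLinearMap ∘ₗ A.antipodeInv)
    (by
      ext ξ x
      change ξ (ρ (A.antipodeInv 1) x) = ξ x
      rw [A.antipodeInv_one, map_one]; rfl)
    (fun a b => by
      ext ξ x
      change ξ (ρ (A.antipodeInv (a * b)) x) = ξ (ρ (A.antipodeInv b) (ρ (A.antipodeInv a) x))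
      rw [A.antipodeInv_mul, map_mul]; rfl)

/-- `(h ξ)(x) = ξ(γ(h) x)`. -/
def actRightDual : H →ₐ[k] Module.End k (Module.Dual k V) :=
  AlgHom.ofLinearMap (Module.Dual.transpose ∘ₗ ρ.toLinearMap ∘ₗ γ k H)
    (by
      ext ξ x
      change ξ (ρ (γ k H 1) x) = ξ x
      rw [γ, HopfAlgebra.antipode_one, map_one]; rfl)
    (fun a b => by
      ext ξ x
      change ξ (ρ (γ k H (a * b)) x) = ξ (ρ (γ k H b) (ρ (γ k H a) x))
      rw [RibbonHopfAlgebra.γ_mul, map_mul]; rfl)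

lemma actLeftDual_apply (h : H) (ξ : Module.Dual k V) (x : V) :
    actLeftDual A ρ h ξ x = ξ (ρ (A.antipodeInv h) x) := rfl

lemma actRightDual_apply (h : H) (ξ : Module.Dual k V) (x : V) :
    actRightDual ρ h ξ x = ξ (ρ (γ k H h) x) := rfl

lemma antipodeInv_left (h : H) :
    LinearMap.mul' k H (TensorProduct.map A.antipodeInv LinearMap.id
      (flip k H (Coalgebra.comul (R := k) h))) =
      algebraMap k H (Coalgebra.counit (R := k) h) := by
  apply A.antipode_bijective.1
  have key : ∀ t : H ⊗[k] H, γ k H (LinearMap.mul' k H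
      (TensorProduct.map A.antipodeInv LinearMap.id (flip k H t))) =
      LinearMap.mul' k H (LinearMap.rTensor H (γ k H) t) := by
    intro t
    induction t with
    | zero => simp only [map_zero]
    | add a b ha hb => simp only [map_add, ha, hb]
    | tmul a b =>
      change γ k H (A.antipodeInv b * a) = γ k H a * b
      rw [RibbonHopfAlgebra.γ_mul, A.γ_antipodeInv]
  rw [key, HopfAlgebra.mul_antipode_rTensor_comul_apply, Algebra.algebraMap_eq_smul_one,
    map_smul, γ, HopfAlgebra.antipode_one]

lemma antipodeInv_right (h : H) :
    LinearMap.mul' k H (TensorProduct.map LinearMap.id A.antipodeInv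
      (flip k H (Coalgebra.comul (R := k) h))) =
      algebraMap k H (Coalgebra.counit (R := k) h) := by
  apply A.antipode_bijective.1
  have key : ∀ t : H ⊗[k] H, γ k H (LinearMap.mul' k H
      (TensorProduct.map LinearMap.id A.antipodeInv (flip k H t))) =
      LinearMap.mul' k H (LinearMap.lTensor H (γ k H) t) := by
    intro t
    induction t with
    | zero => simp only [map_zero]
    | add a b ha hb => simp only [map_add, ha, hb]
    | tmul a b =>
      change γ k H (b * A.antipodeInv a) = a * γ k H b
      rw [RibbonHopfAlgebra.γ_mul, A.γ_antipodeInv]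
  rw [key, HopfAlgebra.mul_antipode_lTensor_comul_apply, Algebra.algebraMap_eq_smul_one,
    map_smul, γ, HopfAlgebra.antipode_one]

/-- `x ⊗ ξ ↦ ξ x`. -/
def evLeft (V : Type u) [AddCommGroup V] [Module k V] : V ⊗[k] Module.Dual k V →ₗ[k] k :=
  contractRight k V

lemma evLeft_act (h : H) (z : V ⊗[k] Module.Dual k V) :
    evLeft V (actTensor ρ (actLeftDual A ρ) h z) = actUnit h (evLeft V z) := by
  have key : ∀ t : H ⊗[k] H, ∀ (x : V) (ξ : Module.Dual k V),
      evLeft V (act₂ ρ (actLeftDual A ρ) t (x ⊗ₜ ξ)) = ξ (ρ (LinearMap.mul' k H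
        (TensorProduct.map A.antipodeInv LinearMap.id (flip k H t))) x) := by
    intro t x ξ
    induction t with
    | zero => simp only [map_zero, LinearMap.zero_apply]
    | add a b ha hb => simp only [map_add, LinearMap.add_apply, ha, hb]
    | tmul a b =>
      change ξ (ρ (A.antipodeInv b) (ρ a x)) = ξ (ρ (A.antipodeInv b * a) x)
      rw [map_mul]; rfl
  induction z with
  | zero => simp only [map_zero]
  | add a b ha hb => simp only [map_add, ha, hb]
  | tmul x ξ =>
    rw [actTensor_apply, key, antipodeInv_left, AlgHom.commutes, actUnit_apply]
    change ξ (Coalgebra.counit (R := k) h • x) = _ * ξ x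
    rw [map_smul, smul_eq_mul]

lemma evRight_act (h : H) (z : Module.Dual k V ⊗[k] V) :
    contractLeft k V (actTensor (actRightDual ρ) ρ h z) = actUnit h (contractLeft k V z) := by
  have key : ∀ t : H ⊗[k] H, ∀ (x : V) (ξ : Module.Dual k V),
      contractLeft k V (act₂ (actRightDual ρ) ρ t (ξ ⊗ₜ x)) = ξ (ρ (LinearMap.mul' k H
        (LinearMap.rTensor H (γ k H) t)) x) := by
    intro t x ξ
    induction t with
    | zero => simp only [map_zero, LinearMap.zero_apply]
    | add a b ha hb => simp only [map_add, LinearMap.add_apply, ha, hb]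
    | tmul a b =>
      change ξ (ρ (γ k H a) (ρ b x)) = ξ (ρ (γ k H a * b) x)
      rw [map_mul]; rfl
  induction z with
  | zero => simp only [map_zero]
  | add a b ha hb => simp only [map_add, ha, hb]
  | tmul ξ x =>
    rw [actTensor_apply, key, HopfAlgebra.mul_antipode_rTensor_comul_apply, AlgHom.commutes,
      actUnit_apply]
    change ξ (Coalgebra.counit (R := k) h • x) = _ * ξ x
    rw [map_smul, smul_eq_mul]

variable [Module.Finite k V]

/-- `1 ↦ ∑ eⁱ ⊗ eᵢ`. -/
def coevLeft (V : Type u) [AddCommGroup V] [Module k V] [Module.Finite k V] :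
    k →ₗ[k] Module.Dual k V ⊗[k] V :=
  (TensorProduct.comm k V (Module.Dual k V)).toLinearMap ∘ₗ coevaluation k V

lemma coevaluation_eq (r : k) : coevaluation k V r =
    r • ∑ i, Module.Basis.ofVectorSpace k V i ⊗ₜ[k] (Module.Basis.ofVectorSpace k V).coord i := by
  conv_lhs => rw [← mul_one r, ← smul_eq_mul, map_smul, coevaluation_apply_one]

lemma coevLeft_eq (r : k) : coevLeft V r =
    r • ∑ i, (Module.Basis.ofVectorSpace k V).coord i ⊗ₜ[k] Module.Basis.ofVectorSpace k V i := by
  change TensorProduct.comm k V (Module.Dual k V) (coevaluation k V r) = _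
  rw [coevaluation_eq, map_smul, map_sum]
  rfl

lemma dualTensorHom_coevLeft (r : k) : dualTensorHom k V V (coevLeft V r) = r • LinearMap.id := by
  rw [coevLeft_eq, map_smul, map_sum]
  congr 1
  ext x
  rw [LinearMap.sum_apply]
  exact (Module.Basis.ofVectorSpace k V).sum_repr x

lemma coevLeft_act (h : H) (r : k) :
    coevLeft V (actUnit h r) = actTensor (actLeftDual A ρ) ρ h (coevLeft V r) := by
  apply (dualTensorHomEquiv k V V).injective
  have key : ∀ t : H ⊗[k] H, ∀ w : Module.Dual k V ⊗[k] V, dualTensorHom k V V w = r • .id →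
      dualTensorHom k V V (act₂ (actLeftDual A ρ) ρ t w) = r • ρ (LinearMap.mul' k H
        (TensorProduct.map LinearMap.id A.antipodeInv (flip k H t))) := by
    intro t w hw
    induction t with
    | zero => simp only [map_zero, LinearMap.zero_apply, smul_zero]
    | add a b ha hb => simp only [map_add, LinearMap.add_apply, ha, hb, smul_add]
    | tmul a b =>
      have : ∀ w : Module.Dual k V ⊗[k] V,
          dualTensorHom k V V (act₂ (actLeftDual A ρ) ρ (a ⊗ₜ b) w) =
          ρ b ∘ₗ dualTensorHom k V V w ∘ₗ ρ (A.antipodeInv a) := by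
        intro w
        induction w with
        | zero => simp only [map_zero, LinearMap.zero_comp, LinearMap.comp_zero]
        | add a b ha hb => simp only [map_add, LinearMap.add_comp, LinearMap.comp_add, ha, hb]
        | tmul ξ x =>
          ext y
          exact (map_smul (ρ b) _ x).symm
      rw [this, hw]
      change _ = r • ρ (b * A.antipodeInv a)
      rw [map_mul]
      ext y
      exact map_smul (ρ b) _ _
  change dualTensorHom k V V _ = dualTensorHom k V V _
  rw [actTensor_apply, key _ _ (dualTensorHom_coevLeft r), antipodeInv_right, AlgHom.commutes,
    dualTensorHom_coevLeft, actUnit_apply, mul_comm, mul_smul]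
  rfl

lemma coevRight_act (h : H) (r : k) :
    coevaluation k V (actUnit h r) = actTensor ρ (actRightDual ρ) h (coevaluation k V r) := by
  apply (TensorProduct.comm k V (Module.Dual k V)).injective
  apply (dualTensorHomEquiv k V V).injective
  have key : ∀ t : H ⊗[k] H, ∀ w : V ⊗[k] Module.Dual k V,
      dualTensorHom k V V (TensorProduct.comm k V _ w) = r • .id →
      dualTensorHom k V V (TensorProduct.comm k V _ (act₂ ρ (actRightDual ρ) t w)) =
        r • ρ (LinearMap.mul' k H (LinearMap.lTensor H (γ k H) t)) := by
    intro t w hw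
    induction t with
    | zero => simp only [map_zero, LinearMap.zero_apply, smul_zero]
    | add a b ha hb => simp only [map_add, LinearMap.add_apply, ha, hb, smul_add]
    | tmul a b =>
      have : ∀ w : V ⊗[k] Module.Dual k V,
          dualTensorHom k V V (TensorProduct.comm k V _ (act₂ ρ (actRightDual ρ) (a ⊗ₜ b) w)) =
          ρ a ∘ₗ dualTensorHom k V V (TensorProduct.comm k V _ w) ∘ₗ ρ (γ k H b) := by
        intro w
        induction w with
        | zero => simp only [map_zero, LinearMap.zero_comp, LinearMap.comp_zero]
        | add a b ha hb => simp only [map_add, LinearMap.add_comp, LinearMap.comp_add, ha, hb]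
        | tmul x ξ =>
          ext y
          exact (map_smul (ρ a) _ x).symm
      rw [this, hw]
      change _ = r • ρ (a * γ k H b)
      rw [map_mul]
      ext y
      exact map_smul (ρ a) _ _
  change dualTensorHom k V V _ = dualTensorHom k V V _
  rw [actTensor_apply, key _ _ (dualTensorHom_coevLeft r),
    HopfAlgebra.mul_antipode_lTensor_comul_apply, AlgHom.commutes]
  refine (dualTensorHom_coevLeft _).trans ?_
  rw [actUnit_apply, mul_comm, mul_smul]
  rfl

variable (V) in
lemma evLeft_coevLeft (x : V) (r : k) :
    TensorProduct.map (evLeft V) LinearMap.id ((TensorProduct.assoc k _ _ _).symm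
      (x ⊗ₜ[k] coevLeft V r)) = (TensorProduct.lid k V).symm (TensorProduct.rid k V (x ⊗ₜ r)) := by
  rw [coevLeft_eq, TensorProduct.tmul_smul, map_smul, map_smul, TensorProduct.rid_tmul, map_smul,
    TensorProduct.tmul_sum, map_sum, map_sum]
  congr 1
  apply (TensorProduct.lid k V).injective
  rw [map_sum, LinearEquiv.apply_symm_apply]
  exact (Module.Basis.ofVectorSpace k V).sum_repr x

variable (V) in
lemma coevLeft_evLeft (r : k) (ξ : Module.Dual k V) :
    TensorProduct.map LinearMap.id (evLeft V) (TensorProduct.assoc k _ _ _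
      (coevLeft V r ⊗ₜ[k] ξ)) = (TensorProduct.rid k (Module.Dual k V)).symm
        (TensorProduct.lid k (Module.Dual k V) (r ⊗ₜ ξ)) := by
  rw [coevLeft_eq, ← TensorProduct.smul_tmul', map_smul, map_smul, TensorProduct.lid_tmul,
    map_smul, TensorProduct.sum_tmul, map_sum, map_sum]
  congr 1
  apply (TensorProduct.rid k (Module.Dual k V)).injective
  rw [map_sum, LinearEquiv.apply_symm_apply]
  exact (Module.Basis.ofVectorSpace k V).sum_dual_apply_smul_coord ξ

end Duals

namespace HMod

variable {k H : Type u} [Field k] [Ring H] [HopfAlgebra k H] {A : RibbonHopfAlgebra k H}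

instance (X : HMod A) : HasLeftDual X where
  leftDual := ⟨Module.Dual k X.V, actLeftDual A X.act⟩
  exact :=
    { coevaluation' := ⟨coevLeft X.V, coevLeft_act A X.act⟩
      evaluation' := ⟨evLeft X.V, evLeft_act A X.act⟩
      coevaluation_evaluation' := by
        apply hom_ext
        exact TensorProduct.ext' (evLeft_coevLeft X.V)
      evaluation_coevaluation' := by
        apply hom_ext
        exact TensorProduct.ext' (coevLeft_evLeft X.V) }

instance (X : HMod A) : HasRightDual X where
  rightDual := ⟨Module.Dual k X.V, actRightDual X.act⟩
  exact :=
    { coevaluation' := ⟨coevaluation k X.V, coevRight_act X.act⟩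
      evaluation' := ⟨contractLeft k X.V, evRight_act X.act⟩
      coevaluation_evaluation' := by
        apply hom_ext
        exact contractLeft_assoc_coevaluation k X.V
      evaluation_coevaluation' := by
        apply hom_ext
        exact contractLeft_assoc_coevaluation' k X.V }

instance : RigidCategory (HMod A) where

end HMod

namespace HMod

variable {k H : Type u} [Field k] [Ring H] [HopfAlgebra k H] {A : RibbonHopfAlgebra k H}

section Linear

variable (X Y : HMod A)

/-- `H`-linear maps, as a subspace of the `k`-linear maps. -/
def homSubmodule : Submodule k (X.V →ₗ[k] Y.V) where
  carrier := {f | ∀ (h : H) (x : X.V), f (X.act h x) = Y.act h (f x)}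
  add_mem' hf hg h x := by
    simp only [LinearMap.add_apply, map_add, hf h x, hg h x]
  zero_mem' h x := by simp
  smul_mem' c f hf h x := by
    simp only [LinearMap.smul_apply, map_smul, hf h x]

/-- Morphisms are the elements of `homSubmodule`. -/
def homEquiv : (X ⟶ Y) ≃ homSubmodule X Y where
  toFun f := ⟨f.lin, f.comm⟩
  invFun f := ⟨f.1, f.2⟩

instance : AddCommGroup (X ⟶ Y) := (homEquiv X Y).addCommGroup

instance : Module k (X ⟶ Y) := (homEquiv X Y).module k

end Linear

instance : Preadditive (HMod A) where
  add_comp _ _ _ f f' g := by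
    apply hom_ext
    exact LinearMap.comp_add f.lin f'.lin g.lin
  comp_add _ _ _ f g g' := by
    apply hom_ext
    exact LinearMap.add_comp f.lin g'.lin g.lin

instance : Linear k (HMod A) where
  smul_comp _ _ _ r f g := by
    apply hom_ext
    exact LinearMap.comp_smul g.lin r f.lin
  comp_smul _ _ _ f r g := by
    apply hom_ext
    exact LinearMap.smul_comp r g.lin f.lin

instance : MonoidalPreadditive (HMod A) where
  whiskerLeft_zero := by
    intros; apply hom_ext; exact TensorProduct.map_zero_right _
  zero_whiskerRight := by
    intros; apply hom_ext; exact TensorProduct.map_zero_left _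
  whiskerLeft_add _ _ := by
    apply hom_ext; exact TensorProduct.map_add_right _ _ _
  add_whiskerRight _ _ := by
    apply hom_ext; exact TensorProduct.map_add_left _ _ _

instance : MonoidalLinear k (HMod A) where
  whiskerLeft_smul _ _ _ r _ := by
    apply hom_ext; exact TensorProduct.map_smul_right r _ _
  smul_whiskerRight r _ _ _ _ := by
    apply hom_ext; exact TensorProduct.map_smul_left r _ _

section Abelian

/-- The underlying `H`-module. -/
def Carrier (X : HMod A) : Type u := X.V

instance (X : HMod A) : AddCommGroup X.Carrier := X.addCommGroup
instance (X : HMod A) : Module H X.Carrier :=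
  letI : Module (Module.End k X.V) X.V := inferInstance
  Module.compHom X.V X.act.toRingHom

variable [FiniteDimensional k H]

instance (X : HMod A) : Module.Finite H X.Carrier := by
  let : Module k X.Carrier := X.module
  have : Module.Finite k X.Carrier := X.finite
  have : IsScalarTower k H X.Carrier := ⟨fun r h x => by
    change X.act (r • h) x = r • X.act h x
    rw [map_smul]; rfl⟩
  exact Module.Finite.of_restrictScalars_finite k H X.Carrier

/-- The equivalence of `H`-mod with finitely generated `H`-modules. -/
def toFG : HMod A ⥤ FGModuleCat.{u} H where
  obj X := FGModuleCat.of H X.Carrier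
  map {X Y} f := FGModuleCat.ofHom
    ({ toFun := f.lin, map_add' := f.lin.map_add, map_smul' := f.comm } :
      X.Carrier →ₗ[H] Y.Carrier)

instance : (toFG (A := A)).Faithful where
  map_injective {X Y f g} h := by
    apply hom_ext
    ext x
    exact congrArg (fun φ => φ.hom.hom x) h

instance : (toFG (A := A)).Full where
  map_surjective {X Y} φ := by
    let ψ : X.Carrier →ₗ[H] Y.Carrier := φ.hom.hom
    refine ⟨⟨{ toFun := ψ, map_add' := ψ.map_add, map_smul' := fun r x => ?_ }, ψ.map_smul⟩, rfl⟩
    have h := ψ.map_smul (algebraMap k H r) x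
    have h1 : (algebraMap k H r) • (show X.Carrier from x) = (r • x : X.V) := by
      change X.act (algebraMap k H r) x = _
      rw [AlgHom.commutes]; rfl
    have h2 : (algebraMap k H r) • ψ x = (r • (show Y.V from ψ x) : Y.V) := by
      change Y.act (algebraMap k H r) _ = _
      rw [AlgHom.commutes]; rfl
    rw [h1, h2] at h
    exact h

instance : (toFG (A := A)).EssSurj where
  mem_essImage M := by
    let : Module k M := Module.compHom M (algebraMap k H)
    have : IsScalarTower k H M := ⟨fun r h x => by
      change (r • h) • x = (algebraMap k H r) • (h • x)
      rw [Algebra.smul_def, mul_smul]⟩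
    have : Module.Finite k M := Module.Finite.trans H M
    refine ⟨⟨M, Algebra.lsmul k k M⟩, ⟨LinearEquiv.toFGModuleCatIso ?_⟩⟩
    exact { LinearEquiv.refl k M with map_smul' := fun h x => rfl }

instance : (toFG (A := A)).IsEquivalence where

instance : Limits.HasFiniteProducts (HMod A) where
  out _ :=
    have : IsNoetherianRing H := isNoetherian_of_tower k inferInstance
    Adjunction.hasLimitsOfShape_of_equivalence (toFG (A := A))

instance : Abelian (HMod A) :=
  haveI : IsNoetherianRing H := isNoetherian_of_tower k inferInstance
  let B : Abelian (HMod A) := abelianOfEquivalence (toFG (A := A))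
  { toIsNormalMonoCategory := B.toIsNormalMonoCategory
    toIsNormalEpiCategory := B.toIsNormalEpiCategory
    has_finite_products := B.has_finite_products
    has_kernels := B.has_kernels
    has_cokernels := B.has_cokernels }

end Abelian

end HMod

namespace RibbonHopfAlgebra

variable {k H : Type u} [Field k] [Ring H] [HopfAlgebra k H] (A : RibbonHopfAlgebra k H)

lemma κ_mul (a : H) : (A.κ : H) * a = γ k H (γ k H a) * A.κ := by
  rw [← A.κ_conj, mul_assoc, Units.inv_mul, mul_one]

/-- `x ⊗ y ⊗ z ↦ y γ(z) γ²(x) κ`. -/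
def νAux : (H ⊗[k] H) ⊗[k] H →ₗ[k] H :=
  TensorProduct.lift (TensorProduct.lift (LinearMap.mk₂ k
    (fun x y => LinearMap.mulRight k (γ k H (γ k H x) * A.κ) ∘ₗ LinearMap.mulLeft k y ∘ₗ γ k H)
    (fun x x' y => by ext z; simp [add_mul, mul_add, mul_assoc])
    (fun c x y => by ext z; simp [mul_assoc])
    (fun x y y' => by ext z; simp [add_mul])
    (fun c x y => by ext z; simp)))

lemma νAux_tmul (x y z : H) : A.νAux ((x ⊗ₜ y) ⊗ₜ z) = y * γ k H z * (γ k H (γ k H x) * A.κ) :=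
  rfl

lemma νAux_left (r : H ⊗[k] H) (a : H) :
    A.νAux (leg12 k H r * comulRight k H (Coalgebra.comul (R := k) a)) =
      LinearMap.mul' k H (TensorProduct.map LinearMap.id (LinearMap.mulLeft k (A.κ : H))
        (flip k H r)) * a := by
  have key : ∀ w : H ⊗[k] H, A.νAux (leg12 k H r * comulRight k H w) =
      LinearMap.mul' k H (TensorProduct.map LinearMap.id (LinearMap.mulLeft k (A.κ : H))
        (flip k H r)) * TensorProduct.rid k H (LinearMap.lTensor H (Coalgebra.counit (R := k)) w) := by
    intro w
    induction r with
    | zero => simp only [map_zero, zero_mul]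
    | add r s hr hs => simp only [map_add, add_mul, hr, hs]
    | tmul x y =>
      induction w with
      | zero => simp only [map_zero, mul_zero]
      | add r s hr hs => simp only [map_add, mul_add, hr, hs]
      | tmul b c =>
        have h2 : ∀ t : H ⊗[k] H, A.νAux (leg12 k H (x ⊗ₜ y) *
            (TensorProduct.assoc k H H H).symm (b ⊗ₜ t)) =
            y * (LinearMap.mul' k H (LinearMap.lTensor H (γ k H) t)) *
              (γ k H (γ k H (x * b)) * A.κ) := by
          intro t
          induction t with
          | zero => simp only [map_zero, mul_zero, TensorProduct.tmul_zero, zero_mul]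
          | add r s hr hs =>
            simp only [map_add, mul_add, TensorProduct.tmul_add, hr, hs, add_mul]
          | tmul t t' =>
            change A.νAux (((x ⊗ₜ y) ⊗ₜ 1) * ((b ⊗ₜ t) ⊗ₜ t')) = y * (t * γ k H t') * _
            rw [Algebra.TensorProduct.tmul_mul_tmul, Algebra.TensorProduct.tmul_mul_tmul,
              νAux_tmul, one_mul, mul_assoc y]
        refine (h2 (Coalgebra.comul c)).trans ?_
        rw [HopfAlgebra.mul_antipode_lTensor_comul_apply, ← A.κ_mul]
        change _ = y * (A.κ * x) * (Coalgebra.counit (R := k) c • b)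
        rw [Algebra.algebraMap_eq_smul_one]
        simp [mul_assoc]
  rw [key]
  simp

/-- The flip of the first two factors. -/
def flip12 : (H ⊗[k] H) ⊗[k] H →ₐ[k] (H ⊗[k] H) ⊗[k] H :=
  Algebra.TensorProduct.map (flip k H) (AlgHom.id k H)

lemma νAux_right (r : H ⊗[k] H) (a : H) :
    A.νAux (flip12 (comulRight k H (Coalgebra.comul (R := k) a)) * leg12 k H r) =
      a * LinearMap.mul' k H (TensorProduct.map LinearMap.id (LinearMap.mulLeft k (A.κ : H))
        (flip k H r)) := by
  have key : ∀ w : H ⊗[k] H, A.νAux (flip12 (comulRight k H w) * leg12 k H r) =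
      TensorProduct.rid k H (LinearMap.lTensor H (Coalgebra.counit (R := k)) w) *
      LinearMap.mul' k H (TensorProduct.map LinearMap.id (LinearMap.mulLeft k (A.κ : H))
        (flip k H r)) := by
    intro w
    induction r with
    | zero => simp only [map_zero, mul_zero]
    | add r s hr hs => simp only [map_add, mul_add, hr, hs]
    | tmul x y =>
      induction w with
      | zero => simp only [map_zero, zero_mul]
      | add r s hr hs => simp only [map_add, add_mul, hr, hs]
      | tmul b c =>
        have h2 : ∀ t : H ⊗[k] H, A.νAux (flip12 ((TensorProduct.assoc k H H H).symm (b ⊗ₜ t)) *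
            leg12 k H (x ⊗ₜ y)) =
            b * y * (γ k H (γ k H x * LinearMap.mul' k H (LinearMap.rTensor H (γ k H) t)) *
              A.κ) := by
          intro t
          induction t with
          | zero => simp only [map_zero, mul_zero, TensorProduct.tmul_zero, zero_mul]
          | add r s hr hs =>
            simp only [map_add, mul_add, TensorProduct.tmul_add, hr, hs, add_mul]
          | tmul t t' =>
            change A.νAux (((t ⊗ₜ b) ⊗ₜ t') * ((x ⊗ₜ y) ⊗ₜ 1)) =
              b * y * (γ k H (γ k H x * (γ k H t * t')) * A.κ)
            rw [Algebra.TensorProduct.tmul_mul_tmul, Algebra.TensorProduct.tmul_mul_tmul,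
              νAux_tmul, mul_one]
            simp only [γ_mul, mul_assoc]
        refine (h2 (Coalgebra.comul c)).trans ?_
        rw [HopfAlgebra.mul_antipode_rTensor_comul_apply]
        change _ = (Coalgebra.counit (R := k) c • b) * (y * (A.κ * x))
        rw [Algebra.algebraMap_eq_smul_one, A.κ_mul]
        simp [mul_assoc]
  rw [key]
  simp

/-- The element `ν` is central. -/
lemma ν_mul_comm (a : H) : A.ν * a = a * A.ν := by
  have key : ∀ t : H ⊗[k] H, leg12 k H (A.R : H ⊗[k] H) * comulLeft k H t =
      flip12 (comulLeft k H t) * leg12 k H (A.R : H ⊗[k] H) := by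
    intro t
    induction t with
    | zero => simp only [map_zero, mul_zero, zero_mul]
    | add r s hr hs => simp only [map_add, mul_add, add_mul, hr, hs]
    | tmul b c =>
      change ((A.R : H ⊗[k] H) ⊗ₜ[k] (1 : H)) * (Coalgebra.comul (R := k) b ⊗ₜ[k] c) =
        (flip k H (Coalgebra.comul (R := k) b) ⊗ₜ[k] c) * ((A.R : H ⊗[k] H) ⊗ₜ[k] (1 : H))
      rw [Algebra.TensorProduct.tmul_mul_tmul, Algebra.TensorProduct.tmul_mul_tmul,
        A.flip_comul_mul, one_mul, mul_one]
  have h := congrArg A.νAux (key (Coalgebra.comul (R := k) a))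
  rw [coassoc, νAux_left, νAux_right] at h
  exact h

end RibbonHopfAlgebra

namespace HMod

variable {k H : Type u} [Field k] [Ring H] [HopfAlgebra k H]

/-- The ribbon twist of `H`-mod: multiplication by `ν`. -/
def twist (A : RibbonHopfAlgebra k H) : 𝟭 (HMod A) ⟶ 𝟭 (HMod A) where
  app X := (⟨X.act A.ν, fun h x => by
    rw [← Module.End.mul_apply, ← Module.End.mul_apply, ← map_mul, ← map_mul, A.ν_mul_comm]⟩ :
      Hom X X)
  naturality X Y f := by
    apply hom_ext
    ext x
    exact (f.comm A.ν x).symm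

end HMod

namespace RibbonHopfAlgebra

variable {k H : Type u} [Field k] [Ring H] [HopfAlgebra k H] (A : RibbonHopfAlgebra k H)

/-- `(H, R, κ)` is three-modular if `H`-mod is a three-modular category. -/
def IsThreeModular [FiniteDimensional k H] : Prop :=
  RibbonHopf.IsThreeModular k (HMod A) (HMod.twist A)

/-- The element `R¹² R²¹ = ∑ R_i' R_j'' ⊗ R_i'' R_j'`. -/
def monodromy : H ⊗[k] H := (A.R : H ⊗[k] H) * flip k H A.R

/-- The smallest subspace `W` of `H` with `R¹² R²¹ ∈ W ⊗ H`: it consists of the elements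
`(1 ⊗ φ)(R¹² R²¹)` for linear functionals `φ` on `H`. -/
def uSubspace : Submodule k H where
  carrier := {x | ∃ φ : Module.Dual k H,
    x = TensorProduct.rid k H (LinearMap.lTensor H φ A.monodromy)}
  add_mem' := by
    rintro _ _ ⟨φ, rfl⟩ ⟨ψ, rfl⟩
    exact ⟨φ + ψ, by rw [LinearMap.lTensor_add, LinearMap.add_apply, map_add]⟩
  zero_mem' := ⟨0, by rw [LinearMap.lTensor_zero, LinearMap.zero_apply, map_zero]⟩
  smul_mem' := by
    rintro c _ ⟨φ, rfl⟩
    exact ⟨c • φ, by rw [LinearMap.lTensor_smul, LinearMap.smul_apply, map_smul]⟩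

/-- `∑ I(R_i' R_j'') R_i'' R_j'`. -/
def integralOfMonodromy (I : Module.Dual k H) : H :=
  TensorProduct.lid k H (LinearMap.rTensor H I A.monodromy)

end RibbonHopfAlgebra

section Integrals

variable (k : Type u) {H : Type u} [Field k] [Ring H] [HopfAlgebra k H]

/-- A left integral on `H`: a nonzero functional `I` with `x₍₁₎ I(x₍₂₎) = I(x) 1`. -/
structure IsLeftIntegral (I : Module.Dual k H) : Prop where
  ne_zero : I ≠ 0
  apply : ∀ x : H,
    TensorProduct.rid k H (LinearMap.lTensor H I (Coalgebra.comul (R := k) x)) = I x • (1 : H)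

variable (H) in
/-- Every left integral in `H` is a right integral. -/
def IsUnimodular : Prop :=
  ∀ Λ : H, (∀ x : H, x * Λ = Coalgebra.counit (R := k) x • Λ) →
    ∀ x : H, Λ * x = Coalgebra.counit (R := k) x • Λ

end Integrals

end RibbonHopf

end

/-!
The coend `F = ∫ L ⊗ L^∨` of `H`-mod is the dual space of `H` with the coadjoint action, its
structure maps being the matrix coefficients `x ⊗ ξ ↦ (h ↦ ξ(h x))` (`coend_universal`). Every
structure on it becomes a formula in functionals `f` on `H` and in the monodromy
`M = R¹² R²¹ = ∑ M' ⊗ M''`: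
* the product is the transpose of a braided comultiplication (`coendMulLin_matrixCoeff`);
* the pairing is `ω(f ⊗ g) = g(γ(∑ f(M') M''))` (`coendAlgebra_ω_lin_tmul`), so its annihilator is
  the annihilator of `𝔲`, and the quotient `𝐟` is the restriction of functionals to `𝔲`
  (`π_lin_eq_zero_iff`);
* the loop coloured by `f` acts on a module by the element `γ(∑ f(M') M'')`
  (`counit_Ω_lin_tmul`);
* the twist of `F` is `f ↦ f(ν ·)`.

That the operations descend to `𝐟` comes from the fact that `f ↦ ∑ f(M') M''` reverses products
(`sliceLeft_braidedMul_monodromy`), whence `𝔲` is a subalgebra. The twist descends if and only if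
`ν ∈ 𝔲`.

A morphism from the unit to `F` is a functional with `f(x y) = f(y γ²(x))` (`isInvariant_iff`).
On such a functional the braided comultiplication can be replaced by the comultiplication of `H`,
so it is a two-sided integral of `F` exactly when it satisfies the equation of a left integral on
`H` (`isTwoSidedIntegral_iff`); by uniqueness of integrals it is a multiple of `I`. It is nonzero
in `𝐟` exactly when `∑ I(M') M'' ≠ 0`. This shows that the three conditions are necessary.

For the converse, `Δ(ν) = R²¹ R¹² (ν ⊗ ν)` and the integral property of `I` show that the loops
coloured by `I(ν ·)` and `I(ν⁻¹ ·)` act by `I(ν) ν⁻¹` and `I(ν⁻¹) ν`. Both scalars are nonzero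
when `I` does not vanish on `𝔲`, since `ν` is invertible in `𝔲`. As every element of `k` is a
square, there is a scalar `c` with `c² I(ν) I(ν⁻¹) = 1`, and the functional `c I` is then the
normalized integral.

The equivalence of `I(x y) = I(y γ²(x))` with unimodularity is a statement about a
finite-dimensional Hopf algebra with bijective antipode: the form `I(x y)` is nondegenerate, and if
`Λ` is a two-sided integral with `I(Λ) = 1`, then `∑ γ(Λ₁) ⊗ Λ₂` is a pair of dual bases for it.
-/

noncomputable section

namespace RibbonHopf

open Coalgebra

/-! ### Antipode identities and partial evaluation of tensors -/

section HopfIdentities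

variable {k H : Type u} [Field k] [Ring H] [HopfAlgebra k H]

/-- The partial evaluation `x ⊗ y ↦ φ(y) x`. -/
def sliceRight (φ : Module.Dual k H) : H ⊗[k] H →ₗ[k] H :=
  (TensorProduct.rid k H).toLinearMap ∘ₗ LinearMap.lTensor H φ

/-- The partial evaluation `x ⊗ y ↦ φ(x) y`. -/
def sliceLeft (φ : Module.Dual k H) : H ⊗[k] H →ₗ[k] H :=
  (TensorProduct.lid k H).toLinearMap ∘ₗ LinearMap.rTensor H φ

@[simp] lemma sliceRight_tmul (φ : Module.Dual k H) (x y : H) :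
    sliceRight φ (x ⊗ₜ y) = φ y • x := rfl

@[simp] lemma sliceLeft_tmul (φ : Module.Dual k H) (x y : H) :
    sliceLeft φ (x ⊗ₜ y) = φ x • y := rfl

lemma sliceRight_tmul_one_mul (φ : Module.Dual k H) (x : H) (t : H ⊗[k] H) :
    sliceRight φ ((x ⊗ₜ 1) * t) = x * sliceRight φ t := by
  induction t with
  | zero => simp
  | add a b ha hb => simp only [mul_add, map_add, ha, hb]
  | tmul a b => simp

lemma sliceRight_mul_tmul_one (φ : Module.Dual k H) (x : H) (t : H ⊗[k] H) :
    sliceRight φ (t * (x ⊗ₜ 1)) = sliceRight φ t * x := by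
  induction t with
  | zero => simp
  | add a b ha hb => simp only [add_mul, map_add, ha, hb]
  | tmul a b => simp

lemma sliceRight_one_tmul_mul (φ : Module.Dual k H) (x : H) (t : H ⊗[k] H) :
    sliceRight φ ((1 ⊗ₜ x) * t) = sliceRight (φ ∘ₗ LinearMap.mulLeft k x) t := by
  induction t with
  | zero => simp
  | add a b ha hb => simp only [mul_add, map_add, ha, hb]
  | tmul a b => simp

lemma sliceRight_mul_one_tmul (φ : Module.Dual k H) (x : H) (t : H ⊗[k] H) :
    sliceRight φ (t * (1 ⊗ₜ x)) = sliceRight (φ ∘ₗ LinearMap.mulRight k x) t := by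
  induction t with
  | zero => simp
  | add a b ha hb => simp only [add_mul, map_add, ha, hb]
  | tmul a b => simp

lemma sliceLeft_one_tmul_mul (φ : Module.Dual k H) (x : H) (t : H ⊗[k] H) :
    sliceLeft φ ((1 ⊗ₜ x) * t) = x * sliceLeft φ t := by
  induction t with
  | zero => simp
  | add a b ha hb => simp only [mul_add, map_add, ha, hb]
  | tmul a b => simp

lemma sliceLeft_mul_one_tmul (φ : Module.Dual k H) (x : H) (t : H ⊗[k] H) :
    sliceLeft φ (t * (1 ⊗ₜ x)) = sliceLeft φ t * x := by
  induction t with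
  | zero => simp
  | add a b ha hb => simp only [add_mul, map_add, ha, hb]
  | tmul a b => simp

lemma sliceLeft_tmul_one_mul (φ : Module.Dual k H) (x : H) (t : H ⊗[k] H) :
    sliceLeft φ ((x ⊗ₜ 1) * t) = sliceLeft (φ ∘ₗ LinearMap.mulLeft k x) t := by
  induction t with
  | zero => simp
  | add a b ha hb => simp only [mul_add, map_add, ha, hb]
  | tmul a b => simp

lemma sliceLeft_mul_tmul_one (φ : Module.Dual k H) (x : H) (t : H ⊗[k] H) :
    sliceLeft φ (t * (x ⊗ₜ 1)) = sliceLeft (φ ∘ₗ LinearMap.mulRight k x) t := by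
  induction t with
  | zero => simp
  | add a b ha hb => simp only [add_mul, map_add, ha, hb]
  | tmul a b => simp

lemma sliceLeft_flip (φ : Module.Dual k H) (t : H ⊗[k] H) :
    sliceLeft φ (flip k H t) = sliceRight φ t := by
  induction t with
  | zero => simp
  | add a b ha hb => simp only [map_add, ha, hb]
  | tmul a b => simp [flip]

lemma sliceRight_flip (φ : Module.Dual k H) (t : H ⊗[k] H) :
    sliceRight φ (flip k H t) = sliceLeft φ t := by
  induction t with
  | zero => simp
  | add a b ha hb => simp only [map_add, ha, hb]
  | tmul a b => simp [flip]

@[simp] lemma flip_tmul (x y : H) : flip k H (x ⊗ₜ y) = y ⊗ₜ x := rfl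

@[simp] lemma flip_flip (t : H ⊗[k] H) : flip k H (flip k H t) = t :=
  (TensorProduct.comm k H H).symm_apply_apply t

/-- Coassociativity, applied to two bilinear maps which agree after rebracketing. -/
lemma sum_comul_left_eq_sum_comul_right {ι : Type*} {h : H} (r : Repr k h ι)
    {P : Type*} [AddCommGroup P] [Module k P] (f : H ⊗[k] H →ₗ[k] H →ₗ[k] P)
    (g : H →ₗ[k] H ⊗[k] H →ₗ[k] P) (hfg : ∀ x y z, f (x ⊗ₜ y) z = g x (y ⊗ₜ z)) :
    ∑ i ∈ r.index, f (comul (r.left i)) (r.right i) =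
      ∑ i ∈ r.index, g (r.left i) (comul (r.right i)) := by
  have h1 : TensorProduct.lift f =
      TensorProduct.lift g ∘ₗ (TensorProduct.assoc k H H H).toLinearMap := by
    apply TensorProduct.ext_threefold
    intro x y z
    simp [hfg]
  have h2 := congrArg (TensorProduct.lift g) (Coalgebra.coassoc_apply (R := k) h)
  have h3 := LinearMap.congr_fun h1 (LinearMap.rTensor H comul (comul h))
  rw [LinearMap.comp_apply, LinearEquiv.coe_coe, h2] at h3
  simpa [← r.eq, map_sum] using h3

lemma sum_smul_counit {ι : Type*} {h : H} (r : Repr k h ι) :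
    ∑ i ∈ r.index, counit (R := k) (r.right i) • r.left i = h := by
  have := congrArg (TensorProduct.rid k H) (Coalgebra.sum_tmul_counit_eq r)
  rw [map_sum] at this
  simpa only [TensorProduct.rid_tmul, one_smul] using this

lemma sum_algebraMap_counit_tmul {ι : Type*} {h : H} (r : Repr k h ι) :
    ∑ i ∈ r.index, algebraMap k H (counit (R := k) (r.left i)) ⊗ₜ[k] r.right i = 1 ⊗ₜ h := by
  conv_rhs => rw [← Coalgebra.sum_counit_smul r, TensorProduct.tmul_sum]
  simp only [Algebra.algebraMap_eq_smul_one, TensorProduct.tmul_smul, TensorProduct.smul_tmul']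

/-- `∑ (γ(h₁) ⊗ 1) Δ(h₂) = 1 ⊗ h`. -/
lemma sum_antipode_tmul_one_mul_comul {ι : Type*} {h : H} (r : Repr k h ι) :
    ∑ i ∈ r.index, (γ k H (r.left i) ⊗ₜ 1) * comul (R := k) (r.right i) = 1 ⊗ₜ[k] h := by
  have := sum_comul_left_eq_sum_comul_right r
    ((TensorProduct.mk k H H) ∘ₗ (LinearMap.mul' k H ∘ₗ LinearMap.rTensor H (γ k H)))
    ((LinearMap.mul k (H ⊗[k] H)) ∘ₗ ((TensorProduct.mk k H H).flip 1 ∘ₗ γ k H))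
    (fun x y z => by simp)
  simpa [sum_algebraMap_counit_tmul r] using this.symm

variable (A : RibbonHopfAlgebra k H)

/-- `∑ Δ(h₂) (γ⁻¹(h₁) ⊗ 1) = 1 ⊗ h`. -/
lemma sum_comul_mul_antipodeInv_tmul_one {ι : Type*} {h : H} (r : Repr k h ι) :
    ∑ i ∈ r.index, comul (R := k) (r.right i) * (A.antipodeInv (r.left i) ⊗ₜ 1) =
      1 ⊗ₜ[k] h := by
  have := sum_comul_left_eq_sum_comul_right r
    ((TensorProduct.mk k H H) ∘ₗ (LinearMap.mul' k H ∘ₗ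
      TensorProduct.map LinearMap.id A.antipodeInv ∘ₗ (flip k H).toLinearMap))
    ((LinearMap.mul k (H ⊗[k] H)).flip ∘ₗ ((TensorProduct.mk k H H).flip 1 ∘ₗ A.antipodeInv))
    (fun x y z => by simp)
  simpa [sum_algebraMap_counit_tmul r, antipodeInv_right] using this.symm

lemma flip_map (f g : H →ₗ[k] H) (t : H ⊗[k] H) :
    flip k H (TensorProduct.map f g t) = TensorProduct.map g f (flip k H t) := by
  induction t with
  | zero => simp
  | add a b ha hb => simp only [map_add, ha, hb]
  | tmul a b => simp

lemma map_antipode_mul (s t : H ⊗[k] H) :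
    TensorProduct.map (γ k H) (γ k H) (s * t) =
      TensorProduct.map (γ k H) (γ k H) t * TensorProduct.map (γ k H) (γ k H) s := by
  induction s with
  | zero => simp
  | add a b ha hb => simp only [add_mul, mul_add, map_add, ha, hb]
  | tmul a b =>
    induction t with
    | zero => simp
    | add a b ha hb => simp only [add_mul, mul_add, map_add, ha, hb]
    | tmul c d => simp [RibbonHopfAlgebra.γ_mul]

/-- The antipode reverses the comultiplication: both sides are convolution inverse to `Δ`. -/
lemma comul_antipode (h : H) : comul (R := k) (γ k H h) =
    flip k H (TensorProduct.map (γ k H) (γ k H) (comul (R := k) h)) := by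
  let L : H →ₗ[k] H ⊗[k] H := (flip k H).toLinearMap ∘ₗ TensorProduct.map (γ k H) (γ k H) ∘ₗ comul
  let K : H ⊗[k] H →ₗ[k] H ⊗[k] H := LinearMap.mul' k (H ⊗[k] H) ∘ₗ
    TensorProduct.map ((TensorProduct.mk k H H).flip 1 ∘ₗ γ k H) comul
  have hK (h : H) : K (comul h) = 1 ⊗ₜ h := by
    rw [← sum_antipode_tmul_one_mul_comul (Repr.arbitrary k h)]
    conv_lhs => rw [← (Repr.arbitrary k h).eq]
    simp [K]
  have hL : WithConv.toConv L * WithConv.toConv (comul : H →ₗ[k] H ⊗[k] H) = 1 := by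
    ext h
    rw [(Repr.arbitrary k h).convMul_apply]
    set r := Repr.arbitrary k h
    -- `(1 ⊗ γ(h₁)) (γ(h₂) ⊗ 1) Δ(h₃)` collapses from the right
    have := sum_comul_left_eq_sum_comul_right r
      ((LinearMap.mul k (H ⊗[k] H) ∘ₗ (flip k H).toLinearMap ∘ₗ
        TensorProduct.map (γ k H) (γ k H)).compl₂ comul)
      ((LinearMap.mul k (H ⊗[k] H) ∘ₗ TensorProduct.mk k H H 1 ∘ₗ γ k H).compl₂ K)
      (fun x y z => by simp [K, ← mul_assoc])
    refine this.trans ?_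
    simp only [LinearMap.compl₂_apply, LinearMap.comp_apply, LinearMap.mul_apply', hK,
      TensorProduct.mk_apply, Algebra.TensorProduct.tmul_mul_tmul, mul_one,
      ← TensorProduct.tmul_sum, HopfAlgebra.sum_antipode_mul_eq_algebraMap_counit r]
    simp [Algebra.algebraMap_eq_smul_one, Algebra.TensorProduct.one_def]
  have hR : WithConv.toConv (comul : H →ₗ[k] H ⊗[k] H) * WithConv.toConv (comul ∘ₗ γ k H) = 1 := by
    ext h
    rw [(Repr.arbitrary k h).convMul_apply]
    simp only [LinearMap.comp_apply, ← Bialgebra.comul_mul, ← map_sum,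
      HopfAlgebra.sum_mul_antipode_eq_algebraMap_counit (Repr.arbitrary k h)]
    simp
  have := left_inv_eq_right_inv hL hR
  exact (LinearMap.congr_fun (WithConv.toConv_injective this) h).symm

/-- Partial evaluations in the two factors commute. -/
lemma apply_sliceLeft (φ ψ : Module.Dual k H) (t : H ⊗[k] H) :
    φ (sliceLeft ψ t) = ψ (sliceRight φ t) := by
  induction t with
  | zero => simp
  | add a b ha hb => simp only [map_add, ha, hb]
  | tmul a b => simp [mul_comm]

lemma sum_basis_tmul_sliceLeft {ι : Type*} [Fintype ι] (b : Module.Basis ι k H) (t : H ⊗[k] H) :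
    ∑ i, b i ⊗ₜ[k] sliceLeft (b.coord i) t = t := by
  induction t with
  | zero => simp
  | add x y hx hy => simp only [map_add, TensorProduct.tmul_add, Finset.sum_add_distrib, hx, hy]
  | tmul x y =>
    conv_rhs => rw [← b.sum_repr x, TensorProduct.sum_tmul]
    simp [TensorProduct.smul_tmul]

@[simp] lemma sliceRight_counit_comul (h : H) : sliceRight (counit (R := k)) (comul h) = h := by
  simp [sliceRight]

@[simp] lemma sliceLeft_counit_comul (h : H) : sliceLeft (counit (R := k)) (comul h) = h := by
  simp [sliceLeft]

end HopfIdentities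

end RibbonHopf

end

noncomputable section

namespace RibbonHopf

open Coalgebra

/-! ### Integrals -/

namespace IsLeftIntegral

variable {k H : Type u} [Field k] [Ring H] [HopfAlgebra k H] {I : Module.Dual k H}

lemma sliceRight_comul (hI : IsLeftIntegral k I) (h : H) :
    sliceRight I (comul h) = I h • (1 : H) := hI.apply h

/-- `∑ h₁ I(g h₂) = ∑ γ(g₁) I(g₂ h)`. -/
lemma sliceRight_mulLeft_comul (hI : IsLeftIntegral k I) {ι : Type*} {g : H} (r : Repr k g ι)
    (h : H) : sliceRight (I ∘ₗ LinearMap.mulLeft k g) (comul h) =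
      ∑ i ∈ r.index, I (r.right i * h) • γ k H (r.left i) := by
  rw [← sliceRight_one_tmul_mul, ← sum_antipode_tmul_one_mul_comul r, Finset.sum_mul, map_sum]
  refine Finset.sum_congr rfl fun i _ => ?_
  rw [mul_assoc, sliceRight_tmul_one_mul, ← Bialgebra.comul_mul, hI.sliceRight_comul]
  simp

variable (A : RibbonHopfAlgebra k H)

/-- `∑ h₁ I(h₂ g) = ∑ γ⁻¹(g₁) I(h g₂)`. -/
lemma sliceRight_mulRight_comul (hI : IsLeftIntegral k I) {ι : Type*} {g : H} (r : Repr k g ι)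
    (h : H) : sliceRight (I ∘ₗ LinearMap.mulRight k g) (comul h) =
      ∑ i ∈ r.index, I (h * r.right i) • A.antipodeInv (r.left i) := by
  rw [← sliceRight_mul_one_tmul, ← sum_comul_mul_antipodeInv_tmul_one A r, Finset.mul_sum, map_sum]
  refine Finset.sum_congr rfl fun i _ => ?_
  rw [← mul_assoc, sliceRight_mul_tmul_one, ← Bialgebra.comul_mul, hI.sliceRight_comul]
  simp

lemma antipodeInv_sliceRight_mulLeft_comul (hI : IsLeftIntegral k I) (g h : H) :
    A.antipodeInv (sliceRight (I ∘ₗ LinearMap.mulLeft k g) (comul h)) =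
      sliceRight (I ∘ₗ LinearMap.mulRight k h) (comul g) := by
  rw [hI.sliceRight_mulLeft_comul (Repr.arbitrary k g), ← (Repr.arbitrary k g).eq, map_sum,
    map_sum]
  simp [A.antipodeInv_γ]

include A in
/-- A left integral is a nondegenerate functional. The radical `N` of the form `(x, y) ↦ I(x y)`
is a right ideal and a left coideal, hence `ε` vanishes on it as `ε(g) 1 = ∑ g₂ γ⁻¹(g₁) ∈ N`
and `1 ∉ N`; but then `N = 0` as `g = ∑ g₁ ε(g₂)`. -/
lemma eq_zero_of_mul_right [FiniteDimensional k H] (hI : IsLeftIntegral k I) {g : H}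
    (hg : ∀ h, I (g * h) = 0) : g = 0 := by
  have coideal : ∀ g : H, (∀ h, I (g * h) = 0) → ∀ (ψ : Module.Dual k H) (h : H),
      I (sliceLeft ψ (comul g) * h) = 0 := by
    intro g hg ψ h
    have h0 : I ∘ₗ LinearMap.mulLeft k g = 0 := LinearMap.ext hg
    have h1 := hI.antipodeInv_sliceRight_mulLeft_comul A g h
    have h2 := apply_sliceLeft (I ∘ₗ LinearMap.mulRight k h) ψ (comul g)
    rw [← h1, h0] at h2
    simpa [sliceRight] using h2
  have counit_eq : ∀ g : H, (∀ h, I (g * h) = 0) → counit (R := k) g = 0 := by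
    intro g hg
    by_contra hne
    apply hI.ne_zero
    ext h
    have h1 := antipodeInv_right A g
    rw [← sum_basis_tmul_sliceLeft (Module.finBasis k H) (comul g)] at h1
    have h2 := congrArg (fun x => I (x * h)) h1
    simp only [map_sum, flip_tmul, TensorProduct.map_tmul, LinearMap.id_apply,
      LinearMap.mul'_apply, Finset.sum_mul, mul_assoc, coideal g hg, Finset.sum_const_zero,
      Algebra.algebraMap_eq_smul_one, smul_mul_assoc, one_mul, map_smul, smul_eq_mul] at h2
    exact (mul_eq_zero.1 h2.symm).resolve_left hne
  rw [← Module.forall_dual_apply_eq_zero_iff k]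
  intro ψ
  have := counit_eq _ (coideal g hg ψ)
  rwa [apply_sliceLeft, sliceRight_counit_comul] at this

include A in
lemma exists_mulLeft [FiniteDimensional k H] (hI : IsLeftIntegral k I) (φ : Module.Dual k H) :
    ∃ g, ∀ h, φ h = I (g * h) := by
  have hinj : Function.Injective (LinearMap.compRight k I ∘ₗ LinearMap.mul k H) := by
    rw [injective_iff_map_eq_zero]
    exact fun g hg => hI.eq_zero_of_mul_right A (LinearMap.congr_fun hg)
  obtain ⟨g, hg⟩ := (LinearMap.injective_iff_surjective_of_finrank_eq_finrank
    (Subspace.dual_finrank_eq (K := k) (V := H)).symm).1 hinj φ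
  exact ⟨g, fun h => (LinearMap.congr_fun hg h).symm⟩

include A in
lemma eq_zero_of_mul_left [FiniteDimensional k H] (hI : IsLeftIntegral k I) {g : H}
    (hg : ∀ h, I (h * g) = 0) : g = 0 := by
  rw [← Module.forall_dual_apply_eq_zero_iff k]
  intro φ
  obtain ⟨x, hx⟩ := hI.exists_mulLeft A φ
  rw [hx, hg]

include A in
lemma exists_mulRight [FiniteDimensional k H] (hI : IsLeftIntegral k I) (φ : Module.Dual k H) :
    ∃ g, ∀ h, φ h = I (h * g) := by
  have hinj : Function.Injective (LinearMap.compRight k I ∘ₗ (LinearMap.mul k H).flip) := by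
    rw [injective_iff_map_eq_zero]
    exact fun g hg => hI.eq_zero_of_mul_left A (LinearMap.congr_fun hg)
  obtain ⟨g, hg⟩ := (LinearMap.injective_iff_surjective_of_finrank_eq_finrank
    (Subspace.dual_finrank_eq (K := k) (V := H)).symm).1 hinj φ
  exact ⟨g, fun h => (LinearMap.congr_fun hg h).symm⟩

include A in
/-- Left integrals are unique up to a scalar. -/
lemma exists_eq_smul [FiniteDimensional k H] (hI : IsLeftIntegral k I) {J : Module.Dual k H}
    (hJ : ∀ h, sliceRight J (comul h) = J h • (1 : H)) : ∃ c : k, J = c • I := by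
  obtain ⟨g, hg⟩ := hI.exists_mulLeft A J
  have hJg : J = I ∘ₗ LinearMap.mulLeft k g := LinearMap.ext hg
  -- writing `J = I(g ·)`, the integral property of `J` says that `∑ g₁ ⊗ g₂ = 1 ⊗ g`
  have hslice (ψ : Module.Dual k H) : sliceLeft ψ (comul g) = ψ 1 • g := by
    rw [← sub_eq_zero]
    refine hI.eq_zero_of_mul_right A fun h => ?_
    have h1 := hI.antipodeInv_sliceRight_mulLeft_comul A g h
    rw [← hJg, hJ, map_smul, A.antipodeInv_one] at h1
    have h2 := apply_sliceLeft (I ∘ₗ LinearMap.mulRight k h) ψ (comul g)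
    rw [← h1, map_smul, hg, LinearMap.comp_apply, LinearMap.mulRight_apply] at h2
    rw [sub_mul, map_sub, h2, smul_mul_assoc, map_smul, smul_eq_mul, smul_eq_mul, mul_comm,
      sub_self]
  have hg1 : g = counit (R := k) g • (1 : H) := by
    rw [← sub_eq_zero, ← Module.forall_dual_apply_eq_zero_iff k]
    intro ψ
    have := congrArg (counit (R := k)) (hslice ψ)
    rw [apply_sliceLeft, sliceRight_counit_comul, map_smul] at this
    simp [this, mul_comm]
  refine ⟨counit (R := k) g, LinearMap.ext fun h => ?_⟩
  rw [hg h]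
  conv_lhs => rw [hg1]
  simp

include A in
/-- The Nakayama automorphism of the form `(x, y) ↦ I(x y)` is `γ²` exactly when `H` is
unimodular. If `Λ` is a two-sided integral with `I(Λ) = 1`, then `∑ γ(Λ₁) ⊗ Λ₂` is a pair of dual
bases of the form, and expanding in these bases gives the symmetry. -/
lemma forall_mul_antipode_antipode_iff_isUnimodular [FiniteDimensional k H]
    (hI : IsLeftIntegral k I) :
    (∀ x y : H, I (x * y) = I (y * γ k H (γ k H x))) ↔ IsUnimodular k H := by
  constructor
  · intro h2 Λ hΛ x
    have hΛ' (y : H) : y * γ k H (γ k H Λ) = counit (R := k) y • γ k H (γ k H Λ) := by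
      have := congrArg (fun z => γ k H (γ k H z)) (hΛ (A.antipodeInv (A.antipodeInv y)))
      simp only [RibbonHopfAlgebra.γ_mul, A.γ_antipodeInv, map_smul] at this
      rw [this]
      congr 1
      conv_rhs => rw [← A.γ_antipodeInv y, ← A.γ_antipodeInv (A.antipodeInv y)]
      simp
    rw [← sub_eq_zero]
    refine hI.eq_zero_of_mul_right A fun h => ?_
    rw [sub_mul, map_sub, mul_assoc, h2 Λ, hΛ', smul_mul_assoc, map_smul, map_smul, h2 Λ, hΛ']
    simp [mul_assoc]
  · intro hU x y
    obtain ⟨Λ, hΛ⟩ := hI.exists_mulRight A (counit (R := k))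
    have hleft (x : H) : x * Λ = counit (R := k) x • Λ := by
      rw [← sub_eq_zero]
      refine hI.eq_zero_of_mul_left A fun h => ?_
      rw [mul_sub, map_sub, ← mul_assoc, ← hΛ, mul_smul_comm, map_smul, ← hΛ]
      simp [mul_comm]
    have hright := hU Λ hleft
    have hΛ1 : I Λ = 1 := by simpa using (hΛ 1).symm
    let r := Repr.arbitrary k Λ
    have e1 (h : H) : h = ∑ i ∈ r.index, I (h * r.right i) • A.antipodeInv (r.left i) := by
      rw [← hI.sliceRight_mulRight_comul A r]
      have : I ∘ₗ LinearMap.mulRight k Λ = counit (R := k) := LinearMap.ext fun h => (hΛ h).symm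
      rw [this, sliceRight_counit_comul]
    have e2 (h : H) : h = ∑ i ∈ r.index, I (r.right i * h) • γ k H (r.left i) := by
      rw [← hI.sliceRight_mulLeft_comul r]
      have : I ∘ₗ LinearMap.mulLeft k Λ = counit (R := k) :=
        LinearMap.ext fun h => by simp [hright, hΛ1]
      rw [this, sliceRight_counit_comul]
    have e3 : y = ∑ i ∈ r.index, I (y * γ k H (r.left i)) • r.right i := by
      rw [← sub_eq_zero]
      refine hI.eq_zero_of_mul_right A fun z => ?_
      rw [sub_mul, map_sub, sub_eq_zero]
      conv_lhs => rw [e2 z]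
      simp only [Finset.mul_sum, Finset.sum_mul, map_sum, mul_smul_comm, smul_mul_assoc, map_smul,
        smul_eq_mul, mul_comm]
    have e4 : γ k H (γ k H x) = ∑ i ∈ r.index, I (x * r.right i) • γ k H (r.left i) := by
      conv_lhs => rw [e1 x]
      simp [A.γ_antipodeInv]
    rw [e4]
    conv_lhs => rw [e3]
    simp only [Finset.mul_sum, map_sum, mul_smul_comm, map_smul, smul_eq_mul, mul_comm]

end IsLeftIntegral

end RibbonHopf

end

noncomputable section

namespace RibbonHopf

open Coalgebra

/-! ### The universal `R`-matrix -/

namespace RibbonHopfAlgebra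

variable {k H : Type u} [Field k] [Ring H] [HopfAlgebra k H] (A : RibbonHopfAlgebra k H)

/-- The index set of a chosen expression of `R` as a finite sum of pure tensors. -/
def index : Finset (H × H) := (TensorProduct.exists_finset (A.R : H ⊗[k] H)).choose

lemma R_eq_sum : (A.R : H ⊗[k] H) = ∑ p ∈ A.index, p.1 ⊗ₜ p.2 :=
  (TensorProduct.exists_finset (A.R : H ⊗[k] H)).choose_spec

/-- `(Δ ⊗ 1) R = R¹³ R²³`, applied to a bilinear map. -/
lemma sum_comul_left {P : Type*} [AddCommGroup P] [Module k P]
    (f : H ⊗[k] H →ₗ[k] H →ₗ[k] P) :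
    ∑ p ∈ A.index, f (comul p.1) p.2 =
      ∑ p ∈ A.index, ∑ q ∈ A.index, f (p.1 ⊗ₜ q.1) (p.2 * q.2) := by
  have h := congrArg (TensorProduct.lift f) A.comulLeft_R
  rw [A.R_eq_sum] at h
  simpa [comulLeft, leg13, leg23, Finset.sum_mul_sum] using h

/-- `(1 ⊗ Δ) R = R¹³ R¹²`, applied to a bilinear map. -/
lemma sum_comul_right {P : Type*} [AddCommGroup P] [Module k P]
    (f : H →ₗ[k] H ⊗[k] H →ₗ[k] P) :
    ∑ p ∈ A.index, f p.1 (comul p.2) =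
      ∑ p ∈ A.index, ∑ q ∈ A.index, f (p.1 * q.1) (q.2 ⊗ₜ p.2) := by
  have h := congrArg (fun t => TensorProduct.lift f (TensorProduct.assoc k H H H t)) A.comulRight_R
  have h' (t : H ⊗[k] (H ⊗[k] H)) : TensorProduct.assoc k H H H
      ((Algebra.TensorProduct.assoc k k k H H H).symm t) = t :=
    (TensorProduct.assoc k H H H).apply_symm_apply t
  rw [A.R_eq_sum] at h
  simp only [comulRight, leg13, leg12, map_sum, Finset.sum_mul_sum, AlgHom.comp_apply] at h
  simpa [h'] using h

/-- Applying `ε` to the first factor of `(Δ ⊗ 1) R = R¹³ R²³` and cancelling `R`. -/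
lemma sliceLeft_counit_R : sliceLeft (counit (R := k)) (A.R : H ⊗[k] H) = 1 := by
  have h := A.sum_comul_left (LinearMap.compl₁₂ (TensorProduct.mk k H H)
    (sliceLeft (counit (R := k))) LinearMap.id)
  have h1 : 1 * (A.R : H ⊗[k] H) =
      (1 ⊗ₜ sliceLeft (counit (R := k)) (A.R : H ⊗[k] H)) * (A.R : H ⊗[k] H) := by
    rw [A.R_eq_sum, one_mul]
    simpa [Finset.sum_mul_sum, TensorProduct.tmul_sum, TensorProduct.smul_tmul] using h
  have h2 := congrArg (sliceLeft (counit (R := k))) (A.R.isUnit.mul_right_cancel h1)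
  simpa [Algebra.TensorProduct.one_def] using h2.symm

lemma sliceRight_counit_R : sliceRight (counit (R := k)) (A.R : H ⊗[k] H) = 1 := by
  have h := A.sum_comul_right (LinearMap.compl₁₂ (TensorProduct.mk k H H)
    LinearMap.id (sliceRight (counit (R := k))))
  have h1 : 1 * (A.R : H ⊗[k] H) =
      (sliceRight (counit (R := k)) (A.R : H ⊗[k] H) ⊗ₜ 1) * (A.R : H ⊗[k] H) := by
    rw [A.R_eq_sum, one_mul]
    simpa [Finset.sum_mul_sum, TensorProduct.sum_tmul, TensorProduct.smul_tmul'] using h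
  have h2 := congrArg (sliceRight (counit (R := k))) (A.R.isUnit.mul_right_cancel h1)
  simpa [Algebra.TensorProduct.one_def] using h2.symm

lemma sum_counit_smul_right : ∑ p ∈ A.index, counit (R := k) p.1 • p.2 = 1 := by
  rw [← A.sliceLeft_counit_R, A.R_eq_sum]; simp

lemma sum_counit_smul_left : ∑ p ∈ A.index, counit (R := k) p.2 • p.1 = 1 := by
  rw [← A.sliceRight_counit_R, A.R_eq_sum]; simp

/-- Applying `γ(x₁) x₂ = ε(x)` to the first factor of `(Δ ⊗ 1) R = R¹³ R²³` gives
`(γ ⊗ 1)(R) R = 1`. -/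
lemma map_antipode_id_mul_R :
    TensorProduct.map (γ k H) LinearMap.id (A.R : H ⊗[k] H) * A.R = 1 := by
  have h := A.sum_comul_left (LinearMap.compl₁₂ (TensorProduct.mk k H H)
    (LinearMap.mul' k H ∘ₗ LinearMap.rTensor H (γ k H)) LinearMap.id)
  have h1 : (1 : H ⊗[k] H) = 1 ⊗ₜ (∑ p ∈ A.index, counit (R := k) p.1 • p.2) := by
    rw [A.sum_counit_smul_right, Algebra.TensorProduct.one_def]
  rw [h1, A.R_eq_sum]
  simpa [Finset.sum_mul_sum, TensorProduct.tmul_sum, Algebra.algebraMap_eq_smul_one,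
    ← TensorProduct.smul_tmul'] using h.symm

lemma map_antipode_id_R :
    TensorProduct.map (γ k H) LinearMap.id (A.R : H ⊗[k] H) = ((A.R⁻¹ : (H ⊗[k] H)ˣ) : H ⊗[k] H) :=
  (Units.inv_eq_of_mul_eq_one_left A.map_antipode_id_mul_R).symm

lemma R_mul_map_id_antipodeInv :
    (A.R : H ⊗[k] H) * TensorProduct.map LinearMap.id A.antipodeInv (A.R : H ⊗[k] H) = 1 := by
  have h := A.sum_comul_right (LinearMap.compl₁₂ (TensorProduct.mk k H H) LinearMap.id
    (LinearMap.mul' k H ∘ₗ TensorProduct.map LinearMap.id A.antipodeInv ∘ₗ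
      (flip k H).toLinearMap))
  have h1 : (1 : H ⊗[k] H) = (∑ p ∈ A.index, counit (R := k) p.2 • p.1) ⊗ₜ 1 := by
    rw [A.sum_counit_smul_left, Algebra.TensorProduct.one_def]
  rw [h1, A.R_eq_sum]
  simpa [Finset.sum_mul_sum, TensorProduct.sum_tmul, Algebra.algebraMap_eq_smul_one,
    antipodeInv_right, TensorProduct.smul_tmul'] using h.symm

lemma map_id_antipodeInv_R :
    TensorProduct.map LinearMap.id A.antipodeInv (A.R : H ⊗[k] H) =
      ((A.R⁻¹ : (H ⊗[k] H)ˣ) : H ⊗[k] H) :=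
  (Units.inv_eq_of_mul_eq_one_right A.R_mul_map_id_antipodeInv).symm

lemma map_antipode_antipode_R :
    TensorProduct.map (γ k H) (γ k H) (A.R : H ⊗[k] H) = A.R := by
  have h : TensorProduct.map (γ k H) (γ k H) (A.R : H ⊗[k] H) =
      TensorProduct.map LinearMap.id (γ k H)
        (TensorProduct.map (γ k H) LinearMap.id (A.R : H ⊗[k] H)) := by
    rw [← LinearMap.comp_apply, ← TensorProduct.map_comp]; rfl
  rw [h, A.map_antipode_id_R, ← A.map_id_antipodeInv_R, ← LinearMap.comp_apply,
    ← TensorProduct.map_comp]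
  have : γ k H ∘ₗ A.antipodeInv = LinearMap.id := LinearMap.ext A.γ_antipodeInv
  rw [this, LinearMap.id_comp, TensorProduct.map_id, LinearMap.id_apply]

lemma map_antipodeInv_antipodeInv_R :
    TensorProduct.map A.antipodeInv A.antipodeInv (A.R : H ⊗[k] H) = A.R := by
  conv_lhs => rw [← A.map_antipode_antipode_R]
  rw [← LinearMap.comp_apply, ← TensorProduct.map_comp]
  have : A.antipodeInv ∘ₗ γ k H = LinearMap.id := LinearMap.ext A.antipodeInv_γ
  rw [this, TensorProduct.map_id, LinearMap.id_apply]

end RibbonHopfAlgebra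

end RibbonHopf

end

noncomputable section

namespace RibbonHopf

open Coalgebra

/-! ### The Drinfeld element and the ribbon element -/

namespace RibbonHopfAlgebra

variable {k H : Type u} [Field k] [Ring H] [HopfAlgebra k H] (A : RibbonHopfAlgebra k H)

lemma κ_mul_κ_inv : (A.κ : H) * ((A.κ⁻¹ : Hˣ) : H) = 1 := Units.mul_inv _

lemma antipode_κ : γ k H (A.κ : H) = ((A.κ⁻¹ : Hˣ) : H) :=
  (Units.inv_eq_of_mul_eq_one_left A.isGroupLike_κ.antipode_mul_cancel).symm

/-- The element `∑ γ(R'') R'`, which implements the square of the antipode. -/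
def drinfeldElement : H := ∑ p ∈ A.index, γ k H p.2 * p.1

/-- The element `∑ R'' γ²(R')`, inverse to the Drinfeld element. -/
def drinfeldInv : H := ∑ p ∈ A.index, p.2 * γ k H (γ k H p.1)

lemma ν_eq_drinfeldInv_mul : A.ν = A.drinfeldInv * A.κ := by
  rw [ν, A.R_eq_sum, drinfeldInv]
  simp [Finset.sum_mul, mul_assoc, A.κ_mul]

lemma drinfeldInv_eq : A.drinfeldInv = A.ν * ((A.κ⁻¹ : Hˣ) : H) := by
  rw [A.ν_eq_drinfeldInv_mul, mul_assoc, A.κ_mul_κ_inv, mul_one]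

/-- As `ν` is central and `κ` implements `γ²`, the inverse of the Drinfeld element implements
`γ⁻²`. -/
lemma mul_drinfeldInv (a : H) : a * A.drinfeldInv = A.drinfeldInv * γ k H (γ k H a) := by
  rw [A.drinfeldInv_eq, ← A.κ_conj, ← mul_assoc, ← A.ν_mul_comm]
  simp [mul_assoc]

lemma drinfeldElement_mul_drinfeldInv : A.drinfeldElement * A.drinfeldInv = 1 := by
  have h1 := congrArg (LinearMap.mul' k H ∘ₗ TensorProduct.map (γ k H) (γ k H ∘ₗ γ k H) ∘ₗ
    (flip k H).toLinearMap) (Units.inv_mul A.R)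
  rw [← A.map_id_antipodeInv_R, A.R_eq_sum] at h1
  simp only [map_sum, Finset.sum_mul_sum, LinearMap.comp_apply, TensorProduct.map_tmul,
    Algebra.TensorProduct.tmul_mul_tmul, AlgHom.toLinearMap_apply, flip_tmul, LinearMap.id_apply,
    γ_mul, A.γ_antipodeInv, LinearMap.mul'_apply, Algebra.TensorProduct.one_def,
    HopfAlgebra.antipode_one, mul_one] at h1
  rw [← h1, drinfeldElement, Finset.sum_mul, Finset.sum_comm]
  refine Finset.sum_congr rfl fun p _ => ?_
  rw [mul_assoc, A.mul_drinfeldInv, drinfeldInv, Finset.sum_mul, Finset.mul_sum]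
  exact Finset.sum_congr rfl fun q _ => by simp only [mul_assoc]

/-- `∑ Δ(γ(R'')) (R' ⊗ 1) = (u ⊗ 1) (1 ⊗ γ)(R)`. -/
lemma sum_comul_antipode_mul_tmul_one :
    ∑ p ∈ A.index, comul (R := k) (γ k H p.2) * (p.1 ⊗ₜ 1) =
      ∑ q ∈ A.index, (A.drinfeldElement * q.1) ⊗ₜ[k] γ k H q.2 := by
  have h := A.sum_comul_right ((LinearMap.mul k (H ⊗[k] H)).flip.compl₁₂
    ((TensorProduct.mk k H H).flip 1)
    ((flip k H).toLinearMap ∘ₗ TensorProduct.map (γ k H) (γ k H)))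
  simp only [LinearMap.compl₁₂_apply, LinearMap.flip_apply, LinearMap.mul_apply',
    LinearMap.comp_apply, AlgHom.toLinearMap_apply, TensorProduct.mk_apply, TensorProduct.map_tmul,
    flip_tmul, Algebra.TensorProduct.tmul_mul_tmul, mul_one, ← comul_antipode] at h
  rw [h, Finset.sum_comm]
  simp [drinfeldElement, Finset.sum_mul, TensorProduct.sum_tmul, mul_assoc]

lemma flip_R_inv : flip k H ((A.R⁻¹ : (H ⊗[k] H)ˣ) : H ⊗[k] H) =
    ∑ p ∈ A.index, A.antipodeInv p.2 ⊗ₜ p.1 := by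
  rw [← A.map_id_antipodeInv_R, A.R_eq_sum]
  simp

lemma flip_R_inv_mul_comul (a : H) :
    flip k H ((A.R⁻¹ : (H ⊗[k] H)ˣ) : H ⊗[k] H) * comul (R := k) a =
      flip k H (comul (R := k) a) * flip k H ((A.R⁻¹ : (H ⊗[k] H)ˣ) : H ⊗[k] H) := by
  conv_lhs => rw [← flip_flip (comul (R := k) a), A.flip_comul]
  rw [← map_mul, ← map_mul]
  simp [← mul_assoc]

/-- For `R⁻²¹ = ∑ γ⁻¹(R'') ⊗ R'`, the commutation of `R⁻²¹` past `Δ` in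
`∑ (1 ⊗ γ(R'')) R⁻²¹ Δ(R')`. -/
lemma sum_antipode_tmul_mul_tmul :
    ∑ m ∈ A.index, ∑ q ∈ A.index, ∑ p ∈ A.index,
      (A.antipodeInv p.2 * m.1) ⊗ₜ[k] (γ k H (m.2 * q.2) * (p.1 * q.1)) =
    (∑ q ∈ A.index, q.1 ⊗ₜ[k] (γ k H q.2 * A.drinfeldElement)) *
      flip k H ((A.R⁻¹ : (H ⊗[k] H)ˣ) : H ⊗[k] H) := by
  have h1 := A.sum_comul_left ((LinearMap.mul k (H ⊗[k] H)).flip.compl₁₂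
    (LinearMap.mulLeft k (flip k H ((A.R⁻¹ : (H ⊗[k] H)ˣ) : H ⊗[k] H)))
    (TensorProduct.mk k H H 1 ∘ₗ γ k H))
  have h2 := A.sum_comul_left ((LinearMap.mul k (H ⊗[k] H)).flip.compl₁₂
    (flip k H).toLinearMap (TensorProduct.mk k H H 1 ∘ₗ γ k H))
  simp only [LinearMap.compl₁₂_apply, LinearMap.flip_apply, LinearMap.mul_apply',
    LinearMap.comp_apply, AlgHom.toLinearMap_apply, TensorProduct.mk_apply, flip_tmul,
    LinearMap.mulLeft_apply, A.flip_R_inv_mul_comul] at h1 h2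
  simp only [← mul_assoc, ← Finset.sum_mul] at h1
  rw [h2] at h1
  have h3 : ∑ p ∈ A.index, ∑ q ∈ A.index,
      ((1 : H) ⊗ₜ[k] γ k H (p.2 * q.2)) * (q.1 ⊗ₜ[k] p.1) =
      ∑ q ∈ A.index, q.1 ⊗ₜ[k] (γ k H q.2 * A.drinfeldElement) := by
    rw [Finset.sum_comm]
    simp [drinfeldElement, Finset.mul_sum, TensorProduct.tmul_sum, γ_mul, mul_assoc]
  rw [← h3, h1]
  refine Finset.sum_congr rfl fun m _ => Finset.sum_congr rfl fun q _ => ?_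
  rw [A.flip_R_inv]
  simp [Finset.mul_sum, Finset.sum_mul, mul_assoc]

variable [FiniteDimensional k H]

lemma drinfeldInv_mul_drinfeldElement : A.drinfeldInv * A.drinfeldElement = 1 :=
  have : IsNoetherianRing H := isNoetherian_of_tower k inferInstance
  mul_eq_one_comm.1 A.drinfeldElement_mul_drinfeldInv

lemma drinfeldElement_mul (a : H) :
    A.drinfeldElement * a = γ k H (γ k H a) * A.drinfeldElement := by
  calc A.drinfeldElement * a = A.drinfeldElement * (a * A.drinfeldInv) * A.drinfeldElement := by
        rw [mul_assoc, mul_assoc, A.drinfeldInv_mul_drinfeldElement, mul_one]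
    _ = γ k H (γ k H a) * A.drinfeldElement := by
        rw [A.mul_drinfeldInv, ← mul_assoc, A.drinfeldElement_mul_drinfeldInv, one_mul]

lemma antipode_mul_drinfeldElement (a : H) :
    γ k H a * A.drinfeldElement = A.drinfeldElement * A.antipodeInv a := by
  rw [A.drinfeldElement_mul, A.γ_antipodeInv]

/-- `Δ(u) = (u ⊗ u) (R²¹ R¹²)⁻¹` for the Drinfeld element `u = ∑ γ(R'') R'`. Expanding `Δ(R')` and
then `Δ(γ(R''))` by the hexagon identities leaves two copies of `u`, an `R⁻¹` and an `R⁻²¹`. -/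
lemma comul_drinfeldElement : comul (R := k) A.drinfeldElement =
    (A.drinfeldElement ⊗ₜ A.drinfeldElement) * ((A.R⁻¹ : (H ⊗[k] H)ˣ) : H ⊗[k] H) *
      flip k H ((A.R⁻¹ : (H ⊗[k] H)ˣ) : H ⊗[k] H) := by
  set u := A.drinfeldElement
  let Z : H ⊗[k] H := ∑ m ∈ A.index, (u * m.1) ⊗ₜ[k] γ k H m.2
  have h1 := A.sum_comul_left ((LinearMap.mul k (H ⊗[k] H)).flip.compl₂ (comul ∘ₗ γ k H))
  have h2 := A.sum_comul_right ((LinearMap.mul k (H ⊗[k] H)).flip.compl₁₂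
    (LinearMap.mulLeft k Z ∘ₗ TensorProduct.mk k H H 1)
    ((flip k H).toLinearMap ∘ₗ TensorProduct.map (γ k H) (γ k H)))
  simp only [LinearMap.compl₂_apply, LinearMap.compl₁₂_apply, LinearMap.flip_apply,
    LinearMap.mul_apply', LinearMap.comp_apply, TensorProduct.mk_apply, flip_tmul,
    LinearMap.mulLeft_apply, TensorProduct.map_tmul, AlgHom.toLinearMap_apply,
    ← comul_antipode] at h1 h2
  have h3 : comul (R := k) u =
      ∑ q ∈ A.index, comul (R := k) (γ k H q.2) * (Z * (1 ⊗ₜ q.1)) := by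
    rw [show u = ∑ p ∈ A.index, γ k H p.2 * p.1 from rfl, map_sum]
    simp only [Bialgebra.comul_mul]
    rw [h1, Finset.sum_comm]
    refine Finset.sum_congr rfl fun q _ => ?_
    rw [show Z = _ from A.sum_comul_antipode_mul_tmul_one.symm, Finset.sum_mul, Finset.mul_sum]
    refine Finset.sum_congr rfl fun p _ => ?_
    rw [γ_mul, Bialgebra.comul_mul, mul_assoc, mul_assoc, Algebra.TensorProduct.tmul_mul_tmul,
      one_mul, mul_one]
  have h4 : ∑ p ∈ A.index, ∑ q ∈ A.index,
      (γ k H p.2 ⊗ₜ[k] γ k H q.2) * (Z * (1 ⊗ₜ (p.1 * q.1))) =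
      (u ⊗ₜ 1) * ∑ m ∈ A.index, ∑ q ∈ A.index, ∑ p ∈ A.index,
        (A.antipodeInv p.2 * m.1) ⊗ₜ[k] (γ k H (m.2 * q.2) * (p.1 * q.1)) := by
    simp only [Z, Finset.mul_sum, Finset.sum_mul, Algebra.TensorProduct.tmul_mul_tmul, mul_one,
      one_mul, γ_mul, ← mul_assoc, u, A.antipode_mul_drinfeldElement]
    rw [Finset.sum_comm]
    conv_lhs => enter [2, q]; rw [Finset.sum_comm]
    rw [Finset.sum_comm]
  have h5 : (u ⊗ₜ[k] (1 : H)) * ∑ q ∈ A.index, q.1 ⊗ₜ[k] (γ k H q.2 * u) =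
      (u ⊗ₜ u) * ((A.R⁻¹ : (H ⊗[k] H)ˣ) : H ⊗[k] H) := by
    rw [← A.map_id_antipodeInv_R, A.R_eq_sum]
    simp [Finset.mul_sum, u, A.antipode_mul_drinfeldElement]
  rw [h3, h2, h4, A.sum_antipode_tmul_mul_tmul, ← mul_assoc, h5]

/-- `Δ(ν) = R²¹ R¹² (ν ⊗ ν)`. -/
lemma comul_ν : comul (R := k) A.ν =
    flip k H (A.R : H ⊗[k] H) * (A.R : H ⊗[k] H) * (A.ν ⊗ₜ A.ν) := by
  have h1 : comul (R := k) A.drinfeldInv * comul (R := k) A.drinfeldElement = 1 := by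
    rw [← Bialgebra.comul_mul, A.drinfeldInv_mul_drinfeldElement, Bialgebra.comul_one]
  have h2 : comul (R := k) A.drinfeldElement * (flip k H (A.R : H ⊗[k] H) * (A.R : H ⊗[k] H) *
      (A.drinfeldInv ⊗ₜ A.drinfeldInv)) = 1 := by
    rw [A.comul_drinfeldElement]
    simp only [mul_assoc]
    rw [← mul_assoc (flip k H _) (flip k H _), ← map_mul, Units.inv_mul, map_one, one_mul,
      ← mul_assoc _ (A.R : H ⊗[k] H), Units.inv_mul, one_mul, Algebra.TensorProduct.tmul_mul_tmul,
      A.drinfeldElement_mul_drinfeldInv, Algebra.TensorProduct.one_def]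
  rw [A.ν_eq_drinfeldInv_mul, Bialgebra.comul_mul, A.isGroupLike_κ.comul_eq_tmul_self,
    left_inv_eq_right_inv h1 h2, mul_assoc, Algebra.TensorProduct.tmul_mul_tmul]

/-- The condition `κ² = u₁ u₄` enters here: `u₁` is the Drinfeld element `u` and `u₄ = γ(u⁻¹)`, so
`γ(u⁻¹) = u⁻¹ κ²`, and `ν = u⁻¹ κ`. -/
lemma antipode_ν : γ k H A.ν = A.ν := by
  have h1 : γ k H A.drinfeldInv =
      LinearMap.mul' k H (TensorProduct.map (γ k H ∘ₗ γ k H) LinearMap.id (A.R : H ⊗[k] H)) := by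
    conv_rhs => rw [← A.map_antipode_antipode_R, A.R_eq_sum]
    simp [drinfeldInv, γ_mul]
  have h2 : LinearMap.mul' k H (TensorProduct.map (γ k H) LinearMap.id (flip k H A.R)) =
      A.drinfeldElement := by
    rw [A.R_eq_sum]; simp [drinfeldElement]
  have h3 : γ k H A.drinfeldInv = A.drinfeldInv * (A.κ * A.κ) := by
    rw [A.κ_sq, h2, ← h1, ← mul_assoc, A.drinfeldInv_mul_drinfeldElement, one_mul]
  conv_lhs => rw [A.ν_eq_drinfeldInv_mul]
  rw [γ_mul, A.antipode_κ, h3, A.drinfeldInv_eq, mul_assoc A.ν, ← mul_assoc _ (A.κ : H),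
    Units.inv_mul, one_mul, ← mul_assoc, ← A.ν_mul_comm, mul_assoc, Units.inv_mul, mul_one]

lemma antipodeInv_ν : A.antipodeInv A.ν = A.ν := by
  conv_lhs => rw [← A.antipode_ν, A.antipodeInv_γ]

/-- The ribbon element as a unit. -/
def νUnit : Hˣ where
  val := A.ν
  inv := ((A.κ⁻¹ : Hˣ) : H) * A.drinfeldElement
  val_inv := by
    rw [← mul_assoc, ← A.drinfeldInv_eq, A.drinfeldInv_mul_drinfeldElement]
  inv_val := by
    rw [← A.ν_mul_comm, ← mul_assoc, ← A.drinfeldInv_eq, A.drinfeldInv_mul_drinfeldElement]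

end RibbonHopfAlgebra

end RibbonHopf

end

noncomputable section

namespace RibbonHopf

open Coalgebra

/-! ### The monodromy and the braided comultiplication -/

namespace RibbonHopfAlgebra

variable {k H : Type u} [Field k] [Ring H] [HopfAlgebra k H] (A : RibbonHopfAlgebra k H)

lemma flip_monodromy : flip k H A.monodromy = flip k H A.R * (A.R : H ⊗[k] H) := by
  rw [monodromy, map_mul, flip_flip]

lemma map_antipode_monodromy :
    TensorProduct.map (γ k H) (γ k H) A.monodromy = flip k H A.monodromy := by
  rw [A.flip_monodromy, monodromy, map_antipode_mul, ← flip_map, A.map_antipode_antipode_R]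

lemma flip_monodromy_mul_comul (h : H) :
    flip k H A.monodromy * comul (R := k) h = comul (R := k) h * flip k H A.monodromy := by
  have h1 := congrArg (flip k H) (A.flip_comul_mul h)
  rw [map_mul, map_mul, flip_flip] at h1
  rw [A.flip_monodromy, mul_assoc, ← A.flip_comul_mul, ← mul_assoc, ← h1, mul_assoc]

/-- The monodromy as a unit. -/
def monodromyUnit : (H ⊗[k] H)ˣ := A.R * Units.map (flip k H : H ⊗[k] H →* H ⊗[k] H) A.R

lemma coe_monodromyUnit : (A.monodromyUnit : H ⊗[k] H) = A.monodromy := rfl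

lemma coe_monodromyUnit_inv : ((A.monodromyUnit⁻¹ : (H ⊗[k] H)ˣ) : H ⊗[k] H) =
    flip k H ((A.R⁻¹ : (H ⊗[k] H)ˣ) : H ⊗[k] H) * ((A.R⁻¹ : (H ⊗[k] H)ˣ) : H ⊗[k] H) := by
  rw [monodromyUnit, mul_inv_rev]; rfl

/-- The permutation `x ⊗ y ⊗ z ↦ y ⊗ z ⊗ x`. -/
def rotate : (H ⊗[k] H) ⊗[k] H →ₐ[k] (H ⊗[k] H) ⊗[k] H :=
  (Algebra.TensorProduct.comm k H (H ⊗[k] H)).toAlgHom.comp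
    (Algebra.TensorProduct.assoc k k k H H H).toAlgHom

lemma rotate_comulRight (t : H ⊗[k] H) :
    rotate (comulRight k H t) = comulLeft k H (flip k H t) := by
  induction t with
  | zero => simp
  | add a b ha hb => simp only [map_add, ha, hb]
  | tmul a b =>
    change Algebra.TensorProduct.comm k H (H ⊗[k] H) (TensorProduct.assoc k H H H
      ((TensorProduct.assoc k H H H).symm (a ⊗ₜ comul b))) = _
    rw [LinearEquiv.apply_symm_apply]
    rfl

lemma rotate_leg13 (t : H ⊗[k] H) : rotate (leg13 k H t) = leg23 k H (flip k H t) := by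
  induction t with
  | zero => simp
  | add a b ha hb => simp only [map_add, ha, hb]
  | tmul a b => rfl

lemma rotate_leg12 (t : H ⊗[k] H) : rotate (leg12 k H t) = leg13 k H (flip k H t) := by
  induction t with
  | zero => simp
  | add a b ha hb => simp only [map_add, ha, hb]
  | tmul a b => rfl

lemma flip12_leg13 (t : H ⊗[k] H) : flip12 (leg13 k H t) = leg23 k H t := by
  induction t with
  | zero => simp
  | add a b ha hb => simp only [map_add, ha, hb]
  | tmul a b => rfl

lemma flip12_leg23 (t : H ⊗[k] H) : flip12 (leg23 k H t) = leg13 k H t := by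
  induction t with
  | zero => simp
  | add a b ha hb => simp only [map_add, ha, hb]
  | tmul a b => rfl

lemma leg12_mul_comulLeft (t : H ⊗[k] H) : leg12 k H (A.R : H ⊗[k] H) * comulLeft k H t =
    flip12 (comulLeft k H t) * leg12 k H (A.R : H ⊗[k] H) := by
  induction t with
  | zero => simp only [map_zero, mul_zero, zero_mul]
  | add r s hr hs => simp only [map_add, mul_add, add_mul, hr, hs]
  | tmul b c =>
    change ((A.R : H ⊗[k] H) ⊗ₜ[k] (1 : H)) * (comul (R := k) b ⊗ₜ[k] c) =
      (flip k H (comul (R := k) b) ⊗ₜ[k] c) * ((A.R : H ⊗[k] H) ⊗ₜ[k] (1 : H))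
    rw [Algebra.TensorProduct.tmul_mul_tmul, Algebra.TensorProduct.tmul_mul_tmul,
      A.flip_comul_mul, one_mul, mul_one]

/-- The Yang–Baxter equation. -/
lemma yangBaxter : leg12 k H (A.R : H ⊗[k] H) * (leg13 k H A.R * leg23 k H A.R) =
    leg23 k H A.R * leg13 k H A.R * leg12 k H (A.R : H ⊗[k] H) := by
  rw [← A.comulLeft_R, A.leg12_mul_comulLeft, A.comulLeft_R, map_mul, flip12_leg13, flip12_leg23]

/-- `(Δ ⊗ 1) R²¹` in terms of `R`, from `(1 ⊗ Δ) R` by a cyclic permutation of the factors. -/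
lemma comulLeft_flip_R : comulLeft k H (flip k H A.R) =
    leg23 k H (flip k H A.R) * leg13 k H (flip k H A.R) := by
  rw [← rotate_comulRight, A.comulRight_R, map_mul, rotate_leg13, rotate_leg12]

lemma leg23_flip_monodromy_mul_comulRight (t : H ⊗[k] H) :
    leg23 k H (flip k H A.monodromy) * comulRight k H t =
      comulRight k H t * leg23 k H (flip k H A.monodromy) := by
  have h (s : H ⊗[k] H) :
      leg23 k H s = (Algebra.TensorProduct.assoc k k k H H H).symm (1 ⊗ₜ s) := by
    induction s with
    | zero => simp
    | add a b ha hb => simp only [map_add, ha, hb, TensorProduct.tmul_add]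
    | tmul a b => rfl
  induction t with
  | zero => simp
  | add a b ha hb => simp only [map_add, ha, hb, mul_add, add_mul]
  | tmul a b =>
    change _ * (Algebra.TensorProduct.assoc k k k H H H).symm (a ⊗ₜ comul b) =
      (Algebra.TensorProduct.assoc k k k H H H).symm (a ⊗ₜ comul b) * _
    rw [h, ← map_mul, ← map_mul, Algebra.TensorProduct.tmul_mul_tmul,
      Algebra.TensorProduct.tmul_mul_tmul, A.flip_monodromy_mul_comul, one_mul, mul_one]

/-- `M²³` commutes with `R¹² R¹³`: for the flip of `M` and `R¹³ R¹² = (1 ⊗ Δ) R` this is the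
commutation of the flip of `M` with `Δ`, and the Yang–Baxter equation exchanges the two forms. -/
lemma leg23_monodromy_mul : leg23 k H A.monodromy * (leg12 k H A.R * leg13 k H A.R) =
    leg12 k H A.R * leg13 k H A.R * leg23 k H A.monodromy := by
  have h1 := A.leg23_flip_monodromy_mul_comulRight A.R
  have h2 := A.yangBaxter
  rw [A.comulRight_R, A.flip_monodromy, map_mul] at h1
  have hu : IsUnit (leg23 k H (A.R : H ⊗[k] H)) := A.R.isUnit.map (leg23 k H)
  apply hu.mul_right_cancel
  rw [monodromy, map_mul]
  set a := leg12 k H (A.R : H ⊗[k] H)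
  set b := leg13 k H (A.R : H ⊗[k] H)
  set c := leg23 k H (A.R : H ⊗[k] H)
  set f := leg23 k H (flip k H A.R)
  calc c * f * (a * b) * c = c * f * (a * (b * c)) := by simp only [mul_assoc]
    _ = c * (f * c * (b * a)) := by rw [h2]; simp only [mul_assoc]
    _ = c * b * a * (f * c) := by rw [h1]; simp only [mul_assoc]
    _ = a * b * (c * f) * c := by rw [← h2]; simp only [mul_assoc]

/-- The comultiplication of `H` transported through the braiding,
`h ↦ ∑ (γ⁻¹(R') ⊗ 1) R Δ(h) (1 ⊗ R'')`. Its transpose is the multiplication of the coend. -/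
def braidedComul : H →ₗ[k] H ⊗[k] H :=
  (∑ p ∈ A.index, LinearMap.mulLeft k (A.antipodeInv p.1 ⊗ₜ[k] (1 : H)) ∘ₗ
    LinearMap.mulRight k ((1 : H) ⊗ₜ[k] p.2)) ∘ₗ
    LinearMap.mulLeft k (A.R : H ⊗[k] H) ∘ₗ comul

lemma braidedComul_apply (h : H) : A.braidedComul h = ∑ p ∈ A.index,
    (A.antipodeInv p.1 ⊗ₜ[k] (1 : H)) * ((A.R : H ⊗[k] H) * comul h) * ((1 : H) ⊗ₜ[k] p.2) := by
  simp [braidedComul, mul_assoc]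

/-- `(γ⁻¹ ⊗ 1)` applied to `(γ ⊗ 1)(R) R = 1`. -/
lemma sum_antipodeInv_mul_R : ∑ p ∈ A.index,
    (A.antipodeInv p.1 ⊗ₜ[k] (1 : H)) * (A.R : H ⊗[k] H) * ((1 : H) ⊗ₜ[k] p.2) = 1 := by
  have h1 := congrArg (TensorProduct.map A.antipodeInv LinearMap.id) A.map_antipode_id_mul_R
  rw [A.R_eq_sum] at h1 ⊢
  simp only [map_sum, Finset.sum_mul_sum, TensorProduct.map_tmul,
    Algebra.TensorProduct.tmul_mul_tmul, A.antipodeInv_mul, A.antipodeInv_γ, LinearMap.id_apply,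
    Algebra.TensorProduct.one_def, A.antipodeInv_one] at h1
  rw [Algebra.TensorProduct.one_def, ← h1, Finset.sum_comm]
  simp [Finset.mul_sum, Finset.sum_mul]

/-- The monodromy turns the braided comultiplication into a product:
`(Δ ⊗ 1) M = M²³ M¹³` for the braided comultiplication `Δ`. -/
lemma map_braidedComul_monodromy :
    TensorProduct.map A.braidedComul LinearMap.id A.monodromy =
      leg23 k H A.monodromy * leg13 k H A.monodromy := by
  have h1 (t : H ⊗[k] H) : TensorProduct.map A.braidedComul LinearMap.id t =
      ∑ p ∈ A.index, leg12 k H (A.antipodeInv p.1 ⊗ₜ[k] (1 : H)) *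
        (leg12 k H A.R * comulLeft k H t) * leg12 k H ((1 : H) ⊗ₜ[k] p.2) := by
    induction t with
    | zero => simp
    | add a b ha hb => simp only [map_add, ha, hb, mul_add, add_mul, Finset.sum_add_distrib]
    | tmul a b =>
      rw [TensorProduct.map_tmul, A.braidedComul_apply, TensorProduct.sum_tmul]
      refine Finset.sum_congr rfl fun p _ => ?_
      change _ = ((_ ⊗ₜ[k] (1 : H)) * ((_ ⊗ₜ[k] (1 : H)) * (comul a ⊗ₜ[k] b))) *
        (_ ⊗ₜ[k] (1 : H))
      simp only [Algebra.TensorProduct.tmul_mul_tmul, one_mul, mul_one, LinearMap.id_apply]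
  have h2 : leg12 k H A.R * comulLeft k H A.monodromy =
      leg23 k H A.monodromy * leg12 k H A.R * leg13 k H A.monodromy := by
    rw [mul_assoc, monodromy, map_mul (comulLeft k H), A.comulLeft_R, A.comulLeft_flip_R,
      map_mul (leg13 k H), ← mul_assoc _ (leg13 k H _), ← mul_assoc (leg23 k H _)]
    have h3 := A.leg23_monodromy_mul
    rw [monodromy] at h3
    rw [h3, map_mul (leg23 k H)]
    simp only [mul_assoc]
  have c1 (x : H) (t : H ⊗[k] H) : leg12 k H (x ⊗ₜ[k] (1 : H)) * leg23 k H t =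
      leg23 k H t * leg12 k H (x ⊗ₜ[k] (1 : H)) := by
    induction t with
    | zero => simp
    | add a b ha hb => simp only [map_add, ha, hb, mul_add, add_mul]
    | tmul a b => simp [leg12, leg23]
  have c2 (x : H) (t : H ⊗[k] H) : leg13 k H t * leg12 k H ((1 : H) ⊗ₜ[k] x) =
      leg12 k H ((1 : H) ⊗ₜ[k] x) * leg13 k H t := by
    induction t with
    | zero => simp
    | add a b ha hb => simp only [map_add, ha, hb, mul_add, add_mul]
    | tmul a b => simp [leg12, leg13]
  rw [h1, h2]
  have h4 (p : H × H) : leg12 k H (A.antipodeInv p.1 ⊗ₜ[k] (1 : H)) *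
      (leg23 k H A.monodromy * leg12 k H A.R * leg13 k H A.monodromy) *
      leg12 k H ((1 : H) ⊗ₜ[k] p.2) = leg23 k H A.monodromy *
        leg12 k H ((A.antipodeInv p.1 ⊗ₜ[k] (1 : H)) * (A.R : H ⊗[k] H) * ((1 : H) ⊗ₜ[k] p.2)) *
        leg13 k H A.monodromy := by
    rw [map_mul (leg12 k H), map_mul (leg12 k H)]
    simp only [mul_assoc]
    rw [c2]
    simp only [← mul_assoc]
    rw [c1]
  simp only [h4]
  rw [← Finset.sum_mul, ← Finset.mul_sum, ← map_sum, A.sum_antipodeInv_mul_R, map_one, mul_one]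

end RibbonHopfAlgebra

end RibbonHopf

end

noncomputable section

namespace RibbonHopf

open Coalgebra

/-! ### The subspace `𝔲` and functionals symmetric up to `γ²` -/

namespace RibbonHopfAlgebra

variable {k H : Type u} [Field k] [Ring H] [HopfAlgebra k H] (A : RibbonHopfAlgebra k H)

lemma mem_uSubspace {x : H} :
    x ∈ A.uSubspace ↔ ∃ φ : Module.Dual k H, x = sliceRight φ A.monodromy := Iff.rfl

/-- The functionals vanishing on `𝔲` form the kernel of `φ ↦ (φ ⊗ 1)(R¹² R²¹)`. -/
lemma forall_mem_uSubspace_eq_zero_iff (φ : Module.Dual k H) :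
    (∀ x ∈ A.uSubspace, φ x = 0) ↔ sliceLeft φ A.monodromy = 0 := by
  rw [← Module.forall_dual_apply_eq_zero_iff k]
  constructor
  · intro h χ
    rw [apply_sliceLeft]
    exact h _ ⟨χ, rfl⟩
  · rintro h _ ⟨χ, rfl⟩
    exact (apply_sliceLeft χ φ _).symm.trans (h χ)

lemma sliceRight_counit_mul (s t : H ⊗[k] H) : sliceRight (counit (R := k)) (s * t) =
    sliceRight (counit (R := k)) s * sliceRight (counit (R := k)) t := by
  induction s with
  | zero => simp
  | add a b ha hb => simp only [map_add, ha, hb, add_mul]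
  | tmul a b =>
    induction t with
    | zero => simp
    | add a b ha hb => simp only [map_add, ha, hb, mul_add]
    | tmul c d =>
      simpa [mul_smul] using smul_comm (counit (R := k) b) (counit (R := k) d) (a * c)

lemma one_mem_uSubspace : (1 : H) ∈ A.uSubspace :=
  ⟨counit (R := k), by
    change _ = sliceRight _ A.monodromy
    rw [monodromy, sliceRight_counit_mul, sliceRight_flip, A.sliceLeft_counit_R,
      A.sliceRight_counit_R, one_mul]⟩

/-- `∑ φ(M') γ(M'') = ∑ φ(γ⁻¹(M'')) M'` for the monodromy `M`. -/
lemma antipode_sliceLeft_monodromy (φ : Module.Dual k H) :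
    γ k H (sliceLeft (φ ∘ₗ γ k H) A.monodromy) = sliceRight φ A.monodromy := by
  have h (t : H ⊗[k] H) : γ k H (sliceLeft (φ ∘ₗ γ k H) t) =
      sliceLeft φ (TensorProduct.map (γ k H) (γ k H) t) := by
    induction t with
    | zero => simp
    | add a b ha hb => simp only [map_add, ha, hb]
    | tmul a b => simp
  rw [h, A.map_antipode_monodromy, sliceLeft_flip]

lemma antipode_sliceRight_monodromy (φ : Module.Dual k H) :
    γ k H (sliceRight (φ ∘ₗ γ k H) A.monodromy) = sliceLeft φ A.monodromy := by
  have h (t : H ⊗[k] H) : γ k H (sliceRight (φ ∘ₗ γ k H) t) =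
      sliceRight φ (TensorProduct.map (γ k H) (γ k H) t) := by
    induction t with
    | zero => simp
    | add a b ha hb => simp only [map_add, ha, hb]
    | tmul a b => simp
  rw [h, A.map_antipode_monodromy, sliceRight_flip]

lemma mem_uSubspace_iff_antipode {x : H} :
    x ∈ A.uSubspace ↔ ∃ φ : Module.Dual k H, γ k H x = sliceLeft φ A.monodromy := by
  rw [mem_uSubspace]
  constructor
  · rintro ⟨φ, rfl⟩
    refine ⟨φ ∘ₗ A.antipodeInv, ?_⟩
    rw [← A.antipode_sliceRight_monodromy, LinearMap.comp_assoc,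
      show A.antipodeInv ∘ₗ γ k H = LinearMap.id from LinearMap.ext A.antipodeInv_γ,
      LinearMap.comp_id]
  · rintro ⟨φ, h⟩
    refine ⟨φ ∘ₗ γ k H, A.antipode_bijective.1 ?_⟩
    rw [h, A.antipode_sliceRight_monodromy]

/-- The functional `h ↦ (φ ⊗ ψ)(Δ(h))` for the braided comultiplication `Δ`: the product of `φ`
and `ψ` in the coend. -/
def braidedMul (φ ψ : Module.Dual k H) : Module.Dual k H :=
  LinearMap.mul' k k ∘ₗ TensorProduct.map φ ψ ∘ₗ A.braidedComul

/-- The map `φ ↦ (φ ⊗ 1)(R¹² R²¹)` reverses products. -/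
lemma sliceLeft_braidedMul_monodromy (φ ψ : Module.Dual k H) :
    sliceLeft (A.braidedMul φ ψ) A.monodromy =
      sliceLeft ψ A.monodromy * sliceLeft φ A.monodromy := by
  let G : (H ⊗[k] H) ⊗[k] H →ₗ[k] H := (TensorProduct.lid k H).toLinearMap ∘ₗ
    LinearMap.rTensor H (LinearMap.mul' k k ∘ₗ TensorProduct.map φ ψ)
  have h1 (t : H ⊗[k] H) : sliceLeft (A.braidedMul φ ψ) t =
      G (TensorProduct.map A.braidedComul LinearMap.id t) := by
    induction t with
    | zero => simp
    | add a b ha hb => simp only [map_add, ha, hb]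
    | tmul a b => simp [G, braidedMul]
  have h2 (s t : H ⊗[k] H) : G (leg23 k H s * leg13 k H t) = sliceLeft ψ s * sliceLeft φ t := by
    induction s with
    | zero => simp
    | add a b ha hb => simp only [map_add, ha, hb, add_mul]
    | tmul a b =>
      induction t with
      | zero => simp
      | add a b ha hb => simp only [map_add, ha, hb, mul_add]
      | tmul c d => simp [G, leg23, leg13, mul_smul]
  rw [h1, A.map_braidedComul_monodromy, h2]

/-- The subspace `𝔲` is closed under multiplication. -/
lemma mul_mem_uSubspace {x y : H} (hx : x ∈ A.uSubspace) (hy : y ∈ A.uSubspace) :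
    x * y ∈ A.uSubspace := by
  rw [mem_uSubspace_iff_antipode] at hx hy ⊢
  obtain ⟨φ, hφ⟩ := hx
  obtain ⟨ψ, hψ⟩ := hy
  exact ⟨A.braidedMul φ ψ, by rw [γ_mul, hφ, hψ, A.sliceLeft_braidedMul_monodromy]⟩

/-- A functional `φ` with `φ(x y) = φ(y γ²(x))`, that is, an invariant of the coend. -/
def IsInvariant (k : Type u) {H : Type u} [Field k] [Ring H] [HopfAlgebra k H]
    (φ : Module.Dual k H) : Prop :=
  ∀ x y : H, φ (x * y) = φ (y * γ k H (γ k H x))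

section Invariant

variable {A} {φ : Module.Dual k H}

lemma IsInvariant.smul (hφ : IsInvariant k φ) (c : k) : IsInvariant k (c • φ) := fun x y => by
  simp [hφ x y]

variable (A)

lemma IsInvariant.comp_mulLeft_antipodeInv (hφ : IsInvariant k φ) (a : H) :
    φ ∘ₗ LinearMap.mulLeft k (A.antipodeInv a) = φ ∘ₗ LinearMap.mulRight k (γ k H a) := by
  ext x
  simp [hφ (A.antipodeInv a), A.γ_antipodeInv]

lemma IsInvariant.comp_mulRight (hφ : IsInvariant k φ) (a : H) :
    φ ∘ₗ LinearMap.mulRight k a =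
      φ ∘ₗ LinearMap.mulLeft k (A.antipodeInv (A.antipodeInv a)) := by
  ext x
  simp [hφ (A.antipodeInv (A.antipodeInv a)), A.γ_antipodeInv]

/-- For an invariant functional the right-hand factor `1 ⊗ R''` of the braided comultiplication can
be moved to the left, where it cancels `R`. -/
lemma IsInvariant.sliceRight_braidedComul (hφ : IsInvariant k φ) (h : H) :
    sliceRight φ (A.braidedComul h) = sliceRight φ (comul h) := by
  have h1 : ∑ p ∈ A.index, A.antipodeInv p.1 ⊗ₜ[k] A.antipodeInv (A.antipodeInv p.2) =
      ((A.R⁻¹ : (H ⊗[k] H)ˣ) : H ⊗[k] H) := by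
    rw [← A.map_id_antipodeInv_R, ← A.map_antipodeInv_antipodeInv_R, A.R_eq_sum]
    simp
  rw [A.braidedComul_apply, map_sum]
  have h2 (p : H × H) : sliceRight φ ((A.antipodeInv p.1 ⊗ₜ[k] (1 : H)) *
      ((A.R : H ⊗[k] H) * comul h) * ((1 : H) ⊗ₜ[k] p.2)) =
      sliceRight φ ((A.antipodeInv p.1 ⊗ₜ[k] A.antipodeInv (A.antipodeInv p.2)) *
        ((A.R : H ⊗[k] H) * comul h)) := by
    rw [sliceRight_mul_one_tmul, hφ.comp_mulRight A, ← sliceRight_one_tmul_mul, ← mul_assoc,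
      Algebra.TensorProduct.tmul_mul_tmul, one_mul, mul_one]
  simp only [h2]
  rw [← map_sum, ← Finset.sum_mul, h1, ← mul_assoc, Units.inv_mul, one_mul]

/-- For an invariant functional the left-hand factor `γ⁻¹(R') ⊗ 1` of the braided comultiplication
can be moved to the right, where it turns `R Δ(h)` into `Δᵒᵖ(h)`. -/
lemma IsInvariant.sliceLeft_braidedComul (hφ : IsInvariant k φ) (h : H) :
    sliceLeft φ (A.braidedComul h) = sliceRight φ (comul h) := by
  have h1 : ∑ p ∈ A.index, γ k H p.1 ⊗ₜ[k] p.2 = ((A.R⁻¹ : (H ⊗[k] H)ˣ) : H ⊗[k] H) := by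
    rw [← A.map_antipode_id_R, A.R_eq_sum]
    simp
  rw [A.braidedComul_apply, map_sum]
  have h2 (p : H × H) : sliceLeft φ ((A.antipodeInv p.1 ⊗ₜ[k] (1 : H)) *
      ((A.R : H ⊗[k] H) * comul h) * ((1 : H) ⊗ₜ[k] p.2)) =
      sliceLeft φ (((A.R : H ⊗[k] H) * comul h) * (γ k H p.1 ⊗ₜ[k] p.2)) := by
    rw [mul_assoc, sliceLeft_tmul_one_mul, hφ.comp_mulLeft_antipodeInv, ← sliceLeft_mul_tmul_one,
      mul_assoc, Algebra.TensorProduct.tmul_mul_tmul, one_mul, mul_one]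
  simp only [h2]
  rw [← map_sum, ← Finset.mul_sum, h1, ← A.flip_comul, sliceLeft_flip]

/-- The functional `x ↦ ∑ φ(a₂ x a₁)` of `∑ a₁ ⊗ a₂`, as a linear form in `∑ x a₁ ⊗ a₂`. -/
def swapForm (φ : Module.Dual k H) : H ⊗[k] H →ₗ[k] k :=
  φ ∘ₗ LinearMap.mul' k H ∘ₗ (flip k H).toLinearMap

@[simp] lemma swapForm_tmul (φ : Module.Dual k H) (x y : H) :
    swapForm φ (x ⊗ₜ y) = φ (y * x) := rfl

/-- Invariance under the coadjoint action `(a φ)(x) = ∑ φ(γ⁻¹(a₂) x a₁)` means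
`φ(x y) = φ(y γ²(x))`. -/
lemma isInvariant_iff : IsInvariant k φ ↔ ∀ a x : H,
    swapForm φ ((x ⊗ₜ 1) * TensorProduct.map LinearMap.id A.antipodeInv (comul (R := k) a)) =
      counit (R := k) a * φ x := by
  constructor
  · intro hφ a x
    have h (t : H ⊗[k] H) : swapForm φ ((x ⊗ₜ 1) * TensorProduct.map LinearMap.id A.antipodeInv t) =
        φ (x * LinearMap.mul' k H (LinearMap.lTensor H (γ k H) t)) := by
      induction t with
      | zero => simp
      | add a b ha hb => simp only [map_add, ha, hb, mul_add]
      | tmul a b => simp [hφ (A.antipodeInv b), A.γ_antipodeInv, mul_assoc]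
    rw [h, HopfAlgebra.mul_antipode_lTensor_comul_apply, Algebra.algebraMap_eq_smul_one]
    simp
  · intro hφ y x
    obtain ⟨h, rfl⟩ : ∃ h, y = A.antipodeInv h := ⟨γ k H y, (A.antipodeInv_γ y).symm⟩
    rw [A.γ_antipodeInv]
    let r := Repr.arbitrary k h
    -- evaluate `∑ φ(γ⁻¹(h₃) x γ(h₁) h₂)` in two ways
    have key := sum_comul_left_eq_sum_comul_right r
      (((TensorProduct.mk k H H).compl₁₂
        (LinearMap.mulLeft k x ∘ₗ LinearMap.mul' k H ∘ₗ LinearMap.rTensor H (γ k H))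
        A.antipodeInv).compr₂ (swapForm φ))
      (((LinearMap.mul k (H ⊗[k] H)).compl₁₂
        ((TensorProduct.mk k H H).flip 1 ∘ₗ LinearMap.mulLeft k x ∘ₗ γ k H)
        (TensorProduct.map LinearMap.id A.antipodeInv)).compr₂ (swapForm φ))
      (fun a b c => by simp [mul_assoc])
    simp only [LinearMap.compr₂_apply, LinearMap.compl₁₂_apply, LinearMap.comp_apply,
      TensorProduct.mk_apply, LinearMap.mul_apply', LinearMap.flip_apply, LinearMap.mulLeft_apply,
      hφ, HopfAlgebra.mul_antipode_rTensor_comul_apply, swapForm_tmul] at key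
    have e1 : ∑ i ∈ r.index, φ (A.antipodeInv (r.right i) *
        (x * algebraMap k H (counit (R := k) (r.left i)))) = φ (A.antipodeInv h * x) := by
      conv_rhs => rw [← Coalgebra.sum_counit_smul r]
      simp [Algebra.algebraMap_eq_smul_one, Finset.sum_mul]
    have e2 : ∑ i ∈ r.index, counit (R := k) (r.right i) * φ (x * γ k H (r.left i)) =
        φ (x * γ k H h) := by
      conv_rhs => rw [← sum_smul_counit r]
      simp [Finset.mul_sum]
    rw [← e1, key, e2]

end Invariant

/-- If `φ` does not vanish on the subalgebra `𝔲` and `w ∈ 𝔲` is invertible in `𝔲`, then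
`(φ(w ·) ⊗ 1)(R¹² R²¹)` is nonzero. -/
lemma sliceLeft_mulLeft_ne_zero {φ : Module.Dual k H} {w w' : H} (hw' : w' ∈ A.uSubspace)
    (hww' : w * w' = 1) (h3 : sliceLeft φ A.monodromy ≠ 0) :
    sliceLeft (φ ∘ₗ LinearMap.mulLeft k w) A.monodromy ≠ 0 := by
  intro h
  rw [← A.forall_mem_uSubspace_eq_zero_iff] at h
  refine h3 ((A.forall_mem_uSubspace_eq_zero_iff φ).1 fun x hx => ?_)
  have := h _ (A.mul_mem_uSubspace hw' hx)
  rwa [LinearMap.comp_apply, LinearMap.mulLeft_apply, ← mul_assoc, hww', one_mul] at this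

section Loops

variable [FiniteDimensional k H]

lemma coe_νUnit : (A.νUnit : H) = A.ν := rfl

lemma flip_comul_ν : flip k H (comul (R := k) A.ν) =
    (A.ν ⊗ₜ 1) * A.monodromy * ((1 : H) ⊗ₜ[k] A.ν) := by
  have hc (t : H ⊗[k] H) : (A.ν ⊗ₜ[k] (1 : H)) * t = t * (A.ν ⊗ₜ[k] (1 : H)) := by
    induction t with
    | zero => simp
    | add a b ha hb => simp only [ha, hb, mul_add, add_mul]
    | tmul a b => simp [A.ν_mul_comm]
  rw [A.comul_ν, map_mul, map_mul, flip_flip, hc, mul_assoc A.monodromy,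
    Algebra.TensorProduct.tmul_mul_tmul, one_mul, mul_one]
  rfl

lemma ν_inv_mul_comm (a : H) :
    ((A.νUnit⁻¹ : Hˣ) : H) * a = a * ((A.νUnit⁻¹ : Hˣ) : H) := by
  have h : Commute (A.νUnit : H) a := A.ν_mul_comm a
  exact h.units_inv_left

lemma flip_comul_ν_inv : flip k H (comul (R := k) ((A.νUnit⁻¹ : Hˣ) : H)) =
    ((1 : H) ⊗ₜ[k] ((A.νUnit⁻¹ : Hˣ) : H)) * ((A.monodromyUnit⁻¹ : (H ⊗[k] H)ˣ) : H ⊗[k] H) *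
      (((A.νUnit⁻¹ : Hˣ) : H) ⊗ₜ[k] 1) := by
  have h1 : flip k H (comul (R := k) ((A.νUnit⁻¹ : Hˣ) : H)) *
      flip k H (comul (R := k) A.ν) = 1 := by
    rw [← map_mul, ← Bialgebra.comul_mul, ← A.coe_νUnit, Units.inv_mul, Bialgebra.comul_one,
      map_one]
  refine left_inv_eq_right_inv h1 ?_
  rw [A.flip_comul_ν]
  simp only [mul_assoc]
  rw [← mul_assoc ((1 : H) ⊗ₜ[k] A.ν), Algebra.TensorProduct.tmul_mul_tmul, ← A.coe_νUnit,
    Units.mul_inv, one_mul, ← Algebra.TensorProduct.one_def, one_mul, ← mul_assoc A.monodromy,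
    ← A.coe_monodromyUnit, Units.mul_inv, one_mul, Algebra.TensorProduct.tmul_mul_tmul,
    Units.mul_inv, one_mul, Algebra.TensorProduct.one_def]

/-- If the finite-dimensional subalgebra `𝔲` contains `ν`, it contains `ν⁻¹`. -/
lemma ν_inv_mem_uSubspace (hν : A.ν ∈ A.uSubspace) : ((A.νUnit⁻¹ : Hˣ) : H) ∈ A.uSubspace := by
  let f : A.uSubspace →ₗ[k] A.uSubspace := (LinearMap.mulLeft k A.ν).restrict
    fun x hx => A.mul_mem_uSubspace hν hx
  have hf : Function.Injective f := fun x y hxy => by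
    have h : A.ν * (x : H) = A.ν * (y : H) := congrArg Subtype.val hxy
    exact Subtype.ext (A.νUnit.isUnit.mul_left_cancel h)
  obtain ⟨x, hx⟩ := LinearMap.injective_iff_surjective.1 hf ⟨1, A.one_mem_uSubspace⟩
  have h : A.ν * (x : H) = 1 := congrArg Subtype.val hx
  rw [Units.inv_eq_of_mul_eq_one_right (u := A.νUnit) h]
  exact x.2

variable {I : Module.Dual k H} (hI : IsLeftIntegral k I)

include hI

lemma sliceLeft_mulLeft_ν_mul :
    sliceLeft (I ∘ₗ LinearMap.mulLeft k A.ν) A.monodromy * A.ν = I A.ν • (1 : H) := by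
  rw [← hI.sliceRight_comul, ← sliceLeft_flip, A.flip_comul_ν, sliceLeft_mul_one_tmul,
    sliceLeft_tmul_one_mul]

/-- The loop coloured by `T I` acts by a multiple of `ν⁻¹`. -/
lemma ν_mul_antipode_sliceLeft :
    A.ν * γ k H (sliceLeft (I ∘ₗ LinearMap.mulLeft k A.ν) A.monodromy) = I A.ν • (1 : H) := by
  conv_lhs => rw [← A.antipode_ν]
  rw [← γ_mul, A.antipode_ν, A.sliceLeft_mulLeft_ν_mul hI]
  simp

/-- The loop coloured by `T⁻¹ I` acts by a multiple of `ν`. -/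
lemma antipode_sliceLeft_mulLeft_ν_inv (hinv : IsInvariant k I) :
    γ k H (sliceLeft (I ∘ₗ LinearMap.mulLeft k ((A.νUnit⁻¹ : Hˣ) : H)) A.monodromy) =
      I ((A.νUnit⁻¹ : Hˣ) : H) • A.ν := by
  set w := ((A.νUnit⁻¹ : Hˣ) : H)
  have hw : γ k H (γ k H w) = w := by
    rw [← A.κ_conj, mul_assoc, A.ν_inv_mul_comm, ← mul_assoc, A.κ_mul_κ_inv, one_mul]
  have h1 : flip k H ((A.R⁻¹ : (H ⊗[k] H)ˣ) : H ⊗[k] H) = ∑ q ∈ A.index, q.2 ⊗ₜ γ k H q.1 := by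
    rw [← A.map_antipode_id_R, A.R_eq_sum]; simp
  have h2 : ((A.R⁻¹ : (H ⊗[k] H)ˣ) : H ⊗[k] H) =
      ∑ p ∈ A.index, γ k H (γ k H p.1) ⊗ₜ γ k H p.2 := by
    rw [← A.map_antipode_id_R, ← A.map_antipode_antipode_R, A.R_eq_sum]; simp
  -- by the invariance of `I`, the antipode replaces the monodromy by its inverse
  have h3 : γ k H (sliceLeft (I ∘ₗ LinearMap.mulLeft k w) A.monodromy) = sliceLeft I
      ((w ⊗ₜ 1) * (flip k H ((A.R⁻¹ : (H ⊗[k] H)ˣ) : H ⊗[k] H) *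
        ((A.R⁻¹ : (H ⊗[k] H)ˣ) : H ⊗[k] H))) := by
    rw [h1, h2, monodromy, A.R_eq_sum]
    rw [map_sum, Finset.sum_mul_sum, Finset.sum_mul_sum]
    simp only [map_sum, flip_tmul, Finset.mul_sum,
      Algebra.TensorProduct.tmul_mul_tmul, sliceLeft_tmul, map_smul, LinearMap.comp_apply,
      LinearMap.mulLeft_apply, one_mul, γ_mul]
    rw [Finset.sum_comm]
    refine Finset.sum_congr rfl fun q _ => Finset.sum_congr rfl fun p _ => ?_
    congr 1
    rw [← mul_assoc, hinv (w * p.1), γ_mul, γ_mul, hw, ← mul_assoc, ← A.ν_inv_mul_comm q.2,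
      mul_assoc]
  have hc (t : H ⊗[k] H) : (w ⊗ₜ[k] (1 : H)) * t = t * (w ⊗ₜ[k] (1 : H)) := by
    induction t with
    | zero => simp
    | add a b ha hb => simp only [ha, hb, mul_add, add_mul]
    | tmul a b => simp [w, A.ν_inv_mul_comm]
  have h4 := congrArg (sliceLeft I) A.flip_comul_ν_inv
  rw [sliceLeft_flip, hI.sliceRight_comul, mul_assoc, sliceLeft_one_tmul_mul,
    A.coe_monodromyUnit_inv, ← hc, ← h3] at h4
  have h5 := congrArg (fun x => A.ν * x) h4
  simp only [← mul_assoc, ← A.coe_νUnit, Units.mul_inv, one_mul] at h5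
  rw [← h5, mul_smul_comm, mul_one, A.coe_νUnit]

lemma apply_ν_ne_zero (hν : A.ν ∈ A.uSubspace) (h3 : sliceLeft I A.monodromy ≠ 0) :
    I A.ν ≠ 0 := by
  intro h
  have h1 := A.sliceLeft_mulLeft_ν_mul hI
  rw [h, zero_smul] at h1
  refine A.sliceLeft_mulLeft_ne_zero (A.ν_inv_mem_uSubspace hν) A.νUnit.mul_inv h3 ?_
  exact A.νUnit.isUnit.mul_left_eq_zero.1 h1

lemma apply_ν_inv_ne_zero (hinv : IsInvariant k I) (hν : A.ν ∈ A.uSubspace)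
    (h3 : sliceLeft I A.monodromy ≠ 0) : I ((A.νUnit⁻¹ : Hˣ) : H) ≠ 0 := by
  intro h
  have h1 := A.antipode_sliceLeft_mulLeft_ν_inv hI hinv
  rw [h, zero_smul] at h1
  refine A.sliceLeft_mulLeft_ne_zero hν A.νUnit.inv_mul h3 ?_
  exact A.antipode_bijective.1 (h1.trans (map_zero _).symm)

end Loops

end RibbonHopfAlgebra

end RibbonHopf

end

noncomputable section

namespace RibbonHopf

open Coalgebra

/-! ### Structure morphisms of `H`-mod in terms of elements -/

namespace HMod

variable {k H : Type u} [Field k] [Ring H] [HopfAlgebra k H] {A : RibbonHopfAlgebra k H}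

/-- An element of the dual object, as a functional. -/
abbrev toDual (X : HMod A) (ξ : (ᘁX : HMod A).V) : Module.Dual k X.V := ξ

lemma toDual_leftAdjointMate {X Y : HMod A} (f : X ⟶ Y) (ξ : Module.Dual k Y.V) :
    toDual X (Hom.lin (ᘁf : (ᘁY : HMod A) ⟶ ᘁX) ξ) = ξ ∘ₗ f.lin := by
  have h := leftAdjointMate_comp_evaluation f
  refine LinearMap.ext fun x => ?_
  exact congrArg (fun φ => Hom.lin φ (x ⊗ₜ[k] ξ)) h

lemma tensor_evaluation_lin (X Y : HMod A) (η : Module.Dual k Y.V)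
    (ξ : Module.Dual k X.V) (x : X.V) (y : Y.V) :
    Hom.lin (ε_ ((ᘁY : HMod A) ⊗ (ᘁX : HMod A)) (X ⊗ Y)) ((x ⊗ₜ[k] y) ⊗ₜ[k] (η ⊗ₜ[k] ξ)) =
      η y * ξ x := by
  rw [ExactPairing.tensor_evaluation]
  simp [monoidalComp]
  rfl

lemma leftDualTensorIso_inv_lin_tmul (X Y : HMod A) (η : Module.Dual k Y.V)
    (ξ : Module.Dual k X.V) (x : X.V) (y : Y.V) :
    toDual (X ⊗ Y) (Hom.lin (leftDualTensorIso X Y).inv (η ⊗ₜ[k] ξ)) (x ⊗ₜ y) =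
      η y * ξ x := by
  have h := @leftAdjointMate_comp_evaluation (HMod A) _ _ (X ⊗ Y) (X ⊗ Y)
    inferInstance ⟨(ᘁY : HMod A) ⊗ (ᘁX : HMod A)⟩ (𝟙 (X ⊗ Y))
  have h' := congrArg (fun φ => Hom.lin φ ((x ⊗ₜ[k] y) ⊗ₜ[k] (η ⊗ₜ[k] ξ))) h
  refine Eq.trans h' ?_
  exact tensor_evaluation_lin X Y η ξ x y

lemma doubleBraiding_lin_apply (X Y : HMod A) (z : X.V ⊗[k] Y.V) :
    Hom.lin (doubleBraiding X Y) z = act₂ X.act Y.act (flip k H A.monodromy) z := by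
  change TensorProduct.comm k Y.V X.V (act₂ Y.act X.act A.R
    (TensorProduct.comm k X.V Y.V (act₂ X.act Y.act A.R z))) = _
  rw [comm_act₂, A.flip_monodromy, map_mul, Module.End.mul_apply]
  congr 1
  exact (TensorProduct.comm k X.V Y.V).symm_apply_apply _

/-- A linear map is a morphism if its composition with a surjective morphism is one. -/
def homOfSurjective {X Y Z : HMod A} (p : X ⟶ Y) (hp : Function.Surjective p.lin) (q : X ⟶ Z)
    (f : Y.V →ₗ[k] Z.V) (h : ∀ x, f (p.lin x) = q.lin x) : Y ⟶ Z :=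
  ⟨f, fun a y => by
    obtain ⟨x, rfl⟩ := hp y
    rw [← p.comm, h, h, q.comm]⟩

/-- The regular module, with `H` acting on itself by left multiplication. -/
abbrev regular (A : RibbonHopfAlgebra k H) [FiniteDimensional k H] : HMod A :=
  ⟨H, Algebra.lmul k H⟩

/-- The morphism from the regular module given by an element of a module. -/
def ofElement [FiniteDimensional k H] (X : HMod A) (x : X.V) : regular A ⟶ X :=
  ⟨X.act.toLinearMap.flip x, fun a h => by
    change X.act (a * h) x = X.act a (X.act h x)
    rw [map_mul]; rfl⟩

end HMod

/-! ### The coend `∫ L ⊗ L^∨` on the dual space of `H` -/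

section Coend

variable {k H : Type u} [Field k] [Ring H] [HopfAlgebra k H] (A : RibbonHopfAlgebra k H)

/-- The action `(a f)(x) = f(x a)` of `H` on its dual space. -/
def actTranslate (k H : Type u) [Field k] [Ring H] [HopfAlgebra k H] :
    H →ₐ[k] Module.End k (Module.Dual k H) :=
  AlgHom.ofLinearMap (Module.Dual.transpose ∘ₗ (LinearMap.mul k H).flip)
    (by
      ext f x
      change f (x * 1) = f x
      rw [mul_one])
    (fun a b => by
      ext f x
      change f (x * (a * b)) = f (x * a * b)
      rw [mul_assoc])

/-- The action `((a ⊗ b) f)(x) = f(γ⁻¹(b) x a)` of `H ⊗ H` on the dual space of `H`. -/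
def actBimodule : H ⊗[k] H →ₐ[k] Module.End k (Module.Dual k H) :=
  Algebra.TensorProduct.lift (actTranslate k H) (actLeftDual A (Algebra.lmul k H))
    (fun a b => show _ * _ = _ * _ by
      ext f x
      change f (A.antipodeInv b * (x * a)) = f (A.antipodeInv b * x * a)
      rw [mul_assoc])

lemma actBimodule_tmul (a b : H) (f : Module.Dual k H) (x : H) :
    actBimodule A (a ⊗ₜ b) f x = f (A.antipodeInv b * x * a) := by
  refine (congrArg (fun φ : Module.End k (Module.Dual k H) => φ f x)
    (Algebra.TensorProduct.lift_tmul _ _ _ a b)).trans ?_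
  rw [mul_assoc]
  rfl

/-- The coadjoint action `(a f)(x) = ∑ f(γ⁻¹(a₂) x a₁)`. -/
def actCoadjoint : H →ₐ[k] Module.End k (Module.Dual k H) :=
  (actBimodule A).comp (Bialgebra.comulAlgHom k H)

lemma actBimodule_apply (t : H ⊗[k] H) (f : Module.Dual k H) (x : H) :
    actBimodule A t f x =
      RibbonHopfAlgebra.swapForm f ((x ⊗ₜ 1) * TensorProduct.map LinearMap.id A.antipodeInv t) := by
  induction t with
  | zero => simp
  | add a b ha hb => simp only [map_add, mul_add, LinearMap.add_apply, ha, hb]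
  | tmul a b => simp [actBimodule_tmul, mul_assoc]

/-- The matrix coefficient `x ⊗ ξ ↦ (h ↦ ξ(h x))` of a representation. -/
def matrixCoeff {V : Type u} [AddCommGroup V] [Module k V] (ρ : H →ₐ[k] Module.End k V) :
    V ⊗[k] Module.Dual k V →ₗ[k] Module.Dual k H :=
  TensorProduct.lift (Module.Dual.transpose ∘ₗ ρ.toLinearMap.flip)

lemma matrixCoeff_tmul {V : Type u} [AddCommGroup V] [Module k V] (ρ : H →ₐ[k] Module.End k V)
    (x : V) (ξ : Module.Dual k V) (h : H) : matrixCoeff ρ (x ⊗ₜ ξ) h = ξ (ρ h x) := rfl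

lemma matrixCoeff_act₂ {V : Type u} [AddCommGroup V] [Module k V] (ρ : H →ₐ[k] Module.End k V)
    (t : H ⊗[k] H) (z : V ⊗[k] Module.Dual k V) :
    matrixCoeff ρ (act₂ ρ (actLeftDual A ρ) t z) = actBimodule A t (matrixCoeff ρ z) := by
  induction t with
  | zero => simp only [map_zero, LinearMap.zero_apply]
  | add a b ha hb => simp only [map_add, LinearMap.add_apply, ha, hb]
  | tmul a b =>
    induction z with
    | zero => simp only [map_zero]
    | add a b ha hb => simp only [map_add, ha, hb]
    | tmul x ξ =>
      ext h
      rw [actBimodule_tmul, matrixCoeff_tmul, map_mul, map_mul]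
      rfl

variable [FiniteDimensional k H]

/-- The coend `∫ L ⊗ L^∨` of `H`-mod: the dual space of `H` with the coadjoint action. -/
abbrev coendObj : HMod A := ⟨Module.Dual k H, actCoadjoint A⟩

namespace HMod

variable {A}

/-- The structure map `L ⊗ L^∨ ⟶ ∫ L ⊗ L^∨`, given by matrix coefficients. -/
def coendι (L : HMod A) : L ⊗ (ᘁL : HMod A) ⟶ coendObj A :=
  ⟨matrixCoeff L.act, fun h z => matrixCoeff_act₂ A L.act (comul h) z⟩

lemma coendι_regular (f : Module.Dual k H) :
    Hom.lin (coendι (regular A)) ((1 : H) ⊗ₜ[k] f) = f := by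
  refine LinearMap.ext fun h => ?_
  change f (h * 1) = f h
  rw [mul_one]

lemma coendι_regular_surjective : Function.Surjective (coendι (regular A)).lin :=
  fun f => ⟨_, coendι_regular f⟩

lemma coendι_dinatural {L M : HMod A} (g : L ⟶ M) :
    g ▷ (ᘁM : HMod A) ≫ coendι M = L ◁ (ᘁg : (ᘁM : HMod A) ⟶ ᘁL) ≫ coendι L := by
  apply hom_ext
  apply TensorProduct.ext'
  intro x ξ
  refine LinearMap.ext fun h => ?_
  change toDual M ξ (M.act h (g.lin x)) = toDual L (Hom.lin (ᘁg : (ᘁM : HMod A) ⟶ ᘁL) ξ) (L.act h x)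
  rw [toDual_leftAdjointMate, ← g.comm]
  rfl

/-- A dinatural family is determined by its value on the regular module. -/
lemma dinatural_apply {Y : HMod A} (j : ∀ L : HMod A, L ⊗ (ᘁL : HMod A) ⟶ Y)
    (hj : ∀ {L M : HMod A} (g : L ⟶ M),
      g ▷ (ᘁM : HMod A) ≫ j M = L ◁ (ᘁg : (ᘁM : HMod A) ⟶ ᘁL) ≫ j L)
    (L : HMod A) (z : L.V ⊗[k] Module.Dual k L.V) :
    Hom.lin (j (regular A)) ((1 : H) ⊗ₜ[k] matrixCoeff L.act z) = (j L).lin z := by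
  induction z with
  | zero => rw [map_zero, TensorProduct.tmul_zero, map_zero, map_zero]
  | add a b ha hb => rw [map_add, TensorProduct.tmul_add, map_add, ha, hb, map_add]
  | tmul x ξ =>
    have h := congrArg (fun φ => Hom.lin φ ((1 : H) ⊗ₜ[k] ξ)) (hj (ofElement L x))
    have h1 : Hom.lin (j L) (L.act 1 x ⊗ₜ[k] ξ) = Hom.lin (j (regular A)) ((1 : H) ⊗ₜ[k]
      toDual (regular A) (Hom.lin (ᘁ(ofElement L x) : (ᘁL : HMod A) ⟶ _) ξ)) := h
    rw [toDual_leftAdjointMate, map_one] at h1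
    exact h1.symm

lemma coend_universal (Y : HMod A) (j : ∀ L : HMod A, L ⊗ (ᘁL : HMod A) ⟶ Y)
    (hj : ∀ {L M : HMod A} (g : L ⟶ M),
      g ▷ (ᘁM : HMod A) ≫ j M = L ◁ (ᘁg : (ᘁM : HMod A) ⟶ ᘁL) ≫ j L) :
    ∃! φ : coendObj A ⟶ Y, ∀ L : HMod A, coendι L ≫ φ = j L := by
  refine ⟨homOfSurjective (coendι (regular A)) coendι_regular_surjective (j (regular A))
    ((j (regular A)).lin ∘ₗ TensorProduct.mk k H (Module.Dual k H) 1)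
    (dinatural_apply j hj (regular A)), ?_, ?_⟩
  · intro L
    apply hom_ext
    exact LinearMap.ext (dinatural_apply j hj L)
  · intro φ hφ
    apply hom_ext
    refine LinearMap.ext fun f => ?_
    have h := congrArg (fun φ => Hom.lin φ ((1 : H) ⊗ₜ[k] f)) (hφ (regular A))
    refine Eq.trans ?_ h
    change φ.lin f = φ.lin (Hom.lin (coendι (regular A)) ((1 : H) ⊗ₜ[k] f))
    rw [coendι_regular]

end HMod

end Coend

end RibbonHopf

end

noncomputable section

namespace RibbonHopf

open Coalgebra

/-! ### The operations of the coend in terms of functionals -/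

section CoendOperations

variable {k H : Type u} [Field k] [Ring H] [HopfAlgebra k H] (A : RibbonHopfAlgebra k H)

/-- The map `b ⊗ c ↦ (1 ⊗ γ⁻¹(c)) w (1 ⊗ b)`. -/
def conjRight (w : H ⊗[k] H) : H ⊗[k] H →ₗ[k] H ⊗[k] H :=
  TensorProduct.lift ((LinearMap.mul k (H ⊗[k] H)).flip.compl₁₂ (TensorProduct.mk k H H 1)
    (LinearMap.mulRight k w ∘ₗ TensorProduct.mk k H H 1 ∘ₗ A.antipodeInv))

lemma conjRight_tmul (w : H ⊗[k] H) (b c : H) :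
    conjRight A w (b ⊗ₜ c) = ((1 : H) ⊗ₜ[k] A.antipodeInv c) * w * ((1 : H) ⊗ₜ[k] b) := rfl

/-- The braided comultiplication in the form in which it arises from the strand `L^∨` passing
`M ⊗ M^∨`. -/
lemma sum_conjRight_comul (h : H) :
    ∑ p ∈ A.index, (A.antipodeInv p.1 ⊗ₜ[k] (1 : H)) * conjRight A (comul h) (comul p.2) =
      A.braidedComul h := by
  have h1 := A.sum_comul_right ((LinearMap.mul k (H ⊗[k] H)).compl₁₂
    ((TensorProduct.mk k H H).flip 1 ∘ₗ A.antipodeInv) (conjRight A (comul h)))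
  refine h1.trans ?_
  rw [A.braidedComul_apply, Finset.sum_comm]
  refine Finset.sum_congr rfl fun q _ => ?_
  conv_rhs => rw [← A.map_antipodeInv_antipodeInv_R, A.R_eq_sum]
  simp only [map_sum, Finset.sum_mul, Finset.mul_sum]
  refine Finset.sum_congr rfl fun p _ => ?_
  change (A.antipodeInv (p.1 * q.1) ⊗ₜ[k] (1 : H)) * conjRight A (comul h) (q.2 ⊗ₜ p.2) = _
  rw [conjRight_tmul, A.antipodeInv_mul, TensorProduct.map_tmul]
  simp only [← mul_assoc, Algebra.TensorProduct.tmul_mul_tmul, one_mul, mul_one]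

lemma braidedMul_eq (φ ψ : Module.Dual k H) (h : H) : A.braidedMul φ ψ h =
    TensorProduct.dualDistrib k H H (φ ⊗ₜ ψ) (A.braidedComul h) := by
  change LinearMap.mul' k k (TensorProduct.map φ ψ (A.braidedComul h)) = _
  generalize A.braidedComul h = t
  induction t with
  | zero => simp
  | add a b ha hb => simp only [map_add, ha, hb]
  | tmul a b => simp

/-- The product of the coend. -/
def coendMulLin : Module.Dual k H ⊗[k] Module.Dual k H →ₗ[k] Module.Dual k H :=
  Module.Dual.transpose A.braidedComul ∘ₗ TensorProduct.dualDistrib k H H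

lemma coendMulLin_tmul (φ ψ : Module.Dual k H) :
    coendMulLin A (φ ⊗ₜ ψ) = A.braidedMul φ ψ :=
  LinearMap.ext fun h => (braidedMul_eq A φ ψ h).symm

/-- The pairing `φ ⊗ ψ ↦ ∑ φ(γ⁻¹(M'')) ψ(M')` of the coend, where `∑ M' ⊗ M'' = R¹² R²¹`. -/
def coendPairingLin : Module.Dual k H ⊗[k] Module.Dual k H →ₗ[k] k :=
  (TensorProduct.dualDistrib k H H).flip
    (TensorProduct.map A.antipodeInv LinearMap.id (flip k H A.monodromy))

lemma coendPairingLin_tmul (φ ψ : Module.Dual k H) :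
    coendPairingLin A (φ ⊗ₜ ψ) = ψ (γ k H (sliceLeft φ A.monodromy)) := by
  have h := A.antipode_sliceLeft_monodromy (φ ∘ₗ A.antipodeInv)
  rw [LinearMap.comp_assoc, show A.antipodeInv ∘ₗ γ k H = LinearMap.id from
    LinearMap.ext A.antipodeInv_γ, LinearMap.comp_id] at h
  rw [h]
  change TensorProduct.dualDistrib k H H (φ ⊗ₜ ψ) _ = _
  generalize A.monodromy = t
  induction t with
  | zero => simp
  | add a b ha hb => simp only [map_add, ha, hb]
  | tmul a b => simp

namespace HMod

variable {A}

lemma evLeft_tensorDual_act₂ (L M : HMod A) (x : L.V) (ξ : Module.Dual k L.V) (y : M.V)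
    (η : Module.Dual k M.V) (a : H) (t w : H ⊗[k] H) :
    evLeft (L.V ⊗[k] M.V) (TensorProduct.map (act₂ L.act M.act w) LinearMap.id
      (Hom.lin (L ◁ (α_ M (ᘁM) (ᘁL)).hom ≫
        (α_ L M ((ᘁM : HMod A) ⊗ (ᘁL : HMod A))).inv ≫ (L ⊗ M) ◁ (leftDualTensorIso L M).inv)
        (x ⊗ₜ[k] (act₂ M.act (actLeftDual A M.act) t (y ⊗ₜ η) ⊗ₜ[k] actLeftDual A L.act a ξ)))) =
      TensorProduct.dualDistrib k H H (matrixCoeff L.act (x ⊗ₜ ξ) ⊗ₜ matrixCoeff M.act (y ⊗ₜ η))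
        ((A.antipodeInv a ⊗ₜ[k] (1 : H)) * conjRight A w t) := by
  induction t with
  | zero => simp only [map_zero, LinearMap.zero_apply, TensorProduct.zero_tmul,
      TensorProduct.tmul_zero, mul_zero]
  | add a b ha hb => simp only [map_add, LinearMap.add_apply, TensorProduct.add_tmul,
      TensorProduct.tmul_add, mul_add, ha, hb]
  | tmul b c =>
    rw [conjRight_tmul]
    induction w with
    | zero => simp only [map_zero, TensorProduct.map_zero_left, LinearMap.zero_apply, mul_zero,
        zero_mul]
    | add u v hu hv => simp only [map_add, TensorProduct.map_add_left, LinearMap.add_apply, hu, hv,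
        mul_add, add_mul]
    | tmul u v =>
      simp only [Algebra.TensorProduct.tmul_mul_tmul, one_mul, mul_one,
        TensorProduct.dualDistrib_apply, matrixCoeff_tmul]
      refine (leftDualTensorIso_inv_lin_tmul L M (actLeftDual A M.act c η)
        (actLeftDual A L.act a ξ) (L.act u x) (M.act v (M.act b y))).trans ?_
      rw [actLeftDual_apply, actLeftDual_apply, mul_comm]
      simp only [map_mul, Module.End.mul_apply]

lemma matrixCoeff_apply {V : Type u} [AddCommGroup V] [Module k V]
    (ρ : H →ₐ[k] Module.End k V) (z : V ⊗[k] Module.Dual k V) (h : H) :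
    matrixCoeff ρ z h = evLeft V (TensorProduct.map (ρ h) LinearMap.id z) := by
  induction z with
  | zero => simp
  | add a b ha hb => simp only [map_add, LinearMap.add_apply, ha, hb]
  | tmul x ξ => rfl

lemma coendPairingLin_matrixCoeff (L M : HMod A)
    (z : (L.V ⊗[k] Module.Dual k L.V) ⊗[k] (M.V ⊗[k] Module.Dual k M.V)) :
    coendPairingLin A (TensorProduct.map (matrixCoeff L.act) (matrixCoeff M.act) z) =
      Hom.lin (pairingTangle L M) z := by
  suffices coendPairingLin A ∘ₗ TensorProduct.map (matrixCoeff L.act) (matrixCoeff M.act) =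
      Hom.lin (pairingTangle L M) from LinearMap.congr_fun this z
  apply TensorProduct.ext_fourfold'
  intro x ξ y η
  have h (t : H ⊗[k] H) : TensorProduct.dualDistrib k H H
      (matrixCoeff L.act (x ⊗ₜ ξ) ⊗ₜ matrixCoeff M.act (y ⊗ₜ η))
      (TensorProduct.map A.antipodeInv LinearMap.id t) =
      Hom.lin ((α_ (L ⊗ (ᘁL : HMod A)) M (ᘁM)).hom ≫ (ev L ⊗ₘ ev M) ≫ (λ_ (𝟙_ (HMod A))).hom)
        ((TensorProduct.assoc k L.V (Module.Dual k L.V) M.V).symm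
          (x ⊗ₜ[k] act₂ (actLeftDual A L.act) M.act t (ξ ⊗ₜ y)) ⊗ₜ[k] η) := by
    induction t with
    | zero => simp only [map_zero, LinearMap.zero_apply, TensorProduct.zero_tmul,
        TensorProduct.tmul_zero]
    | add a b ha hb => simp only [map_add, LinearMap.add_apply, TensorProduct.add_tmul,
        TensorProduct.tmul_add, ha, hb]
    | tmul a b => rfl
  refine (h _).trans ?_
  exact congrArg (fun w : (ᘁL : HMod A).V ⊗[k] M.V => Hom.lin
    ((α_ (L ⊗ (ᘁL : HMod A)) M (ᘁM)).hom ≫ (ev L ⊗ₘ ev M) ≫ (λ_ (𝟙_ (HMod A))).hom)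
      ((TensorProduct.assoc k L.V (Module.Dual k L.V) M.V).symm (x ⊗ₜ[k] w) ⊗ₜ[k] η))
    (doubleBraiding_lin_apply (ᘁL : HMod A) M (ξ ⊗ₜ[k] y)).symm

lemma eval_one_matrixCoeff (L : HMod A) (z : L.V ⊗[k] Module.Dual k L.V) :
    Module.Dual.eval k H 1 (matrixCoeff L.act z) = Hom.lin (ev L) z := by
  induction z with
  | zero => simp only [map_zero]
  | add a b ha hb => simp only [map_add, ha, hb]
  | tmul x ξ =>
    change ξ (L.act 1 x) = ξ x
    rw [map_one]
    rfl

variable [FiniteDimensional k H]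

lemma coendMulLin_matrixCoeff (L M : HMod A)
    (z : (L.V ⊗[k] Module.Dual k L.V) ⊗[k] (M.V ⊗[k] Module.Dual k M.V)) :
    coendMulLin A (TensorProduct.map (matrixCoeff L.act) (matrixCoeff M.act) z) =
      Hom.lin (mulTangle L M ≫ coendι (L ⊗ M)) z := by
  suffices coendMulLin A ∘ₗ TensorProduct.map (matrixCoeff L.act) (matrixCoeff M.act) =
      Hom.lin (mulTangle L M ≫ coendι (L ⊗ M)) from LinearMap.congr_fun this z
  apply TensorProduct.ext_fourfold'
  intro x ξ y η
  refine LinearMap.ext fun h => ?_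
  change TensorProduct.dualDistrib k H H
    (matrixCoeff L.act (x ⊗ₜ ξ) ⊗ₜ matrixCoeff M.act (y ⊗ₜ η)) (A.braidedComul h) = _
  rw [← sum_conjRight_comul, map_sum]
  simp only [← evLeft_tensorDual_act₂]
  refine Eq.trans ?_ (matrixCoeff_apply (L ⊗ M).act _ h).symm
  have h1 : act₂ (actLeftDual A L.act) (actTensor M.act (actLeftDual A M.act)) (A.R : H ⊗[k] H)
      (ξ ⊗ₜ[k] (y ⊗ₜ[k] η)) = ∑ p ∈ A.index, actLeftDual A L.act p.1 ξ ⊗ₜ[k]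
        act₂ M.act (actLeftDual A M.act) (comul p.2) (y ⊗ₜ η) := by
    rw [A.R_eq_sum, map_sum, LinearMap.sum_apply]
    rfl
  change _ = evLeft (L.V ⊗[k] M.V) (TensorProduct.map (act₂ L.act M.act (comul h)) LinearMap.id
      (Hom.lin (L ◁ (α_ M (ᘁM) (ᘁL)).hom ≫
        (α_ L M ((ᘁM : HMod A) ⊗ (ᘁL : HMod A))).inv ≫ (L ⊗ M) ◁ (leftDualTensorIso L M).inv)
        (x ⊗ₜ[k] TensorProduct.comm k _ _ (act₂ (actLeftDual A L.act)
          (actTensor M.act (actLeftDual A M.act)) (A.R : H ⊗[k] H) (ξ ⊗ₜ[k] (y ⊗ₜ[k] η))))))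
  rw [h1, map_sum, TensorProduct.tmul_sum, map_sum, map_sum, map_sum]
  rfl

/-- The action of the monodromy on `F ⊗ X`, where `H` acts on the coend `F` through `L^∨`. -/
def coendMonodromyLin (X : HMod A) : Module.Dual k H ⊗[k] X.V →ₗ[k] Module.Dual k H ⊗[k] X.V :=
  act₂ (actLeftDual A (Algebra.lmul k H)) X.act (flip k H A.monodromy)

lemma coendMonodromyLin_matrixCoeff (L X : HMod A) (z : (L.V ⊗[k] Module.Dual k L.V) ⊗[k] X.V) :
    coendMonodromyLin X (TensorProduct.map (matrixCoeff L.act) LinearMap.id z) =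
      Hom.lin (monodromyTangle L X ≫ coendι L ▷ X) z := by
  suffices coendMonodromyLin X ∘ₗ TensorProduct.map (matrixCoeff L.act) LinearMap.id =
      Hom.lin (monodromyTangle L X ≫ coendι L ▷ X) from LinearMap.congr_fun this z
  apply TensorProduct.ext_threefold
  intro x ξ y
  have h (t : H ⊗[k] H) : act₂ (actLeftDual A (Algebra.lmul k H)) X.act t
      (matrixCoeff L.act (x ⊗ₜ ξ) ⊗ₜ y) =
      Hom.lin (coendι L ▷ X) ((TensorProduct.assoc k L.V (Module.Dual k L.V) X.V).symm
          (x ⊗ₜ[k] act₂ (actLeftDual A L.act) X.act t (ξ ⊗ₜ y))) := by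
    induction t with
    | zero => simp only [map_zero, LinearMap.zero_apply, TensorProduct.tmul_zero]
    | add a b ha hb => simp only [map_add, LinearMap.add_apply, TensorProduct.tmul_add, ha, hb]
    | tmul a b =>
      rw [act₂_tmul]
      change _ = matrixCoeff L.act (x ⊗ₜ actLeftDual A L.act a ξ) ⊗ₜ[k] X.act b y
      congr 1
      refine LinearMap.ext fun h => ?_
      change ξ (L.act (A.antipodeInv a * h) x) = ξ (L.act (A.antipodeInv a) (L.act h x))
      rw [map_mul]
      rfl
  refine (h _).trans ?_
  exact congrArg (fun w : (ᘁL : HMod A).V ⊗[k] X.V => Hom.lin (coendι L ▷ X)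
      ((TensorProduct.assoc k L.V (Module.Dual k L.V) X.V).symm (x ⊗ₜ[k] w)))
    (doubleBraiding_lin_apply (ᘁL : HMod A) X (ξ ⊗ₜ[k] y)).symm

lemma comp_mulLeft_ν_matrixCoeff (L : HMod A) (z : L.V ⊗[k] Module.Dual k L.V) :
    Module.Dual.transpose (LinearMap.mulLeft k A.ν) (matrixCoeff L.act z) =
      Hom.lin ((twist A).app L ▷ (ᘁL : HMod A) ≫ coendι L) z := by
  induction z with
  | zero => simp only [map_zero]
  | add a b ha hb => simp only [map_add, ha, hb]
  | tmul x ξ =>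
    refine LinearMap.ext fun h => ?_
    change ξ (L.act (A.ν * h) x) = ξ (L.act h (L.act A.ν x))
    rw [A.ν_mul_comm, map_mul]
    rfl

lemma coendι_tensor_surjective : Function.Surjective
    (Hom.lin (coendι (regular A) ⊗ₘ coendι (regular A))) :=
  TensorProduct.map_surjective coendι_regular_surjective coendι_regular_surjective

variable (A) in
/-- The coend of `H`-mod with its operations. -/
abbrev coendAlgebra : CoendAlgebra (HMod A) where
  F := coendObj A
  ι := coendι
  dinatural := coendι_dinatural
  universal := coend_universal
  mul := homOfSurjective (coendι (regular A) ⊗ₘ coendι (regular A)) coendι_tensor_surjective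
    (mulTangle (regular A) (regular A) ≫ coendι (regular A ⊗ regular A)) (coendMulLin A)
    (coendMulLin_matrixCoeff (regular A) (regular A))
  mul_spec L M := hom_ext (LinearMap.ext (coendMulLin_matrixCoeff L M))
  counit := homOfSurjective (coendι (regular A)) coendι_regular_surjective (ev (regular A))
    (Module.Dual.eval k H 1) (eval_one_matrixCoeff (regular A))
  counit_spec L := hom_ext (LinearMap.ext (eval_one_matrixCoeff L))
  ω := homOfSurjective (coendι (regular A) ⊗ₘ coendι (regular A)) coendι_tensor_surjective
    (pairingTangle (regular A) (regular A)) (coendPairingLin A)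
    (coendPairingLin_matrixCoeff (regular A) (regular A))
  ω_spec L M := hom_ext (LinearMap.ext (coendPairingLin_matrixCoeff L M))
  Ω X := homOfSurjective (coendι (regular A) ▷ X)
    (TensorProduct.map_surjective coendι_regular_surjective Function.surjective_id)
    (monodromyTangle (regular A) X ≫ coendι (regular A) ▷ X) (coendMonodromyLin X)
    (coendMonodromyLin_matrixCoeff (regular A) X)
  Ω_spec L X := hom_ext (LinearMap.ext (coendMonodromyLin_matrixCoeff L X))

variable (A) in
/-- The endomorphism `f ↦ f(ν ·)` of the coend induced by the twist. -/
def coendTwist : coendObj A ⟶ coendObj A :=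
  homOfSurjective (coendι (regular A)) coendι_regular_surjective
    ((twist A).app (regular A) ▷ (ᘁ(regular A)) ≫ coendι (regular A))
    (Module.Dual.transpose (LinearMap.mulLeft k A.ν)) (comp_mulLeft_ν_matrixCoeff (regular A))

lemma isTwist_coendTwist : (coendAlgebra A).IsTwist (twist A) (coendTwist A) := fun L =>
  hom_ext (LinearMap.ext (comp_mulLeft_ν_matrixCoeff L))

lemma coendTwist_lin_apply (f : Module.Dual k H) :
    (coendTwist A).lin f = f ∘ₗ LinearMap.mulLeft k A.ν := rfl

lemma coendAlgebra_mul_lin_tmul (f g : Module.Dual k H) :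
    Hom.lin (coendAlgebra A).mul (f ⊗ₜ[k] g) = A.braidedMul f g :=
  coendMulLin_tmul A f g

lemma coendAlgebra_ω_lin_tmul (f g : Module.Dual k H) :
    Hom.lin (coendAlgebra A).ω (f ⊗ₜ[k] g) = g (γ k H (sliceLeft f A.monodromy)) :=
  coendPairingLin_tmul A f g

/-- The loop coloured by a functional `f` acts by the element `∑ f(M') γ(M'')`, where
`∑ M' ⊗ M'' = R¹² R²¹`. -/
lemma counit_Ω_lin_tmul (X : HMod A) (f : Module.Dual k H) (x : X.V) :
    Hom.lin ((coendAlgebra A).Ω X ≫ (coendAlgebra A).counit ▷ X ≫ (λ_ X).hom) (f ⊗ₜ[k] x) =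
      X.act (γ k H (sliceLeft f A.monodromy)) x := by
  have h := A.antipode_sliceLeft_monodromy (f ∘ₗ A.antipodeInv)
  rw [LinearMap.comp_assoc, show A.antipodeInv ∘ₗ γ k H = LinearMap.id from
    LinearMap.ext A.antipodeInv_γ, LinearMap.comp_id] at h
  rw [h]
  change TensorProduct.lid k X.V (TensorProduct.map (Module.Dual.eval k H 1) LinearMap.id
    (act₂ (actLeftDual A (Algebra.lmul k H)) X.act (flip k H A.monodromy) (f ⊗ₜ x))) = _
  generalize A.monodromy = t
  induction t with
  | zero => simp only [map_zero, LinearMap.zero_apply]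
  | add a b ha hb => simp only [map_add, LinearMap.add_apply, ha, hb]
  | tmul a b =>
    rw [flip_tmul, act₂_tmul, TensorProduct.map_tmul, TensorProduct.lid_tmul, sliceRight_tmul,
      map_smul]
    change f (A.antipodeInv b * 1) • X.act a x = _
    rw [mul_one]
    rfl

end HMod

end CoendOperations

end RibbonHopf

end

noncomputable section

namespace RibbonHopf

open Coalgebra

/-! ### `H`-mod as a noetherian ribbon category -/

namespace HMod

variable {k H : Type u} [Field k] [Ring H] [HopfAlgebra k H] {A : RibbonHopfAlgebra k H}

lemma isIso_of_bijective {X Y : HMod A} (f : X ⟶ Y) (hf : Function.Bijective f.lin) : IsIso f :=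
  (isoMk (LinearEquiv.ofBijective f.lin hf) f.comm).isIso_hom

lemma finiteDimensional_hom (X Y : HMod A) : FiniteDimensional k (X ⟶ Y) := by
  let e : (X ⟶ Y) →ₗ[k] (X.V →ₗ[k] Y.V) :=
    { toFun := Hom.lin, map_add' := fun _ _ => rfl, map_smul' := fun _ _ => rfl }
  exact FiniteDimensional.of_injective e fun f g h => hom_ext h

lemma bijective_smul_id_unit : Function.Bijective fun a : k => a • 𝟙 (𝟙_ (HMod A)) := by
  have h (a : k) : Hom.lin (a • 𝟙 (𝟙_ (HMod A))) = a • (LinearMap.id : k →ₗ[k] k) := rfl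
  constructor
  · intro a b hab
    have h1 : Hom.lin (a • 𝟙 (𝟙_ (HMod A))) (1 : k) = Hom.lin (b • 𝟙 (𝟙_ (HMod A))) (1 : k) :=
      congrArg (fun f => Hom.lin f (1 : k)) hab
    rw [h, h] at h1
    simpa using h1
  · intro f
    let g : k →ₗ[k] k := f.lin
    refine ⟨g 1, hom_ext (LinearMap.ext_ring ?_)⟩
    rw [h]
    exact mul_one (g 1)

variable [FiniteDimensional k H]

lemma injective_of_mono {X Y : HMod A} (f : X ⟶ Y) [Mono f] : Function.Injective f.lin := by
  refine (injective_iff_map_eq_zero f.lin).2 fun x hx => ?_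
  have h : ofElement X x = 0 := by
    rw [← cancel_mono f, Limits.zero_comp]
    refine hom_ext (LinearMap.ext fun a => ?_)
    change f.lin (X.act a x) = 0
    rw [f.comm, hx, map_zero]
  have h1 : X.act 1 x = 0 := congrArg (fun g => Hom.lin g (1 : H)) h
  rwa [map_one] at h1

lemma isNoetherianObject (X : HMod A) : IsNoetherianObject X := by
  have hlt {P Q : Subobject X} (h : P < Q) :
      Module.finrank k (P : HMod A).V < Module.finrank k (Q : HMod A).V := by
    have hinj := injective_of_mono (P.ofLE Q h.le)
    refine lt_of_le_of_ne (LinearMap.finrank_le_finrank_of_injective hinj) fun he => ?_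
    have := isIso_of_bijective (P.ofLE Q h.le)
      ⟨hinj, (LinearMap.injective_iff_surjective_of_finrank_eq_finrank he).1 hinj⟩
    refine h.not_ge (Subobject.le_of_comm (inv (P.ofLE Q h.le)) ?_)
    rw [IsIso.inv_comp_eq, Subobject.ofLE_arrow]
  have hle (P : Subobject X) : Module.finrank k (P : HMod A).V ≤ Module.finrank k X.V :=
    LinearMap.finrank_le_finrank_of_injective (injective_of_mono P.arrow)
  rw [isNoetherianObject_iff_not_strictMono]
  intro f hf
  have hmono : StrictMono fun n => Module.finrank k (f n : HMod A).V := fun m n hmn => hlt (hf hmn)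
  have h1 := hmono.le_apply (x := Module.finrank k X.V + 1)
  have h2 := hle (f (Module.finrank k X.V + 1))
  omega

lemma isRibbonTwist_twist : IsRibbonTwist (twist A) where
  isIso X := by
    refine isIso_of_bijective _ (Function.bijective_iff_has_inverse.2
      ⟨X.act ((A.νUnit⁻¹ : Hˣ) : H), fun x => ?_, fun x => ?_⟩)
    · change (X.act _ * X.act (A.νUnit : H)) x = x
      rw [← map_mul, Units.inv_mul, map_one]
      rfl
    · change (X.act (A.νUnit : H) * X.act _) x = x
      rw [← map_mul, Units.mul_inv, map_one]
      rfl
  tensor X Y := by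
    refine hom_ext (LinearMap.ext fun z => ?_)
    have h := map_act₂ X.act Y.act X.act Y.act ((twist A).app X).comm ((twist A).app Y).comm
      (flip k H A.monodromy) z
    refine Eq.trans ?_ (Eq.trans h.symm (congrArg (TensorProduct.map ((twist A).app X).lin
      ((twist A).app Y).lin) (doubleBraiding_lin_apply X Y z).symm))
    change act₂ X.act Y.act (comul A.ν) z = act₂ X.act Y.act (flip k H A.monodromy)
      (act₂ X.act Y.act (A.ν ⊗ₜ A.ν) z)
    rw [A.comul_ν, A.flip_monodromy, ← Module.End.mul_apply, ← map_mul]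
  dual X := by
    refine hom_ext (LinearMap.ext fun ξ => ?_)
    refine Eq.trans ?_ (toDual_leftAdjointMate ((twist A).app X) ξ).symm
    refine LinearMap.ext fun x => ?_
    change toDual X ξ (X.act (A.antipodeInv A.ν) x) = toDual X ξ (X.act A.ν x)
    rw [A.antipodeInv_ν]

end HMod

end RibbonHopf

end

noncomputable section

namespace RibbonHopf

open Coalgebra

/-! ### The quotient of the coend by the annihilator of its pairing -/

namespace HMod

variable {k H : Type u} [Field k] [Ring H] [HopfAlgebra k H] {A : RibbonHopfAlgebra k H}

section Linear

/-- The image of a morphism. -/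
def imageObj {X Y : HMod A} (f : X ⟶ Y) : HMod A where
  V := LinearMap.range f.lin
  act := AlgHom.ofLinearMap
    { toFun := fun a => (Y.act a).restrict (by
        rintro _ ⟨x, rfl⟩
        exact ⟨X.act a x, f.comm a x⟩)
      map_add' := fun a b => LinearMap.ext fun y => Subtype.ext (by
        change Y.act (a + b) y = Y.act a y + Y.act b y
        rw [map_add]
        rfl)
      map_smul' := fun c a => LinearMap.ext fun y => Subtype.ext (by
        change Y.act (c • a) y = c • Y.act a y
        rw [map_smul]
        rfl) }
    (LinearMap.ext fun y => Subtype.ext (by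
      change Y.act 1 y = y
      rw [map_one]
      rfl))
    (fun a b => LinearMap.ext fun y => Subtype.ext (by
      change Y.act (a * b) y = Y.act a (Y.act b y)
      rw [map_mul]
      rfl))

/-- A morphism as a surjection onto its image. -/
def toImage {X Y : HMod A} (f : X ⟶ Y) : X ⟶ imageObj f :=
  ⟨f.lin.rangeRestrict, fun a x => Subtype.ext (f.comm a x)⟩

lemma toImage_surjective {X Y : HMod A} (f : X ⟶ Y) : Function.Surjective (toImage f).lin :=
  f.lin.surjective_rangeRestrict

lemma toImage_lin_eq_zero_iff {X Y : HMod A} (f : X ⟶ Y) (x : X.V) :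
    (toImage f).lin x = 0 ↔ f.lin x = 0 := Subtype.ext_iff

lemma epi_of_surjective {X Y : HMod A} (p : X ⟶ Y) (hp : Function.Surjective p.lin) : Epi p :=
  ⟨fun f g h => hom_ext (LinearMap.ext fun y => by
    obtain ⟨x, rfl⟩ := hp y
    exact congrArg (fun φ => Hom.lin φ x) h)⟩

lemma exists_comp_eq {X Y Z : HMod A} (p : X ⟶ Y) (hp : Function.Surjective p.lin) (q : X ⟶ Z)
    (h : ∀ x, p.lin x = 0 → q.lin x = 0) : ∃ r : Y ⟶ Z, p ≫ r = q := by
  obtain ⟨s, hs⟩ := p.lin.exists_rightInverse_of_surjective (LinearMap.range_eq_top.2 hp)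
  have h1 (x : X.V) : q.lin (s (p.lin x)) = q.lin x := by
    rw [← sub_eq_zero, ← map_sub]
    refine h _ ?_
    rw [map_sub, sub_eq_zero]
    exact LinearMap.congr_fun hs (p.lin x)
  exact ⟨homOfSurjective p hp q (q.lin ∘ₗ s) h1, hom_ext (LinearMap.ext h1)⟩

/-- The kernel of `p ⊗ Z` is spanned by the tensors with first factor in the kernel of `p`. -/
lemma exists_whiskerRight_comp_eq {X Y Z W : HMod A} (p : X ⟶ Y)
    (hp : Function.Surjective p.lin) (q : X ⊗ Z ⟶ W)
    (h : ∀ x z, p.lin x = 0 → q.lin (x ⊗ₜ[k] z) = 0) : ∃ r : Y ⊗ Z ⟶ W, p ▷ Z ≫ r = q := by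
  refine exists_comp_eq (p ▷ Z) (TensorProduct.map_surjective hp Function.surjective_id) q
    fun t ht => ?_
  have h1 := (rTensor_exact Z.V p.lin.exact_subtype_ker_map hp t).1 ht
  obtain ⟨s, rfl⟩ := h1
  clear ht
  induction s with
  | zero => simp only [map_zero]
  | add a b ha hb => rw [map_add, map_add, ha, hb, add_zero]
  | tmul x z => exact h _ z x.2

lemma exists_tensorHom_comp_eq {X Y W : HMod A} (p : X ⟶ Y)
    (hp : Function.Surjective p.lin) (q : X ⊗ X ⟶ W)
    (h1 : ∀ x z, p.lin x = 0 → q.lin (x ⊗ₜ[k] z) = 0)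
    (h2 : ∀ x z, p.lin z = 0 → q.lin (x ⊗ₜ[k] z) = 0) :
    ∃ r : Y ⊗ Y ⟶ W, (p ⊗ₘ p) ≫ r = q := by
  obtain ⟨r, rfl⟩ := exists_whiskerRight_comp_eq p hp q h1
  have : ∃ r' : Y ⊗ Y ⟶ W, Y ◁ p ≫ r' = r := by
    refine exists_comp_eq (Y ◁ p) (TensorProduct.map_surjective Function.surjective_id hp) r
      fun t ht => ?_
    obtain ⟨s, rfl⟩ := (lTensor_exact Y.V p.lin.exact_subtype_ker_map hp t).1 ht
    clear ht
    induction s with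
    | zero => simp only [map_zero]
    | add a b ha hb => rw [map_add, map_add, ha, hb, add_zero]
    | tmul y x =>
      obtain ⟨z, rfl⟩ := hp y
      exact h2 z _ x.2
  obtain ⟨r', rfl⟩ := this
  exact ⟨r', by rw [MonoidalCategory.tensorHom_def, Category.assoc]⟩

/-- A pairing `X ⊗ Y ⟶ 𝟙` as a morphism from `X` to the dual of `Y`. -/
def curryPairing {X Y : HMod A} (ω : X ⊗ Y ⟶ 𝟙_ (HMod A)) : X ⟶ Yᘁ :=
  (ρ_ X).inv ≫ X ◁ η_ Y (Yᘁ) ≫ (α_ X Y (Yᘁ)).inv ≫ ω ▷ (Yᘁ) ≫ (λ_ (Yᘁ)).hom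

lemma curryPairing_lin_apply {X Y : HMod A} (ω : X ⊗ Y ⟶ 𝟙_ (HMod A)) (x : X.V) (y : Y.V) :
    (show Module.Dual k Y.V from (curryPairing ω).lin x) y = ω.lin (x ⊗ₜ[k] y) := by
  let b := Module.Basis.ofVectorSpace k Y.V
  let w : X.V ⊗[k] Y.V →ₗ[k] k := ω.lin
  have h1 : (curryPairing ω).lin x = TensorProduct.lid k (Module.Dual k Y.V)
      (TensorProduct.map w LinearMap.id ((TensorProduct.assoc k X.V Y.V (Module.Dual k Y.V)).symm
        (x ⊗ₜ[k] coevaluation k Y.V 1))) := rfl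
  rw [h1, coevaluation_apply_one, TensorProduct.tmul_sum, map_sum, map_sum, map_sum]
  change (∑ i, w (x ⊗ₜ b i) • b.coord i) y = w (x ⊗ₜ y)
  conv_rhs => rw [← b.sum_repr y, TensorProduct.tmul_sum, map_sum]
  simp [LinearMap.sum_apply, mul_comm]

end Linear

section Coend

variable [FiniteDimensional k H]

lemma curryPairing_ω_lin_eq_zero_iff (f : Module.Dual k H) :
    (curryPairing (coendAlgebra A).ω).lin f = 0 ↔ sliceLeft f A.monodromy = 0 := by
  have h1 : (curryPairing (coendAlgebra A).ω).lin f = 0 ↔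
      ∀ g : Module.Dual k H, g (γ k H (sliceLeft f A.monodromy)) = 0 := by
    have h2 (g : Module.Dual k H) := (curryPairing_lin_apply (coendAlgebra A).ω f g).trans
      (coendAlgebra_ω_lin_tmul f g)
    constructor
    · intro h g
      rw [← h2, h]
      rfl
    · intro h
      exact LinearMap.ext fun g => (h2 g).trans (h g)
  rw [h1, Module.forall_dual_apply_eq_zero_iff, map_eq_zero_iff _ A.antipode_bijective.1]

lemma whiskerRight_ω_eq_zero_iff {Y : HMod A} (g : Y ⟶ coendObj A) :
    g ▷ coendObj A ≫ (coendAlgebra A).ω = 0 ↔ ∀ y, sliceLeft (g.lin y) A.monodromy = 0 := by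
  simp only [← curryPairing_ω_lin_eq_zero_iff]
  have h2 (y : Y.V) (f : Module.Dual k H) := curryPairing_lin_apply (coendAlgebra A).ω (g.lin y) f
  constructor
  · intro h y
    refine LinearMap.ext fun f => (h2 y f).trans ?_
    exact congrArg (fun φ => Hom.lin φ (y ⊗ₜ[k] f)) h
  · intro h
    refine hom_ext (TensorProduct.ext' fun y f => (h2 y f).symm.trans ?_)
    rw [h]
    rfl

/-- The flipped monodromy lies in `γ(𝔲) ⊗ H`, and `γ(v)` acts on the dual space of `H` as
`f ↦ f(v ·)`. As `𝔲` is a subalgebra, the monodromies of the coend preserve its annihilator. -/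
lemma exists_coendMonodromyLin_tmul_eq (X : HMod A) (f : Module.Dual k H) (x : X.V) :
    ∃ (n : ℕ) (v : Fin n → H) (y : Fin n → X.V), (∀ i, v i ∈ A.uSubspace) ∧
      coendMonodromyLin X (f ⊗ₜ x) = ∑ i, (f ∘ₗ LinearMap.mulLeft k (v i)) ⊗ₜ[k] y i := by
  let b := Module.finBasis k H
  refine ⟨_, fun i => sliceRight (b.coord i) A.monodromy, fun i => X.act (γ k H (b i)) x,
    fun i => ⟨b.coord i, rfl⟩, ?_⟩
  have h1 : flip k H A.monodromy =
      ∑ i, γ k H (sliceRight (b.coord i) A.monodromy) ⊗ₜ γ k H (b i) := by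
    have h0 : A.monodromy = ∑ i, sliceRight (b.coord i) A.monodromy ⊗ₜ b i := by
      conv_lhs => rw [← flip_flip A.monodromy, ← sum_basis_tmul_sliceLeft b (flip k H A.monodromy)]
      simp only [map_sum, flip_tmul, sliceLeft_flip]
    conv_lhs => rw [← A.map_antipode_monodromy, h0]
    simp only [map_sum, TensorProduct.map_tmul]
  change act₂ (actLeftDual A (Algebra.lmul k H)) X.act (flip k H A.monodromy) (f ⊗ₜ x) = _
  rw [h1, map_sum, LinearMap.sum_apply]
  refine Finset.sum_congr rfl fun i _ => ?_
  rw [act₂_tmul]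
  congr 1
  refine LinearMap.ext fun h => ?_
  change f (A.antipodeInv (γ k H _) * h) = f (_ * h)
  rw [A.antipodeInv_γ]

variable (A) in
/-- The quotient of the coend by the annihilator of its pairing. -/
lemma exists_quotientAlgebra : ∃ Q : (coendAlgebra A).QuotientAlgebra,
    Function.Surjective Q.π.lin ∧ ∀ f : Module.Dual k H,
      Q.π.lin f = 0 ↔ sliceLeft f A.monodromy = 0 := by
  let ω' := curryPairing (coendAlgebra A).ω
  let π := toImage ω'
  have hπ : Function.Surjective π.lin := toImage_surjective ω'
  have hker (f : Module.Dual k H) : π.lin f = 0 ↔ sliceLeft f A.monodromy = 0 :=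
    (toImage_lin_eq_zero_iff ω' f).trans (curryPairing_ω_lin_eq_zero_iff f)
  obtain ⟨m, hm⟩ : ∃ m, (π ⊗ₘ π) ≫ m = (coendAlgebra A).mul ≫ π := by
    refine exists_tensorHom_comp_eq π hπ _ (fun f g hf => ?_) (fun f g hg => ?_)
    · refine (congrArg π.lin (coendAlgebra_mul_lin_tmul f g)).trans ((hker _).2 ?_)
      rw [A.sliceLeft_braidedMul_monodromy, (hker f).1 hf, mul_zero]
    · refine (congrArg π.lin (coendAlgebra_mul_lin_tmul f g)).trans ((hker _).2 ?_)
      rw [A.sliceLeft_braidedMul_monodromy, (hker g).1 hg, zero_mul]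
  obtain ⟨e, he⟩ : ∃ e, π ≫ e = (coendAlgebra A).counit :=
    exists_comp_eq π hπ _ fun f hf =>
      (A.forall_mem_uSubspace_eq_zero_iff f).2 ((hker f).1 hf) 1 A.one_mem_uSubspace
  have hΩ (X : HMod A) : ∃ Ω, π ▷ X ≫ Ω = (coendAlgebra A).Ω X ≫ π ▷ X := by
    refine exists_whiskerRight_comp_eq π hπ _ fun f x hf => ?_
    obtain ⟨n, v, y, hv, h⟩ := exists_coendMonodromyLin_tmul_eq X f x
    refine (congrArg (Hom.lin (π ▷ X)) h).trans ?_
    rw [map_sum]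
    refine Finset.sum_eq_zero fun i _ => ?_
    have h1 : π.lin (f ∘ₗ LinearMap.mulLeft k (v i)) = 0 := by
      rw [hker, ← A.forall_mem_uSubspace_eq_zero_iff] at hf ⊢
      exact fun w hw => hf _ (A.mul_mem_uSubspace (hv i) hw)
    refine (congrArg (fun z => z ⊗ₜ[k] y i) h1).trans (TensorProduct.zero_tmul _ _)
  choose Ω hΩ using hΩ
  exact ⟨⟨_, π, epi_of_surjective π hπ, fun g => by
    rw [whiskerRight_ω_eq_zero_iff]
    simp only [← hker]
    exact ⟨fun h y => congrArg (fun φ => Hom.lin φ y) h, fun h => hom_ext (LinearMap.ext h)⟩,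
    m, hm, e, he, Ω, hΩ⟩, hπ, hker⟩

end Coend

end HMod

end RibbonHopf

end

noncomputable section

namespace RibbonHopf

open Coalgebra

/-! ### Integrals of the coend -/

section CoendIntegrals

variable {k H : Type u} [Field k] [Ring H] [HopfAlgebra k H] {A : RibbonHopfAlgebra k H}

lemma dualDistrib_eq_apply_sliceRight (φ ψ : Module.Dual k H) (t : H ⊗[k] H) :
    TensorProduct.dualDistrib k H H (φ ⊗ₜ ψ) t = φ (sliceRight ψ t) := by
  induction t with
  | zero => simp
  | add a b ha hb => simp only [map_add, ha, hb]
  | tmul a b => simp [mul_comm]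

lemma sliceLeft_smul (c : k) (φ : Module.Dual k H) : sliceLeft (c • φ) = c • sliceLeft φ :=
  TensorProduct.ext' fun x y => by simp [mul_smul]

lemma sliceRight_smul (c : k) (φ : Module.Dual k H) : sliceRight (c • φ) = c • sliceRight φ :=
  TensorProduct.ext' fun x y => by simp [mul_smul]

namespace HMod

lemma actCoadjoint_apply_eq_smul_iff (f : Module.Dual k H) :
    (∀ a, actCoadjoint A a f = counit (R := k) a • f) ↔
      RibbonHopfAlgebra.IsInvariant k f := by
  rw [RibbonHopfAlgebra.isInvariant_iff A]
  refine forall_congr' fun a => LinearMap.ext_iff.trans (forall_congr' fun x => ?_)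
  rw [← actBimodule_apply]
  rfl

variable [FiniteDimensional k H]

/-- An invariant functional as a morphism from the unit to the coend. -/
def ofInvariant {f : Module.Dual k H} (hf : RibbonHopfAlgebra.IsInvariant k f) :
    𝟙_ (HMod A) ⟶ coendObj A :=
  ⟨LinearMap.toSpanSingleton k _ f, fun a r => by
    change (counit (R := k) a * r) • f = actCoadjoint A a (r • f)
    rw [map_smul, (actCoadjoint_apply_eq_smul_iff f).2 hf, smul_smul, mul_comm]⟩

/-- The functional on `H` corresponding to a morphism from the unit to the coend. -/
def functionalOf (s : 𝟙_ (HMod A) ⟶ coendObj A) : Module.Dual k H := Hom.lin s (1 : k)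

lemma functionalOf_ofInvariant {f : Module.Dual k H} (hf : RibbonHopfAlgebra.IsInvariant k f) :
    functionalOf (ofInvariant (A := A) hf) = f := one_smul k f

lemma lin_eq_smul_functionalOf (s : 𝟙_ (HMod A) ⟶ coendObj A) (r : k) :
    s.lin r = r • functionalOf s :=
  (congrArg s.lin (mul_one r).symm).trans (s.lin.map_smul r (1 : k))

lemma isInvariant_functionalOf (s : 𝟙_ (HMod A) ⟶ coendObj A) :
    RibbonHopfAlgebra.IsInvariant k (functionalOf s) := by
  refine (actCoadjoint_apply_eq_smul_iff (A := A) _).1 fun a => ?_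
  refine (s.comm a (1 : k)).symm.trans ?_
  change s.lin (counit (R := k) a * 1 : k) = _
  rw [lin_eq_smul_functionalOf, mul_one]

/-- A morphism from the unit to the coend is a two-sided integral exactly when the corresponding
functional satisfies the equation of a left integral on `H`. -/
lemma isTwoSidedIntegral_iff (s : 𝟙_ (HMod A) ⟶ coendObj A) :
    IsTwoSidedIntegral (coendAlgebra A).mul (coendAlgebra A).counit s ↔
      ∀ h : H, sliceRight (functionalOf s) (comul h) = functionalOf s h • (1 : H) := by
  have hs := isInvariant_functionalOf s
  have h5 := lin_eq_smul_functionalOf s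
  generalize hf : functionalOf s = f at hs h5
  have h1 (g : Module.Dual k H) (h : H) :
      A.braidedMul g f h = g (sliceRight f (comul h)) := by
    rw [braidedMul_eq, dualDistrib_eq_apply_sliceRight, hs.sliceRight_braidedComul]
  have h2 (g : Module.Dual k H) (h : H) :
      A.braidedMul f g h = g (sliceRight f (comul h)) := by
    rw [braidedMul_eq, dualDistrib_eq_apply_sliceRight, ← apply_sliceLeft,
      hs.sliceLeft_braidedComul]
  have h3 (g : Module.Dual k H) : Hom.lin (coendObj A ◁ s ≫ (coendAlgebra A).mul)
      (g ⊗ₜ[k] (1 : k)) = A.braidedMul g f := by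
    rw [← hf]
    exact coendAlgebra_mul_lin_tmul g _
  have h4 (g : Module.Dual k H) : Hom.lin (s ▷ coendObj A ≫ (coendAlgebra A).mul)
      ((1 : k) ⊗ₜ[k] g) = A.braidedMul f g := by
    rw [← hf]
    exact coendAlgebra_mul_lin_tmul _ g
  have h6 (g : Module.Dual k H) : Hom.lin ((ρ_ (coendObj A)).hom ≫ (coendAlgebra A).counit ≫ s)
      (g ⊗ₜ[k] (1 : k)) = g 1 • f := by
    refine Eq.trans ?_ (h5 (g 1))
    change s.lin (Module.Dual.eval k H 1 ((1 : k) • g) : k) = _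
    rw [one_smul]
    rfl
  have h7 (g : Module.Dual k H) : Hom.lin ((λ_ (coendObj A)).hom ≫ (coendAlgebra A).counit ≫ s)
      ((1 : k) ⊗ₜ[k] g) = g 1 • f := by
    refine Eq.trans ?_ (h5 (g 1))
    change s.lin (Module.Dual.eval k H 1 ((1 : k) • g) : k) = _
    rw [one_smul]
    rfl
  constructor
  · rintro ⟨h, -⟩ x
    rw [← sub_eq_zero, ← Module.forall_dual_apply_eq_zero_iff k]
    intro g
    have h8 : A.braidedMul g f = g 1 • f := (h3 g).symm.trans ((congrArg
      (fun φ : coendObj A ⊗ 𝟙_ (HMod A) ⟶ coendObj A =>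
        Hom.lin φ (g ⊗ₜ[k] (1 : k))) h).trans (h6 g))
    rw [map_sub, ← h1, h8, map_smul, LinearMap.smul_apply, smul_eq_mul, smul_eq_mul, mul_comm,
      sub_self]
  · intro h
    have h8 (g : Module.Dual k H) (x : H) : g (sliceRight f (comul x)) = (g 1 • f) x := by
      rw [h, map_smul, LinearMap.smul_apply, smul_eq_mul, smul_eq_mul, mul_comm]
    constructor
    · refine hom_ext (TensorProduct.ext (LinearMap.ext fun g => LinearMap.ext_ring ?_))
      exact (h3 g).trans ((LinearMap.ext fun x => (h1 g x).trans (h8 g x)).trans (h6 g).symm)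
    · refine hom_ext (TensorProduct.ext (LinearMap.ext_ring (LinearMap.ext fun g => ?_)))
      exact (h4 g).trans ((LinearMap.ext fun x => (h2 g x).trans (h8 g x)).trans (h7 g).symm)

lemma loop_comp_π (Q : (coendAlgebra A).QuotientAlgebra) (s : 𝟙_ (HMod A) ⟶ coendObj A)
    (X : HMod A) (x : X.V) : Hom.lin (Q.loop (s ≫ Q.π) X) ((1 : k) ⊗ₜ[k] x) =
      X.act (γ k H (sliceLeft (functionalOf s) A.monodromy)) x := by
  have h : Q.loop (s ≫ Q.π) X =
      s ▷ X ≫ (coendAlgebra A).Ω X ≫ (coendAlgebra A).counit ▷ X ≫ (λ_ X).hom := by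
    rw [CoendAlgebra.QuotientAlgebra.loop, comp_whiskerRight, Category.assoc,
      ← Category.assoc (Q.π ▷ X), Q.Ω_spec, Category.assoc, ← Category.assoc (Q.π ▷ X),
      ← comp_whiskerRight, Q.counit_spec]
  rw [h]
  exact counit_Ω_lin_tmul X _ x

lemma isTwoSidedIntegral_comp_π (Q : (coendAlgebra A).QuotientAlgebra)
    (hQ : Function.Surjective Q.π.lin) {s : 𝟙_ (HMod A) ⟶ coendObj A}
    (hs : IsTwoSidedIntegral (coendAlgebra A).mul (coendAlgebra A).counit s) :
    IsTwoSidedIntegral Q.mul Q.counit (s ≫ Q.π) := by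
  constructor
  · have : Epi (Q.π ▷ 𝟙_ (HMod A)) :=
      epi_of_surjective _ (TensorProduct.map_surjective hQ Function.surjective_id)
    rw [← cancel_epi (Q.π ▷ 𝟙_ (HMod A)), ← whisker_exchange_assoc,
      MonoidalCategory.whiskerLeft_comp, Category.assoc, ← MonoidalCategory.tensorHom_def'_assoc,
      Q.mul_spec, ← Category.assoc, hs.1, MonoidalCategory.rightUnitor_naturality_assoc,
      ← Q.counit_spec]
    simp only [Category.assoc]
  · have : Epi (𝟙_ (HMod A) ◁ Q.π) :=
      epi_of_surjective _ (TensorProduct.map_surjective Function.surjective_id hQ)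
    rw [← cancel_epi (𝟙_ (HMod A) ◁ Q.π), whisker_exchange_assoc,
      MonoidalCategory.comp_whiskerRight, Category.assoc, ← MonoidalCategory.tensorHom_def_assoc,
      Q.mul_spec, ← Category.assoc, hs.2, MonoidalCategory.leftUnitor_naturality_assoc,
      ← Q.counit_spec]
    simp only [Category.assoc]

variable {I : Module.Dual k H}

/-- The invariance and nondegeneracy conditions make a multiple of the left integral a normalized
integral. -/
lemma exists_isNormalizedIntegral (hk : ∀ a : k, IsSquare a) (hI : IsLeftIntegral k I)
    (hν : A.ν ∈ A.uSubspace) (hinv : RibbonHopfAlgebra.IsInvariant k I)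
    (h3 : sliceLeft I A.monodromy ≠ 0) (Q : (coendAlgebra A).QuotientAlgebra)
    (hQ : Function.Surjective Q.π.lin) (T : Q.f ⟶ Q.f) (hT : coendTwist A ≫ Q.π = Q.π ≫ T) :
    ∃ (μ : 𝟙_ (HMod A) ⟶ Q.f) (lam : kˣ) (σ : 𝟙_ (HMod A) ⟶ (coendAlgebra A).F),
      Q.IsNormalizedIntegral (twist A) T μ lam ∧
        IsTwoSidedIntegral (coendAlgebra A).mul (coendAlgebra A).counit σ ∧ σ ≫ Q.π = μ := by
  have ha := A.apply_ν_ne_zero hI hν h3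
  have hb := A.apply_ν_inv_ne_zero hI hinv hν h3
  set a := I A.ν
  set w := ((A.νUnit⁻¹ : Hˣ) : H)
  set b := I w
  -- the loops act by `c I(ν) ν⁻¹` and `c I(ν⁻¹) ν`, so `c² I(ν) I(ν⁻¹)` has to be `1`
  obtain ⟨c, hc⟩ := hk (a * b)⁻¹
  have hc' : c * c * (a * b) = 1 := by rw [← hc, inv_mul_cancel₀ (mul_ne_zero ha hb)]
  have hc0 : c ≠ 0 := by
    rintro rfl
    simp at hc'
  have hinv' : RibbonHopfAlgebra.IsInvariant k (I ∘ₗ LinearMap.mulLeft k w) := fun x y => by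
    change I (w * (x * y)) = I (w * (y * _))
    rw [← mul_assoc, A.ν_inv_mul_comm, mul_assoc, hinv, mul_assoc]
  let σ : 𝟙_ (HMod A) ⟶ coendObj A := ofInvariant (hinv.smul c)
  let σ' : 𝟙_ (HMod A) ⟶ coendObj A := ofInvariant (hinv'.smul c)
  have hσ : IsTwoSidedIntegral (coendAlgebra A).mul (coendAlgebra A).counit σ := by
    rw [isTwoSidedIntegral_iff]
    intro h
    rw [functionalOf_ofInvariant, sliceRight_smul, LinearMap.smul_apply, hI.sliceRight_comul,
      LinearMap.smul_apply, smul_assoc]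
  have hσ' : σ' ≫ coendTwist A = σ := by
    refine hom_ext (LinearMap.ext_ring (LinearMap.ext fun x => ?_))
    change (1 : k) • (c • I (w * (A.ν * x))) = (1 : k) • (c • I x)
    rw [← mul_assoc, ← A.coe_νUnit, Units.inv_mul, one_mul]
  refine ⟨σ ≫ Q.π, Units.mk0 (c * a) (mul_ne_zero hc0 ha), σ,
    ⟨isTwoSidedIntegral_comp_π Q hQ hσ, fun X => ?_, σ' ≫ Q.π, ?_, fun X => ?_⟩, hσ, rfl⟩
  · rw [Category.assoc, ← hT, ← Category.assoc]
    refine hom_ext (TensorProduct.ext (LinearMap.ext_ring (LinearMap.ext fun x => ?_)))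
    refine (congrArg (X.act A.ν) (loop_comp_π Q (σ ≫ coendTwist A) X x)).trans ?_
    have h : functionalOf (σ ≫ coendTwist A) = c • (I ∘ₗ LinearMap.mulLeft k A.ν) :=
      one_smul k (c • (I ∘ₗ LinearMap.mulLeft k A.ν))
    change (X.act A.ν * X.act _) x = (c * a) • ((1 : k) • x)
    rw [← map_mul, h, sliceLeft_smul, LinearMap.smul_apply, map_smul, mul_smul_comm,
      A.ν_mul_antipode_sliceLeft hI, smul_smul, map_smul, map_one, one_smul]
    rfl
  · rw [Category.assoc, ← hT, ← Category.assoc, hσ']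
  · refine hom_ext (TensorProduct.ext (LinearMap.ext_ring (LinearMap.ext fun x => ?_)))
    refine (loop_comp_π Q σ' X x).trans ?_
    have hlam : (c * a)⁻¹ = c * b := inv_eq_of_mul_eq_one_right (by rw [← hc']; ring)
    change _ = (c * a)⁻¹ • X.act A.ν ((1 : k) • x)
    rw [functionalOf_ofInvariant, sliceLeft_smul, LinearMap.smul_apply, map_smul,
      A.antipode_sliceLeft_mulLeft_ν_inv hI hinv, smul_smul, map_smul, one_smul, hlam]
    rfl

end HMod

end CoendIntegrals

end RibbonHopf

end

noncomputable section

namespace RibbonHopf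

open Coalgebra

/-! ### Independence of the choice of the coend -/

section Uniqueness

variable {C : Type v} [Category.{w} C] [MonoidalCategory C] [BraidedCategory C] [RigidCategory C]

lemma CoendAlgebra.hom_ext (D : CoendAlgebra C) {Y : C} {f g : D.F ⟶ Y}
    (h : ∀ L, D.ι L ≫ f = D.ι L ≫ g) : f = g :=
  (D.universal Y (fun L => D.ι L ≫ g) fun φ => by
    rw [← Category.assoc, D.dinatural, Category.assoc]).unique h fun _ => rfl

lemma CoendAlgebra.exists_iso (D D' : CoendAlgebra C) :
    ∃ e : D.F ≅ D'.F, ∀ L, D.ι L ≫ e.hom = D'.ι L := by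
  obtain ⟨φ, hφ, -⟩ := D.universal D'.F D'.ι D'.dinatural
  obtain ⟨ψ, hψ, -⟩ := D'.universal D.F D.ι D.dinatural
  exact ⟨⟨φ, ψ, D.hom_ext fun L => by rw [← Category.assoc, hφ, hψ, Category.comp_id],
    D'.hom_ext fun L => by rw [← Category.assoc, hψ, hφ, Category.comp_id]⟩, hφ⟩

end Uniqueness

namespace HMod

variable {k H : Type u} [Field k] [Ring H] [HopfAlgebra k H] [FiniteDimensional k H]
  {A : RibbonHopfAlgebra k H}

/-- A quotient algebra of any coend is a quotient algebra of the coend on the dual space of `H`,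
with the same operations. -/
lemma exists_quotientAlgebra_transport (D : CoendAlgebra (HMod A)) (Q : D.QuotientAlgebra)
    (TF : D.F ⟶ D.F) (T : Q.f ⟶ Q.f) (hTF : D.IsTwist (twist A) TF) (hT : TF ≫ Q.π = Q.π ≫ T)
    (σ : 𝟙_ (HMod A) ⟶ D.F) (hσ : IsTwoSidedIntegral D.mul D.counit σ) (lam : kˣ)
    (hμ : Q.IsNormalizedIntegral (twist A) T (σ ≫ Q.π) lam) :
    ∃ (Q' : (coendAlgebra A).QuotientAlgebra) (T' : Q'.f ⟶ Q'.f)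
      (σ' : 𝟙_ (HMod A) ⟶ coendObj A),
      coendTwist A ≫ Q'.π = Q'.π ≫ T' ∧
        IsTwoSidedIntegral (coendAlgebra A).mul (coendAlgebra A).counit σ' ∧
        Q'.IsNormalizedIntegral (twist A) T' (σ' ≫ Q'.π) lam := by
  obtain ⟨e, he⟩ := (coendAlgebra A).exists_iso D
  have hι : Epi (coendι (regular A)) := epi_of_surjective _ coendι_regular_surjective
  have hιι : Epi (coendι (regular A) ⊗ₘ coendι (regular A)) :=
    epi_of_surjective _ coendι_tensor_surjective
  have he' (X Y : HMod A) : (coendι X ⊗ₘ coendι Y) ≫ (e.hom ⊗ₘ e.hom) = D.ι X ⊗ₘ D.ι Y := by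
    rw [MonoidalCategory.tensorHom_comp_tensorHom]
    exact congrArg₂ (· ⊗ₘ ·) (he X) (he Y)
  have hmul : (coendAlgebra A).mul ≫ e.hom = (e.hom ⊗ₘ e.hom) ≫ D.mul := by
    rw [← cancel_epi (coendι (regular A) ⊗ₘ coendι (regular A)), ← Category.assoc,
      (coendAlgebra A).mul_spec, ← Category.assoc, he', D.mul_spec, Category.assoc, he]
  have hω : (coendAlgebra A).ω = (e.hom ⊗ₘ e.hom) ≫ D.ω := by
    rw [← cancel_epi (coendι (regular A) ⊗ₘ coendι (regular A)), (coendAlgebra A).ω_spec,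
      ← Category.assoc, he', D.ω_spec]
  have hcounit : (coendAlgebra A).counit = e.hom ≫ D.counit := by
    rw [← cancel_epi (coendι (regular A)), (coendAlgebra A).counit_spec, ← Category.assoc]
    exact ((congrArg (· ≫ D.counit) (he _)).trans (D.counit_spec _)).symm
  have hΩ (X : HMod A) : (coendAlgebra A).Ω X ≫ e.hom ▷ X = e.hom ▷ X ≫ D.Ω X := by
    have hX : Epi (coendι (regular A) ▷ X) := epi_of_surjective _
      (TensorProduct.map_surjective coendι_regular_surjective Function.surjective_id)
    have heX : coendι (regular A) ▷ X ≫ e.hom ▷ X = D.ι (regular A) ▷ X := by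
      rw [← MonoidalCategory.comp_whiskerRight]
      exact congrArg (· ▷ X) (he _)
    rw [← cancel_epi (coendι (regular A) ▷ X), ← Category.assoc, (coendAlgebra A).Ω_spec,
      ← Category.assoc, heX, D.Ω_spec, Category.assoc, heX]
  have hTw : coendTwist A ≫ e.hom = e.hom ≫ TF := by
    rw [← cancel_epi (coendι (regular A)), ← Category.assoc, isTwist_coendTwist, ← Category.assoc,
      Category.assoc]
    refine (congrArg (_ ≫ ·) (he _)).trans (Eq.trans ?_ (congrArg (· ≫ TF) (he _)).symm)
    exact (hTF _).symm
  let Q' : (coendAlgebra A).QuotientAlgebra :=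
    { f := Q.f
      π := e.hom ≫ Q.π
      epi := @epi_comp _ _ _ _ _ e.hom inferInstance Q.π Q.epi
      ann := fun {Y} g => by
        have h : g ▷ (coendAlgebra A).F ≫ (coendAlgebra A).ω =
            Y ◁ e.hom ≫ (g ≫ e.hom) ▷ D.F ≫ D.ω := by
          rw [hω, MonoidalCategory.tensorHom_def', Category.assoc, ← whisker_exchange_assoc,
            MonoidalCategory.comp_whiskerRight, Category.assoc]
        rw [← Category.assoc, Q.ann, h, ← cancel_epi (Y ◁ e.hom), Limits.comp_zero]
      mul := Q.mul
      mul_spec := by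
        rw [← Category.assoc, hmul, ← MonoidalCategory.tensorHom_comp_tensorHom, Category.assoc,
          Q.mul_spec, Category.assoc]
      counit := Q.counit
      counit_spec := by rw [Category.assoc, Q.counit_spec, hcounit]
      Ω := Q.Ω
      Ω_spec := fun X => by
        rw [MonoidalCategory.comp_whiskerRight, Category.assoc, Q.Ω_spec, ← Category.assoc, ← hΩ,
          Category.assoc] }
  have hσ' : (σ ≫ e.inv) ≫ Q'.π = σ ≫ Q.π := by
    change (σ ≫ e.inv) ≫ e.hom ≫ Q.π = _
    rw [Category.assoc, Iso.inv_hom_id_assoc]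
  refine ⟨Q', T, σ ≫ e.inv, ?_, ⟨?_, ?_⟩, hσ'.symm ▸ ⟨hμ.1, hμ.2, hμ.3⟩⟩
  · change coendTwist A ≫ e.hom ≫ Q.π = (e.hom ≫ Q.π) ≫ T
    rw [← Category.assoc, hTw, Category.assoc, hT, Category.assoc]
  · rw [← cancel_mono e.hom, Category.assoc, hmul, MonoidalCategory.tensorHom_def_assoc,
      whisker_exchange_assoc, ← MonoidalCategory.whiskerLeft_comp_assoc, Category.assoc,
      Iso.inv_hom_id, Category.comp_id, hσ.1, MonoidalCategory.rightUnitor_naturality_assoc,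
      hcounit]
    simp only [Category.assoc, Iso.inv_hom_id, Category.comp_id]
  · rw [← cancel_mono e.hom, Category.assoc, hmul, MonoidalCategory.tensorHom_def'_assoc,
      ← whisker_exchange_assoc, ← MonoidalCategory.comp_whiskerRight_assoc, Category.assoc,
      Iso.inv_hom_id, Category.comp_id, hσ.2, MonoidalCategory.leftUnitor_naturality_assoc,
      hcounit]
    simp only [Category.assoc, Iso.inv_hom_id, Category.comp_id]

/-- A quotient of the coend by the annihilator of its pairing is the restriction of functionals
to `𝔲`. -/
lemma π_lin_eq_zero_iff (Q : (coendAlgebra A).QuotientAlgebra) (f : Module.Dual k H) :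
    Q.π.lin f = 0 ↔ sliceLeft f A.monodromy = 0 := by
  let g : regular A ⟶ coendObj A := ofElement (coendObj A) f
  have h1 : g.lin (1 : H) = f := LinearMap.congr_fun (map_one (actCoadjoint A)) f
  have h2 := (Q.ann g).trans (whiskerRight_ω_eq_zero_iff g)
  constructor
  · intro h
    rw [← h1]
    refine h2.1 (hom_ext (LinearMap.ext fun a => ?_)) (1 : H)
    refine (Q.π.comm a f).trans ?_
    rw [h, map_zero]
    rfl
  · intro h
    have h3 : g ≫ Q.π = 0 := h2.2 fun a => by
      rw [← curryPairing_ω_lin_eq_zero_iff] at h ⊢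
      refine ((curryPairing (coendAlgebra A).ω).comm a f).trans ?_
      rw [h, map_zero]
    rw [← h1]
    exact congrArg (fun φ => Hom.lin φ (1 : H)) h3

end HMod

/-! ### The criterion -/

namespace RibbonHopfAlgebra

variable {k H : Type u} [Field k] [Ring H] [HopfAlgebra k H] [FiniteDimensional k H]
  {A : RibbonHopfAlgebra k H} {I : Module.Dual k H}

open RibbonHopf.HMod

lemma isThreeModular_of_conditions (hk : ∀ a : k, IsSquare a) (hI : IsLeftIntegral k I)
    (hν : A.ν ∈ A.uSubspace) (hinv : IsInvariant k I) (h3 : sliceLeft I A.monodromy ≠ 0) :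
    A.IsThreeModular where
  noetherian := isNoetherianObject
  finite_hom := finiteDimensional_hom
  end_unit := bijective_smul_id_unit
  ribbon := isRibbonTwist_twist
  modular := by
    obtain ⟨Q, hQ, hker⟩ := exists_quotientAlgebra A
    obtain ⟨T, hT⟩ := exists_comp_eq Q.π hQ (coendTwist A ≫ Q.π) fun f hf => by
      refine (hker _).2 ?_
      rw [hker, ← A.forall_mem_uSubspace_eq_zero_iff] at hf
      exact (A.forall_mem_uSubspace_eq_zero_iff _).1 fun x hx => hf _ (A.mul_mem_uSubspace hν hx)
    exact ⟨coendAlgebra A, Q, coendTwist A, T, isTwist_coendTwist, hT.symm,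
      exists_isNormalizedIntegral hk hI hν hinv h3 Q hQ T hT.symm⟩

lemma IsThreeModular.conditions (h : A.IsThreeModular) (hI : IsLeftIntegral k I) :
    A.ν ∈ A.uSubspace ∧ IsInvariant k I ∧ sliceLeft I A.monodromy ≠ 0 := by
  obtain ⟨D, Q, TF, T, hTF, hT, _, lam, σ, hμ, hσ, rfl⟩ := h.modular
  obtain ⟨Q, T, σ, hT, hσ, hμ⟩ := exists_quotientAlgebra_transport D Q TF T hTF hT σ hσ lam hμ
  have hker := π_lin_eq_zero_iff Q
  -- as `1 ∈ 𝔲`, a functional `f` vanishing on `𝔲` has `f(ν) = (T f)(1) = 0`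
  have hν : A.ν ∈ A.uSubspace := by
    rw [← Subspace.forall_mem_dualAnnihilator_apply_eq_zero_iff]
    intro f hf
    have h1 : Q.π.lin f = 0 := (hker f).2
      ((A.forall_mem_uSubspace_eq_zero_iff f).1 ((Submodule.mem_dualAnnihilator f).1 hf))
    have h2 : Q.π.lin ((coendTwist A).lin f) = 0 := by
      refine (congrArg (fun φ => Hom.lin φ f) hT).trans ?_
      refine (congrArg T.lin h1).trans (map_zero _)
    have h3 := (A.forall_mem_uSubspace_eq_zero_iff _).2 ((hker _).1 h2) 1 A.one_mem_uSubspace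
    rw [coendTwist_lin_apply] at h3
    simpa using h3
  -- otherwise `μ = 0`, and the loop coloured by `T μ` would vanish on the unit
  have hs : sliceLeft (functionalOf σ) A.monodromy ≠ 0 := by
    intro h0
    have h1 : σ ≫ Q.π = 0 := by
      refine HMod.hom_ext (LinearMap.ext_ring ?_)
      exact (hker _).2 h0
    have h2 := hμ.loop_T (𝟙_ (HMod A))
    rw [h1, CoendAlgebra.QuotientAlgebra.loop] at h2
    simp only [Limits.zero_comp, MonoidalPreadditive.zero_whiskerRight] at h2
    have h3 : (0 : k) = (lam : k) * (1 * 1) :=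
      congrArg (fun φ => Hom.lin φ ((1 : k) ⊗ₜ[k] (1 : k))) h2
    exact lam.ne_zero (by simpa using h3.symm)
  obtain ⟨c, hc⟩ := hI.exists_eq_smul A ((isTwoSidedIntegral_iff σ).1 hσ)
  have hc0 : c ≠ 0 := by
    rintro rfl
    rw [hc, sliceLeft_smul, zero_smul] at hs
    exact hs rfl
  have hI' : I = c⁻¹ • functionalOf σ := by rw [hc, smul_smul, inv_mul_cancel₀ hc0, one_smul]
  refine ⟨hν, ?_, fun h0 => hs ?_⟩
  · rw [hI']
    exact (isInvariant_functionalOf σ).smul _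
  · rw [hc, sliceLeft_smul, LinearMap.smul_apply, h0, smul_zero]

end RibbonHopfAlgebra

end RibbonHopf

end

theorem mainTheorem7 {k H : Type u} [Field k] [Ring H] [HopfAlgebra k H] [FiniteDimensional k H]
    (hk : ∀ a : k, IsSquare a) (A : RibbonHopf.RibbonHopfAlgebra k H)
    (I : Module.Dual k H) (hI : RibbonHopf.IsLeftIntegral k I) :
    (A.IsThreeModular ↔
      A.ν ∈ A.uSubspace ∧
      (∀ x y : H, I (x * y) = I (y * HopfAlgebra.antipode k (HopfAlgebra.antipode k x))) ∧
      A.integralOfMonodromy I ≠ 0) ∧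
    ((∀ x y : H, I (x * y) = I (y * HopfAlgebra.antipode k (HopfAlgebra.antipode k x))) ↔
      RibbonHopf.IsUnimodular k H) :=
  ⟨⟨fun h => h.conditions hI, fun ⟨hν, hinv, h3⟩ =>
    RibbonHopf.RibbonHopfAlgebra.isThreeModular_of_conditions hk hI hν hinv h3⟩,
    hI.forall_mul_antipode_antipode_iff_isUnimodular A⟩
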